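/- Let $\sigma, C\in\mathbb R$ with $C>0$, $\sigma\neq 0$, $\sigma\neq\tfrac12$, let $M\in\mathbb R$ and put $\alpha=(2\sigma-1)^2$. Consider the Levi-Civita spacetime $$ds^2=r^{4\sigma}dt^2-r^{8\sigma^2-4\sigma}(dr^2+dz^2)-\frac{r^{2-4\sigma}}{C^2}\,d\theta^2,\qquad r>0,\ z\in\mathbb R,\ \theta\in\mathbb R/2\pi\mathbb Z,$$ with static slice $\Sigma$, spatial metric $h$ (positive definite), lapse $N=r^{2\sigma}$, and spatial Klein–Gordon operator $Af=-N D^i(N D_i f)+N^2M^2f$ for a scalar particle of mass $M$, acting in $L^2(\Sigma,N^{-1}d\mathrm{vol}_h)$ with domain $C_0^\infty(\Sigma)$. The spacetime is called quantum mechanically singular if $A$ is not essentially self-adjoint. For $k\in\mathbb R$, $m\in\mathbb Z$ define on $(0,\infty)$ $$V_{k,m}(x)=\frac{Ck^2}{\alpha}(\alpha Cx^2)^{\frac{1-\alpha}{\alpha}}+\frac{CM^2}{\alpha}(\alpha Cx^2)^{\frac{2\sigma}{\alpha}}+\frac{m^2C^3}{\alpha}(\alpha Cx^2)^{\frac{4\sigma-1}{\alpha}}-\frac1{4x^2}.$$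 A continuous potential $V$ on $(0,\infty)$ is in the limit circle case at $0$ (at $\infty$) if for some $E\in\mathbb C$ all solutions of $-\psi''+V\psi=E\psi$ on $(0,\infty)$ are square integrable near $0$ (near $\infty$), and in the limit point case there otherwise. Then the following hold. (1) Let $k\in\mathbb R$, $m\in\mathbb Z$. (a) For every $\lambda\in\mathbb C$ and $R:(0,\infty)\to\mathbb C$: $R$ is twice continuously differentiable and $A(Re^{ikz}e^{im\theta})=\lambda Re^{ikz}e^{im\theta}$ on $\Sigma$ if and only if $\psi(x)=\sqrt x\,R\big((\alpha Cx^2)^{1/(2\alpha)}\big)$ is a twice differentiable solution of $-\psi''+V_{k,m}\psi=\frac{C\lambda}{\alpha}\psi$ on $(0,\infty)$. (b) $V_{k,m}$ is in the limit point case at infinity. (c) $V_{k,m}(x)\sim-\frac1{4x^2}$ as $x\to0^+$. (d) $V_{k,m}$ is in the limit circle case at $0$. (e) The operator $-\frac{d^2}{dx^2}+V_{k,m}$ with domain $C_0^\infty(0,\infty)$ is not essentially self-adjoint in $L^2(0,\infty)$. (2) For every $R:(0,\infty)\to\mathbb C$, with $\psi(x)=\sqrt x\,R\big((\alpha Cx^2)^{1/(2\alpha)}\big)$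 as in (1a), $\int_0^\infty \frac{\sqrt{\det h}}{N}|R|^2\,dr=\int_0^\infty|\psi|^2\,dx$ (with values in $[0,\infty]$, and as lower Lebesgue integrals if $R$ is not measurable). (3) The solutions on $(0,\infty)$ of the limiting equation $\psi''+\frac1{4x^2}\psi=0$ are exactly the functions $c_1x^{1/2}+c_2x^{1/2}\ln x$ with uniquely determined $c_1,c_2\in\mathbb C$, and both $x^{1/2}$ and $x^{1/2}\ln x$ are square integrable near $0$. (4) The spacetime is quantum mechanically singular: $A$ with domain $C_0^\infty(\Sigma)$ is not essentially self-adjoint. -/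

import Mathlib

open Set Filter Topology MeasureTheory
open scoped ContDiff

noncomputable section

namespace LeviCivita

/-! ### Operators on `L²` given by their action on a space of test functions -/

/-- An operator `T` with domain in a Hilbert space is essentially self-adjoint if its closure is
self-adjoint. -/
def IsEssentiallySelfAdjoint {H : Type*} [NormedAddCommGroup H] [InnerProductSpace ℂ H]
    [CompleteSpace H] (T : H →ₗ.[ℂ] H) : Prop :=
  IsSelfAdjoint T.closure

section Operator

variable {X : Type*} [MeasurableSpace X] {μ : Measure X}

/-- The map sending a function of the space `D` to its class in `L²(μ)`. -/
def toL2 (D : Submodule ℂ (X → ℂ)) (B : D →ₗ[ℂ] (X → ℂ)) (hB : ∀ f : D, MemLp (B f) 2 μ) :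
    D →ₗ[ℂ] Lp ℂ 2 μ where
  toFun f := (hB f).toLp (B f)
  map_add' f g := by
    rw [← MemLp.toLp_add, MemLp.toLp_eq_toLp_iff, map_add]
  map_smul' c f := by
    rw [RingHom.id_apply, ← MemLp.toLp_const_smul, MemLp.toLp_eq_toLp_iff, map_smul]

theorem toL2_subtype_injective (D : Submodule ℂ (X → ℂ)) (hD : ∀ f : D, MemLp (D.subtype f) 2 μ)
    (hinj : ∀ f ∈ D, f =ᵐ[μ] 0 → f = 0) : Function.Injective (toL2 D D.subtype hD) := by
  rw [← LinearMap.ker_eq_bot, LinearMap.ker_eq_bot']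
  intro f hf
  have h : (hD f).toLp (D.subtype f) = 0 := hf
  rw [Lp.eq_zero_iff_ae_eq_zero] at h
  exact Subtype.ext (hinj f f.2 ((hD f).coeFn_toLp.symm.trans h))

/-- The unbounded operator on `L²(μ)` whose domain consists of the classes of the functions in `D`
and which sends the class of `f` to the class of `B f`. -/
def l2Operator (D : Submodule ℂ (X → ℂ)) (hD : ∀ f : D, MemLp (D.subtype f) 2 μ)
    (hinj : ∀ f ∈ D, f =ᵐ[μ] 0 → f = 0) (B : D →ₗ[ℂ] (X → ℂ))
    (hB : ∀ f : D, MemLp (B f) 2 μ) : Lp ℂ 2 μ →ₗ.[ℂ] Lp ℂ 2 μ where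
  domain := LinearMap.range (toL2 D D.subtype hD)
  toFun := (toL2 D B hB).comp
    (LinearEquiv.ofInjective _ (toL2_subtype_injective D hD hinj)).symm.toLinearMap

theorem l2Operator_apply (D : Submodule ℂ (X → ℂ)) (hD : ∀ f : D, MemLp (D.subtype f) 2 μ)
    (hinj : ∀ f ∈ D, f =ᵐ[μ] 0 → f = 0) (B : D →ₗ[ℂ] (X → ℂ))
    (hB : ∀ f : D, MemLp (B f) 2 μ) (f : D) :
    l2Operator D hD hinj B hB ⟨toL2 D D.subtype hD f, LinearMap.mem_range_self _ f⟩
      = (hB f).toLp (B f) := by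
  have h : (LinearEquiv.ofInjective _ (toL2_subtype_injective D hD hinj)).symm
      ⟨toL2 D D.subtype hD f, LinearMap.mem_range_self _ f⟩ = f :=
    (LinearEquiv.symm_apply_eq _).2 rfl
  change toL2 D B hB _ = _
  erw [h]
  rfl

end Operator

/-! ### One-dimensional Schrödinger operators on `(0, ∞)` -/

/-- `ψ` is a (twice differentiable) solution of `-ψ'' + V ψ = E ψ` on `(0, ∞)`. -/
def IsSolution (V : ℝ → ℝ) (E : ℂ) (ψ : ℝ → ℂ) : Prop :=
  ∃ φ : ℝ → ℂ, ∀ x : ℝ, 0 < x →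
    HasDerivAt ψ (φ x) x ∧ HasDerivAt φ (((V x : ℂ) - E) * ψ x) x

/-- Square integrability at zero. -/
def SquareIntegrableAtZero (ψ : ℝ → ℂ) : Prop :=
  ∃ c : ℝ, 0 < c ∧ MemLp ψ 2 (volume.restrict (Ioo 0 c))

/-- Square integrability at infinity. -/
def SquareIntegrableAtInfinity (ψ : ℝ → ℂ) : Prop :=
  ∃ c : ℝ, 0 < c ∧ MemLp ψ 2 (volume.restrict (Ioi c))

/-- `V` is in the limit circle case at `0`: for some `E`, all solutions of `-ψ'' + V ψ = E ψ` are
square integrable at zero. -/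
def LimitCircleAtZero (V : ℝ → ℝ) : Prop :=
  ∃ E : ℂ, ∀ ψ : ℝ → ℂ, IsSolution V E ψ → SquareIntegrableAtZero ψ

/-- `V` is in the limit circle case at `∞`. -/
def LimitCircleAtInfinity (V : ℝ → ℝ) : Prop :=
  ∃ E : ℂ, ∀ ψ : ℝ → ℂ, IsSolution V E ψ → SquareIntegrableAtInfinity ψ

/-- `V` is in the limit point case at `∞`: it is not in the limit circle case there. -/
def LimitPointAtInfinity (V : ℝ → ℝ) : Prop := ¬ LimitCircleAtInfinity V

/-- The test functions `C₀^∞(0, ∞)`. -/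
def halfLineTest : Submodule ℂ (ℝ → ℂ) where
  carrier := {f | ContDiff ℝ ∞ f ∧ ∃ K : Set ℝ, IsCompact K ∧ K ⊆ Ioi 0 ∧ ∀ x ∉ K, f x = 0}
  zero_mem' := ⟨contDiff_const, ∅, isCompact_empty, empty_subset _, fun _ _ => rfl⟩
  add_mem' := by
    rintro f g ⟨hf, K, hK, hK0, hfK⟩ ⟨hg, L, hL, hL0, hgL⟩
    refine ⟨hf.add hg, K ∪ L, hK.union hL, union_subset hK0 hL0, fun x hx => ?_⟩
    rw [mem_union, not_or] at hx
    simp [hfK x hx.1, hgL x hx.2]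
  smul_mem' := by
    rintro c f ⟨hf, K, hK, hK0, hfK⟩
    refine ⟨contDiff_const.smul hf, K, hK, hK0, fun x hx => ?_⟩
    simp [hfK x hx]

theorem halfLine_memLp {f : ℝ → ℂ} {K : Set ℝ} (hK : IsCompact K) (hf : ContinuousOn f (Ioi 0))
    (hK0 : K ⊆ Ioi 0) (hfK : ∀ x ∉ K, f x = 0) : MemLp f 2 (volume.restrict (Ioi 0)) := by
  have hcont : Continuous f := by
    rw [continuous_iff_continuousAt]
    intro x
    by_cases hx : x ∈ K
    · exact hf.continuousAt (isOpen_Ioi.mem_nhds (hK0 hx))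
    · have : f =ᶠ[𝓝 x] fun _ => 0 := by
        filter_upwards [hK.isClosed.isOpen_compl.mem_nhds hx] with y hy using hfK y hy
      exact (continuousAt_congr this).2 continuousAt_const
  exact (hcont.memLp_of_hasCompactSupport (HasCompactSupport.intro hK hfK))

theorem deriv_eq_zero_of_notMem {f : ℝ → ℂ} {K : Set ℝ} (hK : IsClosed K)
    (hfK : ∀ x ∉ K, f x = 0) : ∀ x ∉ K, deriv f x = 0 := by
  intro x hx
  have : f =ᶠ[𝓝 x] fun _ => 0 := by
    filter_upwards [hK.isOpen_compl.mem_nhds hx] with y hy using hfK y hy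
  rw [this.deriv_eq, deriv_const]

theorem contDiff_deriv {f : ℝ → ℂ} (hf : ContDiff ℝ ∞ f) : ContDiff ℝ ∞ (deriv f) :=
  (contDiff_infty_iff_deriv.1 hf).2

/-- The action `f ↦ -f'' + V f` on test functions. -/
def schrodingerAction (V : ℝ → ℝ) : halfLineTest →ₗ[ℂ] (ℝ → ℂ) where
  toFun f := fun x => -deriv (deriv (f : ℝ → ℂ)) x + (V x : ℂ) * (f : ℝ → ℂ) x
  map_add' f g := by
    have hf := f.2.1
    have hg := g.2.1
    have h1 : deriv ((f : ℝ → ℂ) + (g : ℝ → ℂ)) = deriv (f : ℝ → ℂ) + deriv (g : ℝ → ℂ) := by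
      funext x
      exact deriv_add (hf.differentiable (by simp) x) (hg.differentiable (by simp) x)
    funext x
    have h2 : deriv (deriv (f : ℝ → ℂ) + deriv (g : ℝ → ℂ)) x
        = deriv (deriv (f : ℝ → ℂ)) x + deriv (deriv (g : ℝ → ℂ)) x :=
      deriv_add ((contDiff_deriv hf).differentiable (by simp) x)
        ((contDiff_deriv hg).differentiable (by simp) x)
    simp only [Submodule.coe_add, h1, h2, Pi.add_apply]
    ring
  map_smul' c f := by
    have hf := f.2.1
    have h1 : deriv (c • (f : ℝ → ℂ)) = c • deriv (f : ℝ → ℂ) := by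
      funext x
      exact deriv_const_smul c (hf.differentiable (by simp) x)
    funext x
    have h2 : deriv (c • deriv (f : ℝ → ℂ)) x = c • deriv (deriv (f : ℝ → ℂ)) x :=
      deriv_const_smul c ((contDiff_deriv hf).differentiable (by simp) x)
    simp only [Submodule.coe_smul, h1, h2, Pi.smul_apply, smul_eq_mul, RingHom.id_apply]
    ring

/-- The operator `H = -d²/dx² + V(x)` in `L²(0, ∞)` with domain `C₀^∞(0, ∞)`. -/
def schrodingerOperator (V : ℝ → ℝ) (hV : ContinuousOn V (Ioi 0)) :
    Lp ℂ 2 (volume.restrict (Ioi (0 : ℝ))) →ₗ.[ℂ] Lp ℂ 2 (volume.restrict (Ioi (0 : ℝ))) :=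
  l2Operator halfLineTest
    (fun f => by
      obtain ⟨hf, K, hK, hK0, hfK⟩ := f.2
      exact halfLine_memLp hK hf.continuous.continuousOn hK0 hfK)
    (fun f hf h => by
      obtain ⟨hf, K, hK, hK0, hfK⟩ := hf
      have h0 : EqOn f 0 (Ioi 0) := Measure.eqOn_open_of_ae_eq h isOpen_Ioi
        hf.continuous.continuousOn continuousOn_const
      funext x
      by_cases hx : x ∈ K
      · exact h0 (hK0 hx)
      · exact hfK x hx)
    (schrodingerAction V)
    (fun f => by
      obtain ⟨hf, K, hK, hK0, hfK⟩ := f.2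
      refine halfLine_memLp hK ?_ hK0 ?_
      · exact ((contDiff_deriv (contDiff_deriv hf)).continuous.continuousOn.neg).add
          ((Complex.continuous_ofReal.comp_continuousOn hV).mul hf.continuous.continuousOn)
      · intro x hx
        have h1 := deriv_eq_zero_of_notMem hK.isClosed
          (deriv_eq_zero_of_notMem hK.isClosed hfK) x hx
        change -deriv (deriv (f : ℝ → ℂ)) x + (V x : ℂ) * (f : ℝ → ℂ) x = 0
        rw [h1, hfK x hx]
        simp)

/-! ### The Levi-Civita metric
`ds² = r^{4σ} dt² - r^{8σ²-4σ} (dr² + dz²) - (r^{2-4σ} / C²) dθ²`.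
Points of the static slice are written in the coordinates `(r, z, θ)`, with `0 < r` and `θ` taken
modulo `2π`. -/

/-- `V = √(g_tt)`, the norm of the static Killing field. -/
def lapse (σ r : ℝ) : ℝ := √(r ^ (4 * σ))

/-- The component `h_rr = h_zz` of the spatial metric. -/
def hrr (σ r : ℝ) : ℝ := r ^ (8 * σ ^ 2 - 4 * σ)

/-- The component `h_θθ` of the spatial metric. -/
def hθθ (σ C r : ℝ) : ℝ := r ^ (2 - 4 * σ) / C ^ 2

/-- The square root of the determinant of the spatial metric. -/
def sqrtDet (σ C r : ℝ) : ℝ := √(hrr σ r * hrr σ r * hθθ σ C r)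

/-- Partial derivative with respect to `r`. -/
def dR (f : ℝ × ℝ × ℝ → ℂ) : ℝ × ℝ × ℝ → ℂ :=
  fun p => deriv (fun s => f (s, p.2.1, p.2.2)) p.1

/-- Partial derivative with respect to `z`. -/
def dZ (f : ℝ × ℝ × ℝ → ℂ) : ℝ × ℝ × ℝ → ℂ :=
  fun p => deriv (fun s => f (p.1, s, p.2.2)) p.2.1

/-- Partial derivative with respect to `θ`. -/
def dT (f : ℝ × ℝ × ℝ → ℂ) : ℝ × ℝ × ℝ → ℂ :=
  fun p => deriv (fun s => f (p.1, p.2.1, s)) p.2.2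

/-- Multiplication by a real function of `r`. -/
def mulR (c : ℝ → ℝ) (f : ℝ × ℝ × ℝ → ℂ) : ℝ × ℝ × ℝ → ℂ := fun p => (c p.1 : ℂ) * f p

/-- The operator `f ↦ V D^i (V D_i f)` on the static slice, written out in coordinates as
`(V / √h) ∂_i (√h h^{ij} V ∂_j f)`. -/
def weightedLaplacian (σ C : ℝ) (f : ℝ × ℝ × ℝ → ℂ) : ℝ × ℝ × ℝ → ℂ :=
  mulR (fun r => lapse σ r / sqrtDet σ C r)
    (dR (mulR (fun r => sqrtDet σ C r * (hrr σ r)⁻¹ * lapse σ r) (dR f))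
      + dZ (mulR (fun r => sqrtDet σ C r * (hrr σ r)⁻¹ * lapse σ r) (dZ f))
      + dT (mulR (fun r => sqrtDet σ C r * (hθθ σ C r)⁻¹ * lapse σ r) (dT f)))

/-- The spatial Klein–Gordon operator `A f = -V D^i (V D_i f) + V² M² f` for mass `M`. -/
def kleinGordon (σ C M : ℝ) (f : ℝ × ℝ × ℝ → ℂ) : ℝ × ℝ × ℝ → ℂ :=
  -weightedLaplacian σ C f + mulR (fun r => lapse σ r ^ 2 * M ^ 2) f

/-- The measure on the static slice: `V⁻¹` times the natural volume element `√h dr dz dθ`, on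
`0 < r`, `z ∈ ℝ`, `0 < θ ≤ 2π`. -/
def sliceMeasure (σ C : ℝ) : Measure (ℝ × ℝ × ℝ) :=
  (volume.restrict (Ioi (0 : ℝ) ×ˢ ((univ : Set ℝ) ×ˢ Ioc (0 : ℝ) (2 * Real.pi)))).withDensity
    (fun p => ENNReal.ofReal (sqrtDet σ C p.1 / lapse σ p.1))

/-- The test functions `C₀^∞` of the static slice, as functions of `(r, z, θ)` that are smooth,
`2π`-periodic in `θ`, and vanish when `(r, z)` lies outside a compact subset of `(0, ∞) × ℝ`. -/
def sliceTest : Submodule ℂ (ℝ × ℝ × ℝ → ℂ) where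
  carrier := {f | ContDiff ℝ ∞ f ∧ (∀ r z θ, f (r, z, θ + 2 * Real.pi) = f (r, z, θ)) ∧
    ∃ K : Set (ℝ × ℝ), IsCompact K ∧ (∀ q ∈ K, 0 < q.1) ∧ ∀ r z θ, (r, z) ∉ K → f (r, z, θ) = 0}
  zero_mem' := ⟨contDiff_const, fun _ _ _ => rfl, ∅, isCompact_empty, by simp,
    fun _ _ _ _ => rfl⟩
  add_mem' := by
    rintro f g ⟨hf, pf, K, hK, hK0, hfK⟩ ⟨hg, pg, L, hL, hL0, hgL⟩
    refine ⟨hf.add hg, fun r z θ => by simp [pf, pg], K ∪ L, hK.union hL, ?_, ?_⟩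
    · rintro q (hq | hq)
      exacts [hK0 q hq, hL0 q hq]
    · intro r z θ hx
      rw [mem_union, not_or] at hx
      simp [hfK r z θ hx.1, hgL r z θ hx.2]
  smul_mem' := by
    rintro c f ⟨hf, pf, K, hK, hK0, hfK⟩
    refine ⟨contDiff_const.smul hf, fun r z θ => by simp [pf], K, hK, hK0, fun r z θ hx => ?_⟩
    simp [hfK r z θ hx]

theorem dR_eq {f : ℝ × ℝ × ℝ → ℂ} (hf : Differentiable ℝ f) (p : ℝ × ℝ × ℝ) :
    dR f p = fderiv ℝ f p (1, 0, 0) := by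
  have h : HasDerivAt (fun s : ℝ => (s, p.2.1, p.2.2)) ((1 : ℝ), (0 : ℝ), (0 : ℝ)) p.1 :=
    (hasDerivAt_id _).prodMk ((hasDerivAt_const _ _).prodMk (hasDerivAt_const _ _))
  exact ((hf p).hasFDerivAt.comp_hasDerivAt p.1 h).deriv

theorem dZ_eq {f : ℝ × ℝ × ℝ → ℂ} (hf : Differentiable ℝ f) (p : ℝ × ℝ × ℝ) :
    dZ f p = fderiv ℝ f p (0, 1, 0) := by
  have h : HasDerivAt (fun s : ℝ => (p.1, s, p.2.2)) ((0 : ℝ), (1 : ℝ), (0 : ℝ)) p.2.1 :=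
    (hasDerivAt_const _ _).prodMk ((hasDerivAt_id _).prodMk (hasDerivAt_const _ _))
  exact ((hf p).hasFDerivAt.comp_hasDerivAt p.2.1 h).deriv

theorem dT_eq {f : ℝ × ℝ × ℝ → ℂ} (hf : Differentiable ℝ f) (p : ℝ × ℝ × ℝ) :
    dT f p = fderiv ℝ f p (0, 0, 1) := by
  have h : HasDerivAt (fun s : ℝ => (p.1, p.2.1, s)) ((0 : ℝ), (0 : ℝ), (1 : ℝ)) p.2.2 :=
    (hasDerivAt_const _ _).prodMk ((hasDerivAt_const _ _).prodMk (hasDerivAt_id _))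
  exact ((hf p).hasFDerivAt.comp_hasDerivAt p.2.2 h).deriv

theorem sliceTest_differentiable {f : ℝ × ℝ × ℝ → ℂ} (hf : f ∈ sliceTest) : Differentiable ℝ f :=
  hf.1.differentiable (by simp)

/-- A directional derivative with constant direction preserves the test functions. -/
theorem fderiv_mem {f : ℝ × ℝ × ℝ → ℂ} (hf : f ∈ sliceTest) (v : ℝ × ℝ × ℝ) :
    (fun p => fderiv ℝ f p v) ∈ sliceTest := by
  obtain ⟨hs, pf, K, hK, hK0, hfK⟩ := hf
  refine ⟨(hs.fderiv_right (m := ∞) (by simp)).clm_apply contDiff_const, ?_, K, hK, hK0, ?_⟩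
  · intro r z θ
    have h1 : (fun p : ℝ × ℝ × ℝ => f (p + (0, 0, 2 * Real.pi))) = f := by
      funext p
      obtain ⟨a, b, c⟩ := p
      simp [pf]
    have h2 := fderiv_comp_add_right (𝕜 := ℝ) (f := f) (x := (r, z, θ))
      ((0 : ℝ), (0 : ℝ), 2 * Real.pi)
    rw [h1] at h2
    simp only [Prod.mk_add_mk, add_zero] at h2
    exact congrArg (fun L => L v) h2.symm
  · intro r z θ hx
    have hU : IsOpen {p : ℝ × ℝ × ℝ | (p.1, p.2.1) ∉ K} :=
      hK.isClosed.isOpen_compl.preimage (by fun_prop : Continuous fun p : ℝ × ℝ × ℝ => (p.1, p.2.1))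
    have : f =ᶠ[𝓝 (r, z, θ)] fun _ => 0 := by
      filter_upwards [hU.mem_nhds hx] with p hp using hfK p.1 p.2.1 p.2.2 hp
    change fderiv ℝ f (r, z, θ) v = 0
    rw [this.fderiv_eq]
    simp

theorem dR_mem {f : ℝ × ℝ × ℝ → ℂ} (hf : f ∈ sliceTest) : dR f ∈ sliceTest := by
  rw [funext (dR_eq (sliceTest_differentiable hf))]
  exact fderiv_mem hf _

theorem dZ_mem {f : ℝ × ℝ × ℝ → ℂ} (hf : f ∈ sliceTest) : dZ f ∈ sliceTest := by
  rw [funext (dZ_eq (sliceTest_differentiable hf))]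
  exact fderiv_mem hf _

theorem dT_mem {f : ℝ × ℝ × ℝ → ℂ} (hf : f ∈ sliceTest) : dT f ∈ sliceTest := by
  rw [funext (dT_eq (sliceTest_differentiable hf))]
  exact fderiv_mem hf _

theorem mulR_mem {c : ℝ → ℝ} (hc : ContDiffOn ℝ ∞ c (Ioi 0)) {f : ℝ × ℝ × ℝ → ℂ}
    (hf : f ∈ sliceTest) : mulR c f ∈ sliceTest := by
  obtain ⟨hs, pf, K, hK, hK0, hfK⟩ := hf
  refine ⟨?_, fun r z θ => by simp [mulR, pf], K, hK, hK0,
    fun r z θ hx => by simp [mulR, hfK r z θ hx]⟩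
  rw [contDiff_iff_contDiffAt]
  intro p
  by_cases hp : (p.1, p.2.1) ∈ K
  · have h1 : ContDiffAt ℝ ∞ c p.1 := hc.contDiffAt (isOpen_Ioi.mem_nhds (hK0 _ hp))
    have h2 : ContDiffAt ℝ ∞ (fun q : ℝ × ℝ × ℝ => c q.1) p :=
      ContDiffAt.comp p h1 contDiffAt_fst
    exact (Complex.ofRealCLM.contDiff.contDiffAt.comp p h2).mul hs.contDiffAt
  · have hU : IsOpen {p : ℝ × ℝ × ℝ | (p.1, p.2.1) ∉ K} :=
      hK.isClosed.isOpen_compl.preimage (by fun_prop : Continuous fun p : ℝ × ℝ × ℝ => (p.1, p.2.1))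
    have : mulR c f =ᶠ[𝓝 p] fun _ => 0 := by
      filter_upwards [hU.mem_nhds hp] with q hq
      have := hfK q.1 q.2.1 q.2.2 hq
      simp only [mulR, Prod.mk.eta] at this ⊢
      simp [this]
    exact contDiffAt_const.congr_of_eventuallyEq this

theorem dR_add {f g : ℝ × ℝ × ℝ → ℂ} (hf : f ∈ sliceTest) (hg : g ∈ sliceTest) :
    dR (f + g) = dR f + dR g := by
  have h1 := sliceTest_differentiable hf
  have h2 := sliceTest_differentiable hg
  funext p
  rw [Pi.add_apply, dR_eq h1, dR_eq h2, dR_eq (h1.add h2), fderiv_add (h1 p) (h2 p)]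
  rfl

theorem dZ_add {f g : ℝ × ℝ × ℝ → ℂ} (hf : f ∈ sliceTest) (hg : g ∈ sliceTest) :
    dZ (f + g) = dZ f + dZ g := by
  have h1 := sliceTest_differentiable hf
  have h2 := sliceTest_differentiable hg
  funext p
  rw [Pi.add_apply, dZ_eq h1, dZ_eq h2, dZ_eq (h1.add h2), fderiv_add (h1 p) (h2 p)]
  rfl

theorem dT_add {f g : ℝ × ℝ × ℝ → ℂ} (hf : f ∈ sliceTest) (hg : g ∈ sliceTest) :
    dT (f + g) = dT f + dT g := by
  have h1 := sliceTest_differentiable hf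
  have h2 := sliceTest_differentiable hg
  funext p
  rw [Pi.add_apply, dT_eq h1, dT_eq h2, dT_eq (h1.add h2), fderiv_add (h1 p) (h2 p)]
  rfl

theorem dR_smul (c : ℂ) (f : ℝ × ℝ × ℝ → ℂ) : dR (c • f) = c • dR f := by
  funext p
  exact deriv_const_smul_field c (fun s => f (s, p.2.1, p.2.2))

theorem dZ_smul (c : ℂ) (f : ℝ × ℝ × ℝ → ℂ) : dZ (c • f) = c • dZ f := by
  funext p
  exact deriv_const_smul_field c (fun s => f (p.1, s, p.2.2))

theorem dT_smul (c : ℂ) (f : ℝ × ℝ × ℝ → ℂ) : dT (c • f) = c • dT f := by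
  funext p
  exact deriv_const_smul_field c (fun s => f (p.1, p.2.1, s))

theorem mulR_add (c : ℝ → ℝ) (f g : ℝ × ℝ × ℝ → ℂ) : mulR c (f + g) = mulR c f + mulR c g := by
  funext p
  simp only [mulR, Pi.add_apply]
  ring

theorem mulR_smul (c : ℝ → ℝ) (a : ℂ) (f : ℝ × ℝ × ℝ → ℂ) :
    mulR c (a • f) = a • mulR c f := by
  funext p
  simp only [mulR, Pi.smul_apply, smul_eq_mul]
  ring

theorem contDiffOn_rpow (a : ℝ) : ContDiffOn ℝ ∞ (fun r : ℝ => r ^ a) (Ioi 0) :=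
  contDiffOn_id.rpow_const_of_ne fun _ hx => (mem_Ioi.1 hx).ne'

theorem hrr_pos (σ : ℝ) {r : ℝ} (hr : 0 < r) : 0 < hrr σ r := Real.rpow_pos_of_pos hr _

theorem hθθ_pos (σ : ℝ) {C : ℝ} (hC : 0 < C) {r : ℝ} (hr : 0 < r) : 0 < hθθ σ C r :=
  div_pos (Real.rpow_pos_of_pos hr _) (by positivity)

theorem lapse_pos (σ : ℝ) {r : ℝ} (hr : 0 < r) : 0 < lapse σ r :=
  Real.sqrt_pos.2 (Real.rpow_pos_of_pos hr _)

theorem sqrtDet_pos (σ : ℝ) {C : ℝ} (hC : 0 < C) {r : ℝ} (hr : 0 < r) : 0 < sqrtDet σ C r :=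
  Real.sqrt_pos.2 (mul_pos (mul_pos (hrr_pos σ hr) (hrr_pos σ hr)) (hθθ_pos σ hC hr))

theorem hrr_smooth (σ : ℝ) : ContDiffOn ℝ ∞ (hrr σ) (Ioi 0) := contDiffOn_rpow _

theorem hθθ_smooth (σ C : ℝ) : ContDiffOn ℝ ∞ (hθθ σ C) (Ioi 0) :=
  (contDiffOn_rpow _).div_const _

theorem lapse_smooth (σ : ℝ) : ContDiffOn ℝ ∞ (lapse σ) (Ioi 0) :=
  (contDiffOn_rpow _).sqrt fun _ hr => (Real.rpow_pos_of_pos hr _).ne'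

theorem sqrtDet_smooth (σ : ℝ) {C : ℝ} (hC : 0 < C) : ContDiffOn ℝ ∞ (sqrtDet σ C) (Ioi 0) :=
  (((hrr_smooth σ).mul (hrr_smooth σ)).mul (hθθ_smooth σ C)).sqrt fun _ hr =>
    (mul_pos (mul_pos (hrr_pos σ hr) (hrr_pos σ hr)) (hθθ_pos σ hC hr)).ne'

theorem coeff1_smooth (σ : ℝ) {C : ℝ} (hC : 0 < C) :
    ContDiffOn ℝ ∞ (fun r => sqrtDet σ C r * (hrr σ r)⁻¹ * lapse σ r) (Ioi 0) :=
  ((sqrtDet_smooth σ hC).mul ((hrr_smooth σ).inv fun _ hr => (hrr_pos σ hr).ne')).mul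
    (lapse_smooth σ)

theorem coeff2_smooth (σ : ℝ) {C : ℝ} (hC : 0 < C) :
    ContDiffOn ℝ ∞ (fun r => sqrtDet σ C r * (hθθ σ C r)⁻¹ * lapse σ r) (Ioi 0) :=
  ((sqrtDet_smooth σ hC).mul ((hθθ_smooth σ C).inv fun _ hr => (hθθ_pos σ hC hr).ne')).mul
    (lapse_smooth σ)

theorem coeff3_smooth (σ : ℝ) {C : ℝ} (hC : 0 < C) :
    ContDiffOn ℝ ∞ (fun r => lapse σ r / sqrtDet σ C r) (Ioi 0) :=
  (lapse_smooth σ).div (sqrtDet_smooth σ hC) fun _ hr => (sqrtDet_pos σ hC hr).ne'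

theorem coeff4_smooth (σ M : ℝ) :
    ContDiffOn ℝ ∞ (fun r => lapse σ r ^ 2 * M ^ 2) (Ioi 0) :=
  ((lapse_smooth σ).pow 2).mul contDiffOn_const

theorem kleinGordon_mem (σ : ℝ) {C : ℝ} (hC : 0 < C) (M : ℝ) {f : ℝ × ℝ × ℝ → ℂ}
    (hf : f ∈ sliceTest) : kleinGordon σ C M f ∈ sliceTest := by
  refine add_mem (neg_mem (mulR_mem (coeff3_smooth σ hC) (add_mem (add_mem ?_ ?_) ?_)))
    (mulR_mem (coeff4_smooth σ M) hf)
  · exact dR_mem (mulR_mem (coeff1_smooth σ hC) (dR_mem hf))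
  · exact dZ_mem (mulR_mem (coeff1_smooth σ hC) (dZ_mem hf))
  · exact dT_mem (mulR_mem (coeff2_smooth σ hC) (dT_mem hf))

/-- The spatial Klein–Gordon operator on test functions, as a linear map. -/
def kleinGordonAction (σ : ℝ) {C : ℝ} (hC : 0 < C) (M : ℝ) :
    sliceTest →ₗ[ℂ] (ℝ × ℝ × ℝ → ℂ) where
  toFun f := kleinGordon σ C M f
  map_add' f g := by
    have c1 := coeff1_smooth σ hC
    have c2 := coeff2_smooth σ hC
    simp only [kleinGordon, weightedLaplacian, Submodule.coe_add]
    rw [dR_add f.2 g.2, dZ_add f.2 g.2, dT_add f.2 g.2]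
    simp only [mulR_add]
    rw [dR_add (mulR_mem c1 (dR_mem f.2)) (mulR_mem c1 (dR_mem g.2)),
      dZ_add (mulR_mem c1 (dZ_mem f.2)) (mulR_mem c1 (dZ_mem g.2)),
      dT_add (mulR_mem c2 (dT_mem f.2)) (mulR_mem c2 (dT_mem g.2))]
    simp only [mulR_add]
    abel
  map_smul' a f := by
    simp only [kleinGordon, weightedLaplacian, Submodule.coe_smul, dR_smul, dZ_smul, dT_smul,
      mulR_smul, RingHom.id_apply, smul_add, smul_neg, mulR_add]

theorem sliceTest_memLp (σ : ℝ) {C : ℝ} (hC : 0 < C) {f : ℝ × ℝ × ℝ → ℂ} (hf : f ∈ sliceTest) :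
    MemLp f 2 (sliceMeasure σ C) := by
  obtain ⟨hs, -, K, hK, hK0, hfK⟩ := hf
  let S : Set (ℝ × ℝ × ℝ) :=
    (fun q : (ℝ × ℝ) × ℝ => (q.1.1, q.1.2, q.2)) '' (K ×ˢ Icc 0 (2 * Real.pi))
  have hS : IsCompact S := (hK.prod isCompact_Icc).image (by fun_prop)
  have hSm : MeasurableSet S := hS.isClosed.measurableSet
  have hdens : ContinuousOn (fun p : ℝ × ℝ × ℝ => sqrtDet σ C p.1 / lapse σ p.1) S := by
    refine ContinuousOn.comp (t := Ioi 0) (g := fun r => sqrtDet σ C r / lapse σ r) ?_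
      continuous_fst.continuousOn ?_
    · exact (sqrtDet_smooth σ hC).continuousOn.div (lapse_smooth σ).continuousOn
        fun r hr => (lapse_pos σ hr).ne'
    · rintro _ ⟨q, hq, rfl⟩
      exact hK0 _ hq.1
  obtain ⟨B, hB⟩ := hS.exists_bound_of_continuousOn hdens
  have hfin : sliceMeasure σ C S < ⊤ := by
    rw [sliceMeasure, withDensity_apply _ hSm]
    calc ∫⁻ p in S, ENNReal.ofReal (sqrtDet σ C p.1 / lapse σ p.1)
          ∂(volume.restrict (Ioi (0 : ℝ) ×ˢ ((univ : Set ℝ) ×ˢ Ioc (0 : ℝ) (2 * Real.pi))))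
        ≤ ∫⁻ _ in S, ENNReal.ofReal B
          ∂(volume.restrict (Ioi (0 : ℝ) ×ˢ ((univ : Set ℝ) ×ˢ Ioc (0 : ℝ) (2 * Real.pi)))) :=
          setLIntegral_mono' hSm fun p hp =>
            ENNReal.ofReal_le_ofReal ((le_abs_self _).trans (hB p hp))
      _ < ⊤ := by
          rw [setLIntegral_const]
          exact ENNReal.mul_lt_top ENNReal.ofReal_lt_top
            ((Measure.restrict_apply_le _ _).trans_lt hS.measure_lt_top)
  have hae : ∀ᵐ p ∂(sliceMeasure σ C),
      p ∈ Ioi (0 : ℝ) ×ˢ ((univ : Set ℝ) ×ˢ Ioc (0 : ℝ) (2 * Real.pi)) :=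
    (withDensity_absolutelyContinuous _ _).ae_le
      (ae_restrict_mem (measurableSet_Ioi.prod (MeasurableSet.univ.prod measurableSet_Ioc)))
  have heq : S.indicator f =ᵐ[sliceMeasure σ C] f := by
    filter_upwards [hae] with p hp
    by_cases hpS : p ∈ S
    · exact indicator_of_mem hpS f
    · rw [indicator_of_notMem hpS]
      by_cases hpK : (p.1, p.2.1) ∈ K
      · exact absurd ⟨((p.1, p.2.1), p.2.2), ⟨hpK, Ioc_subset_Icc_self hp.2.2⟩, rfl⟩ hpS
      · exact (hfK p.1 p.2.1 p.2.2 hpK).symm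
  obtain ⟨B', hB'⟩ := hS.exists_bound_of_continuousOn hs.continuous.continuousOn
  refine MemLp.ae_eq heq ?_
  rw [memLp_indicator_iff_restrict hSm]
  have : IsFiniteMeasure ((sliceMeasure σ C).restrict S) := ⟨by simpa using hfin⟩
  exact MemLp.of_bound hs.continuous.aestronglyMeasurable B' ((ae_restrict_iff' hSm).2
    (Eventually.of_forall hB'))

theorem sliceTest_eq_zero (σ : ℝ) {C : ℝ} (hC : 0 < C) {f : ℝ × ℝ × ℝ → ℂ} (hf : f ∈ sliceTest)
    (h : f =ᵐ[sliceMeasure σ C] 0) : f = 0 := by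
  obtain ⟨hs, pf, K, hK, hK0, hfK⟩ := hf
  have hmeas : MeasurableSet (Ioi (0 : ℝ) ×ˢ ((univ : Set ℝ) ×ˢ Ioc (0 : ℝ) (2 * Real.pi))) :=
    measurableSet_Ioi.prod (MeasurableSet.univ.prod measurableSet_Ioc)
  have hae : f =ᵐ[volume.restrict
      (Ioi (0 : ℝ) ×ˢ ((univ : Set ℝ) ×ˢ Ioc (0 : ℝ) (2 * Real.pi)))] 0 := by
    have hm : AEMeasurable (fun p : ℝ × ℝ × ℝ => ENNReal.ofReal (sqrtDet σ C p.1 / lapse σ p.1))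
        (volume.restrict (Ioi (0 : ℝ) ×ˢ ((univ : Set ℝ) ×ˢ Ioc (0 : ℝ) (2 * Real.pi)))) := by
      simp only [sqrtDet, lapse, hrr, hθθ]
      fun_prop
    have h' := (ae_withDensity_iff' hm).1 h
    filter_upwards [h', ae_restrict_mem hmeas] with p hp hpm
    refine hp ?_
    rw [ne_eq, ENNReal.ofReal_eq_zero, not_le]
    exact div_pos (sqrtDet_pos σ hC hpm.1) (lapse_pos σ hpm.1)
  have h0 : EqOn f 0 (Ioi (0 : ℝ) ×ˢ ((univ : Set ℝ) ×ˢ Ioc (0 : ℝ) (2 * Real.pi))) := by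
    refine Measure.eqOn_of_ae_eq hae hs.continuous.continuousOn continuousOn_const ?_
    rw [interior_prod_eq, interior_prod_eq, closure_prod_eq, closure_prod_eq, interior_Ioi,
      interior_univ, interior_Ioc, closure_univ, closure_Ioo (by positivity)]
    exact prod_mono subset_closure (prod_mono le_rfl Ioc_subset_Icc_self)
  funext ⟨r, z, θ⟩
  by_cases hp : (r, z) ∈ K
  · have hper : Function.Periodic (fun t => f (r, z, t)) (2 * Real.pi) := fun t => pf r z t
    obtain ⟨t, ht, hft⟩ := hper.exists_mem_Ioc (by positivity) θ 0
    rw [zero_add] at ht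
    change f (r, z, θ) = f (r, z, t) at hft
    rw [hft]
    exact h0 ⟨hK0 _ hp, mem_univ _, ht⟩
  · exact hfK r z θ hp

/-- The spatial Klein–Gordon operator `A` for mass `M`, in the Hilbert space `L²` of the static
slice, with domain `C₀^∞`. -/
def kleinGordonOperator (σ : ℝ) {C : ℝ} (hC : 0 < C) (M : ℝ) :
    Lp ℂ 2 (sliceMeasure σ C) →ₗ.[ℂ] Lp ℂ 2 (sliceMeasure σ C) :=
  l2Operator sliceTest (fun f => sliceTest_memLp σ hC f.2)
    (fun _ hf h => sliceTest_eq_zero σ hC hf h) (kleinGordonAction σ hC M)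
    (fun f => sliceTest_memLp σ hC (kleinGordon_mem σ hC M f.2))

/-- The Levi-Civita spacetime with parameters `σ`, `C` is quantum mechanically singular, as probed
by scalar particles of mass `M`: the spatial Klein–Gordon operator is not essentially
self-adjoint. -/
def QuantumMechanicallySingular (σ : ℝ) {C : ℝ} (hC : 0 < C) (M : ℝ) : Prop :=
  ¬ IsEssentiallySelfAdjoint (kleinGordonOperator σ hC M)

/-! ### Separation of variables -/

/-- The separated function `R(r) e^{ikz} e^{imθ}`. -/
def mode (k : ℝ) (m : ℤ) (R : ℝ → ℂ) : ℝ × ℝ × ℝ → ℂ :=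
  fun p => R p.1 * Complex.exp (Complex.I * k * p.2.1) * Complex.exp (Complex.I * m * p.2.2)

/-- `R` is a solution of the radial Klein–Gordon equation with spectral parameter `lam` (that is,
`ω²`): it is twice continuously differentiable and `A (R e^{ikz} e^{imθ}) = lam R e^{ikz} e^{imθ}`
on the static slice. -/
def IsRadialSolution (σ C M k : ℝ) (m : ℤ) (lam : ℂ) (R : ℝ → ℂ) : Prop :=
  ContDiffOn ℝ 2 R (Ioi 0) ∧
    ∀ p : ℝ × ℝ × ℝ, 0 < p.1 → kleinGordon σ C M (mode k m R) p = lam * mode k m R p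

/-- `α = (2σ - 1)²`. -/
def alpha (σ : ℝ) : ℝ := (2 * σ - 1) ^ 2

/-- The change of variable `r = (α C x²)^{1/(2α)}`. -/
def rOfX (σ C x : ℝ) : ℝ := (alpha σ * C * x ^ 2) ^ (1 / (2 * alpha σ))

/-- The Schrödinger wave function `ψ(x) = √x R(r(x))` obtained from `R`. -/
def toSchrodinger (σ C : ℝ) (R : ℝ → ℂ) : ℝ → ℂ := fun x => (√x : ℂ) * R (rOfX σ C x)

/-- The potential in the Schrödinger form of the radial equation. -/
def potential (σ C M k : ℝ) (m : ℤ) (x : ℝ) : ℝ :=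
  C * k ^ 2 / alpha σ * (alpha σ * C * x ^ 2) ^ ((-alpha σ + 1) / alpha σ)
    + C * M ^ 2 / alpha σ * (alpha σ * C * x ^ 2) ^ (2 * σ / alpha σ)
    + (m : ℝ) ^ 2 * C ^ 3 / alpha σ * (alpha σ * C * x ^ 2) ^ ((4 * σ - 1) / alpha σ)
    - 1 / (4 * x ^ 2)

theorem alpha_pos {σ : ℝ} (hσ : σ ≠ 1 / 2) : 0 < alpha σ := by
  have : 2 * σ - 1 ≠ 0 := fun h => hσ (by linarith)
  unfold alpha
  positivity

theorem potential_continuousOn {σ C : ℝ} (hσ : σ ≠ 1 / 2) (hC : 0 < C) (M k : ℝ) (m : ℤ) :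
    ContinuousOn (potential σ C M k m) (Ioi 0) := by
  have hα := alpha_pos hσ
  have h (e : ℝ) : ContinuousOn (fun x : ℝ => (alpha σ * C * x ^ 2) ^ e) (Ioi 0) := by
    refine ContinuousOn.rpow_const (by fun_prop) fun x hx => Or.inl ?_
    have : 0 < x := hx
    positivity
  have h4 : ContinuousOn (fun x : ℝ => 1 / (4 * x ^ 2)) (Ioi 0) := by
    refine continuousOn_const.div (by fun_prop) fun x hx => ?_
    have : 0 < x := hx
    positivity
  exact ((((h _).const_mul _).add ((h _).const_mul _)).add ((h _).const_mul _)).sub h4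

end LeviCivita

end

/-!
Everything rests on the operator `r d/dr`. Since `√h h^{rr} N = r / C` and
`√h / N = r^{2α-1} / C`, the Klein–Gordon operator is
`A = -r^{-2α} ((r ∂_r)² + r² ∂_z² + C² r^{8σ²} ∂_θ² - M² r^{4σ+2α})`, and the radial equation
reads `(r d/dr)² R = p R` with `p` tending to `0` at the axis. Such an equation is a first order
system for `R` and `r R'` (`IsEulerSolution`). It is invariant under power substitutions, which
gives the passage from `r` to `x`, and `ψ = √x R` turns it into a Schrödinger equation, the term
`-1/(4x²)` being the price of the factor `√x` (`isRadialSolution_iff_isSolution`). The case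
`p = 0` has the solutions `R = 1` and `R = log r`, hence the limiting equation.

*Limit circle at zero.* If `p` is real with `|p| ≤ 1/4` near `0`, then, for real `R`,
`x (R²/4 + (x R')²)` is increasing there, so every solution `√x R` is bounded near `0`
(`limitCircleAtZero_of_tendsto`).

*Limit point at infinity.* The potential is bounded below there. Hence, at any energy, a solution
that is square integrable at infinity has a square integrable derivative
(`integrableOn_norm_sq_deriv`), and the Wronskian of two such solutions is integrable. But it is
constant, and the existence theorem for linear equations gives two solutions for which it is `1`
(`limitPointAtInfinity_of_bddBelow`).

*Failure of essential self-adjointness.* It suffices to find two real functions in the domain of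
the adjoint whose boundary form `∫ (w₁ u₂ - u₁ w₂)` is nonzero, `wᵢ` being the weak image of `uᵢ`
(`l2Operator_not_isEssentiallySelfAdjoint`). On the half-line these are the solutions at energy
`0` with Wronskian `1`, cut off at infinity (`schrodingerOperator_not_isEssentiallySelfAdjoint`).

On the slice, separated modes are not square integrable in `z`, and exact solutions are replaced
by approximate ones, which avoids Fourier analysis. Let `g(z)` be a test function. The functions
`g` and `g log r` are annihilated by `(r ∂_r)²`. Adding finitely many terms
`r^t (a(z) + b(z) log r)` with `t > 0`, one makes `A` of the sum square integrable near the axis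
(`LogSum.exists_correction`): each step inverts `(r ∂_r)²` on the remaining error, and the other
terms of `A` raise the exponents. Cut off at large `r`, the two sums lie in the domain of the
adjoint by Green's identity (`integral_mul_kleinGordon`). Their boundary form is, up to a nonzero
factor, the limit at the axis of the Wronskian with respect to `r d/dr`, integrated over `z`; only
the leading terms contribute, with `-∫ g²` (`tendsto_wronskian`).
-/

noncomputable section

namespace LeviCivita

/-! ### A criterion for failure of essential self-adjointness -/

/-- If the formal adjoint action on two vectors `u`, `v` is not symmetric, then the operator is not
essentially self-adjoint: a self-adjoint closure would contain `(u, u')` and `(v, v')` in its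
graph. -/
theorem not_isEssentiallySelfAdjoint_of_inner_ne {H : Type*} [NormedAddCommGroup H]
    [InnerProductSpace ℂ H] [CompleteSpace H] (T : H →ₗ.[ℂ] H) {u u' v v' : H}
    (hu : ∀ f : T.domain, inner ℂ u' (f : H) = inner ℂ u (T f))
    (hv : ∀ f : T.domain, inner ℂ v' (f : H) = inner ℂ v (T f))
    (hne : inner ℂ u' v ≠ inner ℂ u v') : ¬ IsEssentiallySelfAdjoint T := by
  intro hT
  have hT' : IsSelfAdjoint T.closure := hT
  have hdense := hT'.dense_domain
  -- the adjoint relation passes from `T` to its closure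
  have ext : ∀ w w' : H, (∀ f : T.domain, inner ℂ w' (f : H) = inner ℂ w (T f)) →
      ∀ f : T.closure.domain, inner ℂ w' (f : H) = inner ℂ w (T.closure f) := by
    intro w w' hw f
    by_cases hc : T.IsClosable
    · have hmem : ((f : H), T.closure f) ∈ T.graph.topologicalClosure := by
        rw [hc.graph_closure_eq_closure_graph]
        exact T.closure.mem_graph f
      have hclosed : IsClosed {p : H × H | inner ℂ w' p.1 = inner ℂ w p.2} :=
        isClosed_eq (by fun_prop) (by fun_prop)
      have hsub : (T.graph : Set (H × H)) ⊆ {p : H × H | inner ℂ w' p.1 = inner ℂ w p.2} := by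
        rintro ⟨a, b⟩ hab
        obtain ⟨y, hy1, hy2⟩ := (LinearPMap.mem_graph_iff T).1 hab
        simp only at hy1 hy2
        simp only [mem_ofPred_eq, ← hy1, ← hy2]
        exact hw y
      exact closure_minimal hsub hclosed hmem
    · revert f
      rw [LinearPMap.closure_def' hc]
      exact hw
  have key : ∀ w w' : H, (∀ f : T.domain, inner ℂ w' (f : H) = inner ℂ w (T f)) →
      ∃ y : T.closure.domain, (y : H) = w ∧ T.closure y = w' := by
    intro w w' hw
    have hmem : w ∈ T.closure.adjoint.domain :=
      T.closure.mem_adjoint_domain_of_exists w ⟨w', ext w w' hw⟩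
    have hval := LinearPMap.adjoint_apply_eq hdense ⟨w, hmem⟩ (ext w w' hw)
    have hg : (w, w') ∈ T.closure.adjoint.graph :=
      (LinearPMap.mem_graph_iff _).2 ⟨⟨w, hmem⟩, rfl, hval⟩
    rw [LinearPMap.isSelfAdjoint_def.1 hT'] at hg
    exact (LinearPMap.mem_graph_iff _).1 hg
  obtain ⟨y, rfl, rfl⟩ := key v v' hv
  exact hne (ext u u' hu y)

/-- The criterion for operators given by test functions, with real-valued `u₁`, `u₂`: here `wᵢ` is
the weak image of `uᵢ`, and the boundary form of `u₁` and `u₂` is `∫ (w₁ u₂ - u₁ w₂)`. -/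
theorem l2Operator_not_isEssentiallySelfAdjoint {X : Type*} [MeasurableSpace X] {μ : Measure X}
    (D : Submodule ℂ (X → ℂ)) (hD : ∀ f : D, MemLp (D.subtype f) 2 μ)
    (hinj : ∀ f ∈ D, f =ᵐ[μ] 0 → f = 0) (B : D →ₗ[ℂ] (X → ℂ)) (hB : ∀ f : D, MemLp (B f) 2 μ)
    {u₁ w₁ u₂ w₂ : X → ℝ} (hu₁ : MemLp u₁ 2 μ) (hw₁ : MemLp w₁ 2 μ) (hu₂ : MemLp u₂ 2 μ)
    (hw₂ : MemLp w₂ 2 μ)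
    (h₁ : ∀ f : D, ∫ p, (u₁ p : ℂ) * B f p ∂μ = ∫ p, (w₁ p : ℂ) * (f : X → ℂ) p ∂μ)
    (h₂ : ∀ f : D, ∫ p, (u₂ p : ℂ) * B f p ∂μ = ∫ p, (w₂ p : ℂ) * (f : X → ℂ) p ∂μ)
    (hne : ∫ p, (w₁ p * u₂ p - u₁ p * w₂ p) ∂μ ≠ 0) :
    ¬ IsEssentiallySelfAdjoint (l2Operator D hD hinj B hB) := by
  have inner_eq : ∀ (u : X → ℝ) (f : X → ℂ) (hu : MemLp (fun p => (u p : ℂ)) 2 μ)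
      (hf : MemLp f 2 μ), inner ℂ (hu.toLp _) (hf.toLp f) = ∫ p, (u p : ℂ) * f p ∂μ := by
    intro u f hu hf
    rw [L2.inner_def]
    refine integral_congr_ae ?_
    filter_upwards [hu.coeFn_toLp, hf.coeFn_toLp] with p h1 h2
    rw [h1, h2, RCLike.inner_apply, Complex.conj_ofReal, mul_comm]
  have weak : ∀ (u w : X → ℝ) (hu : MemLp (fun p => (u p : ℂ)) 2 μ)
      (hw : MemLp (fun p => (w p : ℂ)) 2 μ),
      (∀ f : D, ∫ p, (u p : ℂ) * B f p ∂μ = ∫ p, (w p : ℂ) * (f : X → ℂ) p ∂μ) →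
      ∀ f : (l2Operator D hD hinj B hB).domain,
        inner ℂ (hw.toLp _) (f : Lp ℂ 2 μ) = inner ℂ (hu.toLp _) (l2Operator D hD hinj B hB f) := by
    rintro u w hu hw h ⟨_, f, rfl⟩
    rw [l2Operator_apply]
    change inner ℂ (hw.toLp _) ((hD f).toLp _) = _
    rw [inner_eq u _ hu (hB f), inner_eq w _ hw (hD f)]
    exact (h f).symm
  have cast : ∀ u : X → ℝ, MemLp u 2 μ → MemLp (fun p => (u p : ℂ)) 2 μ := fun u h => h.ofReal
  refine not_isEssentiallySelfAdjoint_of_inner_ne _ (weak u₁ w₁ (cast _ hu₁) (cast _ hw₁) h₁)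
    (weak u₂ w₂ (cast _ hu₂) (cast _ hw₂) h₂) ?_
  rw [inner_eq w₁ _ (cast _ hw₁) (cast _ hu₂), inner_eq u₁ _ (cast _ hu₁) (cast _ hw₂),
    ← sub_ne_zero]
  have e1 : ∫ p, (w₁ p : ℂ) * (u₂ p : ℂ) ∂μ = ((∫ p, w₁ p * u₂ p ∂μ : ℝ) : ℂ) := by
    rw [← integral_complex_ofReal]
    simp
  have e2 : ∫ p, (u₁ p : ℂ) * (w₂ p : ℂ) ∂μ = ((∫ p, u₁ p * w₂ p ∂μ : ℝ) : ℂ) := by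
    rw [← integral_complex_ofReal]
    simp
  have i1 : Integrable (fun p => w₁ p * u₂ p) μ := hw₁.integrable_mul hu₂
  have i2 : Integrable (fun p => u₁ p * w₂ p) μ := hu₁.integrable_mul hw₂
  rw [integral_sub i1 i2] at hne
  rw [e1, e2]
  exact_mod_cast hne

/-! ### Calculus on the half-line -/

/-- The integral over `(0, ∞)` of the derivative of a function vanishing at infinity is minus the
limit of that function at `0`. -/
theorem integral_Ioi_deriv_eq_neg {E : Type*} [NormedAddCommGroup E] [NormedSpace ℝ E]
    [CompleteSpace E] {F F' : ℝ → E} {l : E} (hF : ∀ x, 0 < x → HasDerivAt F (F' x) x)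
    (hint : IntegrableOn F' (Ioi 0)) (h0 : Tendsto F (𝓝[>] 0) (𝓝 l))
    (hinf : Tendsto F atTop (𝓝 0)) : ∫ x in Ioi (0 : ℝ), F' x = -l := by
  have hG : ∀ x : ℝ, 0 < x → Function.update F 0 l =ᶠ[𝓝 x] F := by
    intro x hx
    filter_upwards [Ioi_mem_nhds hx] with y hy
    rw [Function.update_of_ne (ne_of_gt hy)]
  have h := integral_Ioi_of_hasDerivAt_of_tendsto (f := Function.update F 0 l) (f' := F') (a := 0)
    (m := 0) (by
      rw [← continuousWithinAt_Ioi_iff_Ici, continuousWithinAt_update_same]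
      exact h0.mono_left (nhdsWithin_mono _ sdiff_subset))
    (fun x hx => (hF x hx).congr_of_eventuallyEq (hG x hx)) hint
    (hinf.congr' (by
      filter_upwards [Ioi_mem_atTop 0] with y hy
      rw [Function.update_of_ne (ne_of_gt hy)]))
  rw [h, Function.update_self, zero_sub]

/-! ### Linear differential equations and Euler systems -/

theorem norm_intervalIntegral_le_pow {E : Type*} [NormedAddCommGroup E] [NormedSpace ℝ E]
    {f : ℝ → E} {c : ℝ} {n : ℕ} {t : ℝ} (h : ∀ s, |s| ≤ |t| → ‖f s‖ ≤ c * |s| ^ n) :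
    ‖∫ s in (0 : ℝ)..t, f s‖ ≤ c * |t| ^ (n + 1) / (n + 1) := by
  have h1 := intervalIntegral.smul_integral_comp_mul_left (a := 0) (b := 1) f t
  rw [mul_zero, mul_one] at h1
  rw [← h1, norm_smul, Real.norm_eq_abs]
  have h2 : ‖∫ s in (0 : ℝ)..1, f (t * s)‖ ≤ ∫ s in (0 : ℝ)..1, c * |t| ^ n * s ^ n := by
    refine intervalIntegral.norm_integral_le_of_norm_le zero_le_one ?_
      (Continuous.intervalIntegrable (by fun_prop) _ _)
    refine Eventually.of_forall fun s hs => ?_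
    have hs' : |t * s| = |t| * s := by rw [abs_mul, abs_of_pos hs.1]
    refine (h (t * s) ?_).trans_eq ?_
    · rw [hs']
      exact mul_le_of_le_one_right (abs_nonneg t) hs.2
    · rw [hs', mul_pow]
      ring
  rw [intervalIntegral.integral_const_mul, integral_pow] at h2
  calc |t| * ‖∫ s in (0 : ℝ)..1, f (t * s)‖
      ≤ |t| * (c * |t| ^ n * ((1 ^ (n + 1) - 0 ^ (n + 1)) / (n + 1))) := by gcongr
    _ = c * |t| ^ (n + 1) / (n + 1) := by
        rw [zero_pow (Nat.succ_ne_zero n)]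
        ring

/-- The terms of the Volterra (Picard) series of the linear equation `y' = A y`, `y 0 = y₀`. -/
def volterraTerm {E : Type*} [NormedAddCommGroup E] [NormedSpace ℝ E] (A : ℝ → E →L[ℝ] E)
    (y₀ : E) : ℕ → ℝ → E
  | 0 => fun _ => y₀
  | n + 1 => fun t => ∫ s in (0 : ℝ)..t, A s (volterraTerm A y₀ n s)

section Volterra

variable {E : Type*} [NormedAddCommGroup E] [NormedSpace ℝ E] {A : ℝ → E →L[ℝ] E}

theorem volterraTerm_continuous (hA : Continuous A) (y₀ : E) (n : ℕ) :
    Continuous (volterraTerm A y₀ n) := by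
  induction n with
  | zero => exact continuous_const
  | succ n ih =>
    exact intervalIntegral.continuous_primitive (μ := volume)
      (fun a b => (hA.clm_apply ih).intervalIntegrable a b) 0

theorem norm_volterraTerm_le {M T : ℝ} (hM : ∀ t, |t| ≤ T → ‖A t‖ ≤ M) (y₀ : E) (n : ℕ) :
    ∀ t, |t| ≤ T → ‖volterraTerm A y₀ n t‖ ≤ ‖y₀‖ * M ^ n / n.factorial * |t| ^ n := by
  induction n with
  | zero => simp [volterraTerm]
  | succ n ih =>
    intro t ht
    have h := norm_intervalIntegral_le_pow (f := fun s => A s (volterraTerm A y₀ n s))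
      (c := ‖y₀‖ * M ^ (n + 1) / n.factorial) (n := n) (t := t) (fun s hs => ?_)
    · refine h.trans_eq ?_
      rw [Nat.factorial_succ]
      push_cast
      field_simp
    · have hs' := hs.trans ht
      calc ‖A s (volterraTerm A y₀ n s)‖ ≤ ‖A s‖ * ‖volterraTerm A y₀ n s‖ := (A s).le_opNorm _
        _ ≤ M * (‖y₀‖ * M ^ n / n.factorial * |s| ^ n) :=
            mul_le_mul (hM s hs') (ih s hs') (norm_nonneg _)
              ((norm_nonneg _).trans (hM s hs'))
        _ = ‖y₀‖ * M ^ (n + 1) / n.factorial * |s| ^ n := by ring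

/-- A linear differential equation with continuous coefficients on `ℝ` has global solutions. -/
theorem exists_hasDerivAt_linear [CompleteSpace E] (hA : Continuous A) (y₀ : E) :
    ∃ y : ℝ → E, y 0 = y₀ ∧ ∀ t, HasDerivAt y (A t (y t)) t := by
  refine ⟨fun t => ∑' n, volterraTerm A y₀ n t, ?_, fun t => ?_⟩
  · change ∑' n, volterraTerm A y₀ n 0 = y₀
    rw [tsum_eq_single 0]
    · rfl
    · rintro (_ | n) hn
      · exact absurd rfl hn
      · simp [volterraTerm]
  obtain ⟨T, hT⟩ : ∃ T, |t| < T := exists_gt _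
  have hT0 : 0 < T := (abs_nonneg t).trans_lt hT
  obtain ⟨M, hM⟩ := (isCompact_Icc (a := -T) (b := T)).exists_bound_of_continuousOn
    hA.continuousOn
  have hM' : ∀ s, |s| ≤ T → ‖A s‖ ≤ M := fun s hs => hM s (abs_le.1 hs)
  have hM0 : 0 ≤ M := (norm_nonneg _).trans (hM' t hT.le)
  have hbound : ∀ n s, |s| ≤ T →
      ‖volterraTerm A y₀ n s‖ ≤ ‖y₀‖ * ((M * T) ^ n / n.factorial) := by
    intro n s hs
    refine (norm_volterraTerm_le hM' y₀ n s hs).trans ?_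
    calc ‖y₀‖ * M ^ n / n.factorial * |s| ^ n ≤ ‖y₀‖ * M ^ n / n.factorial * T ^ n := by gcongr
      _ = _ := by rw [mul_pow]; ring
  have hsum : Summable fun n : ℕ => ‖y₀‖ * ((M * T) ^ n / n.factorial) :=
    (Real.summable_pow_div_factorial _).mul_left _
  have hsum_t : Summable fun n => volterraTerm A y₀ n t :=
    .of_norm_bounded hsum fun n => hbound n t hT.le
  have hmain := hasDerivAt_tsum_of_isPreconnected (𝕜 := ℝ) (t := Ioo (-T) T) (y := t) (y₀ := t)
    (g := volterraTerm A y₀)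
    (g' := fun n s => n.casesOn (motive := fun _ => E) 0 fun m => A s (volterraTerm A y₀ m s))
    (u := fun n => n.casesOn (motive := fun _ => ℝ) 0
      fun m => M * (‖y₀‖ * ((M * T) ^ m / m.factorial)))
    ((summable_nat_add_iff 1).1 (hsum.mul_left M)) isOpen_Ioo isPreconnected_Ioo ?_ ?_
    (abs_lt.1 hT) hsum_t (abs_lt.1 hT)
  · convert hmain using 1
    have hs' : Summable fun n : ℕ => (n.casesOn (motive := fun _ => E) 0
        fun m => A t (volterraTerm A y₀ m t)) := by
      rw [← summable_nat_add_iff 1]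
      exact (A t).summable hsum_t
    rw [hs'.tsum_eq_zero_add]
    exact ((A t).map_tsum hsum_t).trans (zero_add _).symm
  · rintro (_ | n) s _
    · exact hasDerivAt_const _ _
    · have hc := hA.clm_apply (volterraTerm_continuous hA y₀ n)
      exact intervalIntegral.integral_hasDerivAt_right (hc.intervalIntegrable _ _)
        hc.stronglyMeasurable.stronglyMeasurableAtFilter hc.continuousAt
  · rintro (_ | n) s hs
    · simp
    · have hs' : |s| ≤ T := (abs_lt.2 hs).le
      exact ((A s).le_opNorm _).trans (mul_le_mul (hM' s hs') (hbound n s hs') (norm_nonneg _) hM0)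

end Volterra

/-- `R` and `S = r R'` solve `(r d/dr)² R = p R` on `(0, ∞)`, written as a first order system. -/
def IsEulerSolution {𝕜 : Type*} [RCLike 𝕜] (p R S : ℝ → 𝕜) : Prop :=
  ∀ r : ℝ, 0 < r → HasDerivAt R (r⁻¹ • S r) r ∧ HasDerivAt S (r⁻¹ • (p r * R r)) r

section Euler

variable {𝕜 : Type*} [RCLike 𝕜]

/-- Under `r = e^t` an Euler system becomes a linear system on `ℝ`, so that it has solutions with
arbitrary data at `r = 1`. -/
theorem exists_isEulerSolution {p : ℝ → 𝕜} (hp : ContinuousOn p (Ioi 0)) (a b : 𝕜) :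
    ∃ R S : ℝ → 𝕜, R 1 = a ∧ S 1 = b ∧ IsEulerSolution p R S := by
  have hq : Continuous fun t => p (Real.exp t) :=
    hp.comp_continuous Real.continuous_exp fun t => Real.exp_pos t
  let F : 𝕜 × 𝕜 →L[ℝ] 𝕜 := ContinuousLinearMap.fst ℝ 𝕜 𝕜
  let G : 𝕜 × 𝕜 →L[ℝ] 𝕜 := ContinuousLinearMap.snd ℝ 𝕜 𝕜
  let A : ℝ → (𝕜 × 𝕜 →L[ℝ] 𝕜 × 𝕜) := fun t =>
    (ContinuousLinearMap.inl ℝ 𝕜 𝕜).comp G + (ContinuousLinearMap.inr ℝ 𝕜 𝕜).comp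
      ((ContinuousLinearMap.mul ℝ 𝕜 (p (Real.exp t))).comp F)
  have hA : Continuous A := by
    refine continuous_const.add (continuous_const.clm_comp (Continuous.clm_comp ?_
      continuous_const))
    exact (ContinuousLinearMap.mul ℝ 𝕜).continuous.comp hq
  obtain ⟨y, hy0, hy⟩ := exists_hasDerivAt_linear hA (a, b)
  have hA1 : ∀ t v, A t v = (v.2, p (Real.exp t) * v.1) := by
    intro t v
    simp [A, F, G]
  refine ⟨fun r => (y (Real.log r)).1, fun r => (y (Real.log r)).2, by simp [hy0], by simp [hy0],
    fun r hr => ?_⟩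
  have h1 := (hy (Real.log r)).scomp r (Real.hasDerivAt_log hr.ne')
  rw [hA1, Real.exp_log hr] at h1
  exact ⟨F.hasFDerivAt.comp_hasDerivAt r h1, G.hasFDerivAt.comp_hasDerivAt r h1⟩

theorem IsEulerSolution.congr {p q R R' S S' : ℝ → 𝕜} (h : IsEulerSolution p R S)
    (hp : ∀ r, 0 < r → q r = p r) (hR : ∀ r, 0 < r → R' r = R r) (hS : ∀ r, 0 < r → S' r = S r) :
    IsEulerSolution q R' S' := by
  intro r hr
  obtain ⟨h1, h2⟩ := h r hr
  have e1 : R' =ᶠ[𝓝 r] R := by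
    filter_upwards [Ioi_mem_nhds hr] with y hy using hR y hy
  have e2 : S' =ᶠ[𝓝 r] S := by
    filter_upwards [Ioi_mem_nhds hr] with y hy using hS y hy
  rw [hp r hr, hR r hr, hS r hr]
  exact ⟨h1.congr_of_eventuallyEq e1, h2.congr_of_eventuallyEq e2⟩

/-- Euler systems are invariant under power substitutions `r = κ x^β`, as `x d/dx = β r d/dr`. -/
theorem IsEulerSolution.comp_rpow {p R S : ℝ → 𝕜} (h : IsEulerSolution p R S) {κ : ℝ} (hκ : 0 < κ)
    (β : ℝ) : IsEulerSolution (fun x => (β ^ 2 : ℝ) • p (κ * x ^ β)) (fun x => R (κ * x ^ β))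
      (fun x => β • S (κ * x ^ β)) := by
  intro x hx
  have hρ : 0 < κ * x ^ β := mul_pos hκ (Real.rpow_pos_of_pos hx β)
  obtain ⟨h1, h2⟩ := h _ hρ
  have hd : HasDerivAt (fun x : ℝ => κ * x ^ β) (κ * (β * x ^ (β - 1))) x :=
    (Real.hasDerivAt_rpow_const (Or.inl hx.ne')).const_mul κ
  have hx' : κ * (β * x ^ (β - 1)) * (κ * x ^ β)⁻¹ = x⁻¹ * β := by
    rw [Real.rpow_sub_one hx.ne']
    have := (Real.rpow_pos_of_pos hx β).ne'
    field_simp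
  constructor
  · have := h1.scomp x hd
    rw [smul_smul, hx', ← smul_smul] at this
    exact this
  · have := (h2.scomp x hd).const_smul β
    rw [smul_smul (κ * _), hx', smul_smul] at this
    have e : x⁻¹ • ((β ^ 2 : ℝ) • p (κ * x ^ β) * R (κ * x ^ β))
        = (β * (x⁻¹ * β)) • (p (κ * x ^ β) * R (κ * x ^ β)) := by
      rw [smul_mul_assoc, smul_smul]
      congr 1
      ring
    rw [e]
    exact this

theorem exists_isEulerSolution_comp_rpow_iff {p R : ℝ → 𝕜} {κ β : ℝ} (hκ : 0 < κ) (hβ : β ≠ 0) :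
    (∃ S, IsEulerSolution (fun x => (β ^ 2 : ℝ) • p (κ * x ^ β)) (fun x => R (κ * x ^ β)) S) ↔
      ∃ S, IsEulerSolution p R S := by
  refine ⟨fun ⟨S, h⟩ => ?_, fun ⟨S, h⟩ => ⟨_, h.comp_rpow hκ β⟩⟩
  have hκ' : 0 < κ⁻¹ ^ β⁻¹ := Real.rpow_pos_of_pos (inv_pos.2 hκ) _
  have inv : ∀ r : ℝ, 0 < r → κ * (κ⁻¹ ^ β⁻¹ * r ^ β⁻¹) ^ β = r := by
    intro r hr
    rw [← Real.mul_rpow (inv_pos.2 hκ).le hr.le, ← Real.rpow_mul (by positivity),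
      inv_mul_cancel₀ hβ, Real.rpow_one]
    field_simp
  refine ⟨_, (h.comp_rpow hκ' β⁻¹).congr (fun r hr => ?_) (fun r hr => ?_) (fun r _ => rfl)⟩
  · rw [inv r hr, smul_smul, ← mul_pow, inv_mul_cancel₀ hβ, one_pow, one_smul]
  · rw [inv r hr]

/-- The substitution `ψ = √x R` turns an Euler system into a Schrödinger equation. -/
theorem IsEulerSolution.hasDerivAt_sqrt_smul {p R S : ℝ → 𝕜} (h : IsEulerSolution p R S) {x : ℝ}
    (hx : 0 < x) : HasDerivAt (fun x => √x • R x) ((√x)⁻¹ • (S x + (1 / 2 : ℝ) • R x)) x ∧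
      HasDerivAt (fun x => (√x)⁻¹ • (S x + (1 / 2 : ℝ) • R x))
        ((√x / x ^ 2) • ((p x - 1 / 4) * R x)) x := by
  obtain ⟨h1, h2⟩ := h x hx
  have hs : 0 < √x := Real.sqrt_pos.2 hx
  have hsq : √x ^ 2 = x := Real.sq_sqrt hx.le
  have hd := Real.hasDerivAt_sqrt hx.ne'
  refine ⟨(hd.smul h1).congr_deriv ?_,
    ((hd.inv hs.ne').smul (h2.add (h1.const_smul (1 / 2 : ℝ)))).congr_deriv ?_⟩
  · have e1 : √x * x⁻¹ = (√x)⁻¹ := by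
      field_simp
      exact hsq
    rw [smul_smul, e1, smul_add, smul_smul]
    congr 2
    field_simp
  · have e1 : (√x)⁻¹ * x⁻¹ = √x / x ^ 2 := by
      field_simp
      exact hsq.symm
    have e2 : -(1 / (2 * √x)) / √x ^ 2 = -(1 / 2) * (√x / x ^ 2) := by
      rw [hsq]
      field_simp
      rw [hsq]
    change (√x)⁻¹ • (x⁻¹ • (p x * R x) + (1 / 2 : ℝ) • x⁻¹ • S x)
      + (-(1 / (2 * √x)) / √x ^ 2) • (S x + (1 / 2 : ℝ) • R x) = _
    rw [e2, smul_add, smul_smul, smul_comm (1 / 2 : ℝ) x⁻¹, smul_smul, e1, sub_mul]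
    have e3 : (1 / 4 : 𝕜) * R x = (1 / 4 : ℝ) • R x := by
      rw [RCLike.real_smul_eq_coe_mul]
      push_cast
      rfl
    rw [e3]
    module

theorem isEulerSolution_inv_sqrt_smul {v ψ φ : ℝ → 𝕜}
    (h : ∀ x : ℝ, 0 < x → HasDerivAt ψ (φ x) x ∧ HasDerivAt φ (v x * ψ x) x) :
    IsEulerSolution (fun x => (x ^ 2 : ℝ) • v x + 1 / 4) (fun x => (√x)⁻¹ • ψ x)
      (fun x => √x • φ x - (1 / 2 : ℝ) • ((√x)⁻¹ • ψ x)) := by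
  intro x hx
  obtain ⟨h1, h2⟩ := h x hx
  have hs : 0 < √x := Real.sqrt_pos.2 hx
  have hsq : √x ^ 2 = x := Real.sq_sqrt hx.le
  have hd := Real.hasDerivAt_sqrt hx.ne'
  have e1 : (√x)⁻¹ = x⁻¹ * √x := by
    field_simp
    exact hsq.symm
  have e2 : -(1 / (2 * √x)) / √x ^ 2 = -(1 / 2) * (x⁻¹ * (√x)⁻¹) := by
    rw [hsq]
    field_simp
  have hR : HasDerivAt (fun x => (√x)⁻¹ • ψ x)
      (x⁻¹ • (√x • φ x - (1 / 2 : ℝ) • ((√x)⁻¹ • ψ x))) x := by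
    refine ((hd.inv hs.ne').smul h1).congr_deriv ?_
    rw [e2]
    change (√x)⁻¹ • φ x + _ = _
    rw [smul_sub, smul_smul x⁻¹, ← e1]
    module
  refine ⟨hR, ((hd.smul h2).sub (hR.const_smul (1 / 2 : ℝ))).congr_deriv ?_⟩
  have e3 : (((x ^ 2 : ℝ) • v x + 1 / 4) * (√x)⁻¹ • ψ x : 𝕜)
      = (x ^ 2 * (√x)⁻¹) • (v x * ψ x) + (1 / 4 : ℝ) • (√x)⁻¹ • ψ x := by
    simp only [RCLike.real_smul_eq_coe_mul]
    push_cast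
    ring
  have e4 : x⁻¹ * (x ^ 2 * (√x)⁻¹) = √x := by
    field_simp
    exact hsq.symm
  have e5 : 1 / (2 * √x) = (1 / 2) * (x⁻¹ * √x) := by
    rw [← e1]
    field_simp
  rw [e3, smul_add, smul_smul x⁻¹ (x ^ 2 * (√x)⁻¹), e4, e5]
  module

end Euler

/-- The Schrödinger equation on `(0, ∞)` as an Euler system for `ψ / √x`. -/
theorem isSolution_iff {V : ℝ → ℝ} {E : ℂ} {ψ : ℝ → ℂ} : IsSolution V E ψ ↔
    ∃ S, IsEulerSolution (fun x => (x ^ 2 : ℝ) • ((V x : ℂ) - E) + 1 / 4)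
      (fun x => (√x)⁻¹ • ψ x) S := by
  refine ⟨fun ⟨φ, h⟩ => ⟨_, isEulerSolution_inv_sqrt_smul h⟩, fun ⟨S, h⟩ => ?_⟩
  have hψ : ∀ x : ℝ, 0 < x → ψ x = √x • (√x)⁻¹ • ψ x := by
    intro x hx
    rw [smul_smul, mul_inv_cancel₀ (Real.sqrt_pos.2 hx).ne', one_smul]
  refine ⟨fun x => (√x)⁻¹ • (S x + (1 / 2 : ℝ) • ((√x)⁻¹ • ψ x)), fun x hx => ?_⟩
  obtain ⟨h1, h2⟩ := h.hasDerivAt_sqrt_smul hx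
  refine ⟨h1.congr_of_eventuallyEq ?_, h2.congr_deriv ?_⟩
  · filter_upwards [Ioi_mem_nhds hx] with y hy using hψ y hy
  · nth_rewrite 2 [hψ x hx]
    simp only [Complex.real_smul]
    have : (x : ℂ) ≠ 0 := by exact_mod_cast hx.ne'
    push_cast
    field_simp
    ring

/-! ### The metric coefficients -/

section Coefficients

variable {σ C r : ℝ}

theorem lapse_eq (σ : ℝ) (hr : 0 < r) : lapse σ r = r ^ (2 * σ) := by
  rw [lapse, show 4 * σ = 2 * σ * 2 by ring, Real.rpow_mul hr.le, Real.rpow_two,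
    Real.sqrt_sq (Real.rpow_nonneg hr.le _)]

theorem sqrtDet_eq (σ : ℝ) (hC : 0 < C) (hr : 0 < r) :
    sqrtDet σ C r = r ^ (8 * σ ^ 2 - 6 * σ + 1) / C := by
  have h : hrr σ r * hrr σ r * hθθ σ C r = (r ^ (8 * σ ^ 2 - 6 * σ + 1) / C) ^ 2 := by
    rw [hrr, hθθ, div_pow, ← Real.rpow_mul_natCast hr.le, ← Real.rpow_add hr, mul_div_assoc',
      ← Real.rpow_add hr]
    congr 2
    push_cast
    ring
  rw [sqrtDet, h, Real.sqrt_sq (div_nonneg (Real.rpow_nonneg hr.le _) hC.le)]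

theorem sqrtDet_div_lapse (σ : ℝ) (hC : 0 < C) (hr : 0 < r) :
    sqrtDet σ C r / lapse σ r = r ^ (2 * alpha σ - 1) / C := by
  rw [sqrtDet_eq σ hC hr, lapse_eq σ hr, div_right_comm, ← Real.rpow_sub hr, alpha]
  congr 2
  ring

theorem lapse_div_sqrtDet (σ : ℝ) (hC : 0 < C) (hr : 0 < r) :
    lapse σ r / sqrtDet σ C r = C * r ^ (1 - 2 * alpha σ) := by
  rw [← inv_div, sqrtDet_div_lapse σ hC hr, inv_div, div_eq_mul_inv, ← Real.rpow_neg hr.le, neg_sub]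

theorem axial_coeff_eq (σ : ℝ) (hC : 0 < C) (hr : 0 < r) :
    sqrtDet σ C r * (hrr σ r)⁻¹ * lapse σ r = r / C := by
  rw [sqrtDet_eq σ hC hr, lapse_eq σ hr, hrr, ← Real.rpow_neg hr.le, div_mul_eq_mul_div,
    div_mul_eq_mul_div, ← Real.rpow_add hr, ← Real.rpow_add hr]
  have e : 8 * σ ^ 2 - 6 * σ + 1 + -(8 * σ ^ 2 - 4 * σ) + 2 * σ = 1 := by ring
  rw [e, Real.rpow_one]

theorem angular_coeff_eq (σ : ℝ) (hC : 0 < C) (hr : 0 < r) :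
    sqrtDet σ C r * (hθθ σ C r)⁻¹ * lapse σ r = C * r ^ (8 * σ ^ 2 - 1) := by
  rw [sqrtDet_eq σ hC hr, lapse_eq σ hr, hθθ, inv_div, div_eq_mul_inv (C ^ 2),
    ← Real.rpow_neg hr.le]
  have e : (8 * σ ^ 2 - 1) = (8 * σ ^ 2 - 6 * σ + 1) + -(2 - 4 * σ) + 2 * σ := by ring
  rw [e, Real.rpow_add hr _ (2 * σ), Real.rpow_add hr _ (-(2 - 4 * σ))]
  generalize r ^ (8 * σ ^ 2 - 6 * σ + 1) = a
  generalize r ^ (-(2 - 4 * σ)) = b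
  field_simp

theorem lapse_sq (σ : ℝ) (hr : 0 < r) : lapse σ r ^ 2 = r ^ (4 * σ) :=
  Real.sq_sqrt (Real.rpow_nonneg hr.le _)

end Coefficients

/-! ### Separation of variables -/

theorem dR_mode (k : ℝ) (m : ℤ) (R : ℝ → ℂ) : dR (mode k m R) = mode k m (deriv R) := by
  funext p
  simp only [dR, mode, deriv_mul_const_field]

theorem dZ_mode (k : ℝ) (m : ℤ) (R : ℝ → ℂ) :
    dZ (mode k m R) = mode k m (fun r => Complex.I * k * R r) := by
  funext p
  have h : HasDerivAt (fun s : ℝ => Complex.exp (Complex.I * k * s))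
      (Complex.exp (Complex.I * k * p.2.1) * (Complex.I * k * 1)) p.2.1 :=
    ((Complex.ofRealCLM.hasDerivAt (x := p.2.1)).const_mul (Complex.I * k)).cexp
  simp only [dZ, mode, deriv_mul_const_field, deriv_const_mul_field, h.deriv]
  ring

theorem dT_mode (k : ℝ) (m : ℤ) (R : ℝ → ℂ) :
    dT (mode k m R) = mode k m (fun r => Complex.I * m * R r) := by
  funext p
  have h : HasDerivAt (fun s : ℝ => Complex.exp (Complex.I * m * s))
      (Complex.exp (Complex.I * m * p.2.2) * (Complex.I * m * 1)) p.2.2 :=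
    ((Complex.ofRealCLM.hasDerivAt (x := p.2.2)).const_mul (Complex.I * m)).cexp
  simp only [dT, mode, deriv_const_mul_field, h.deriv]
  ring

theorem mulR_mode (c : ℝ → ℝ) (k : ℝ) (m : ℤ) (R : ℝ → ℂ) :
    mulR c (mode k m R) = mode k m (fun r => c r * R r) := by
  funext p
  simp only [mulR, mode]
  ring

/-- The radial part of the Klein–Gordon operator on a separated function. -/
theorem kleinGordon_mode {σ C M k : ℝ} (hC : 0 < C) {m : ℤ} {R : ℝ → ℂ} {p : ℝ × ℝ × ℝ}
    (hp : 0 < p.1) : kleinGordon σ C M (mode k m R) p =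
      mode k m (fun r => -((C * r ^ (1 - 2 * alpha σ) : ℝ) *
        (deriv (fun s : ℝ => (s / C : ℝ) * deriv R s) r - (r / C : ℝ) * k ^ 2 * R r
          - (C * r ^ (8 * σ ^ 2 - 1) : ℝ) * m ^ 2 * R r)) + (r ^ (4 * σ) * M ^ 2 : ℝ) * R r) p := by
  have hd : deriv (fun r => ((sqrtDet σ C r * (hrr σ r)⁻¹ * lapse σ r : ℝ) : ℂ) * deriv R r) p.1
      = deriv (fun s : ℝ => ((s / C : ℝ) : ℂ) * deriv R s) p.1 := by
    refine Filter.EventuallyEq.deriv_eq ?_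
    filter_upwards [Ioi_mem_nhds hp] with y hy
    rw [axial_coeff_eq σ hC hy]
  rw [kleinGordon, weightedLaplacian]
  simp only [dR_mode, dZ_mode, dT_mode, mulR_mode]
  simp only [Pi.add_apply, Pi.neg_apply, mulR, mode]
  rw [hd, axial_coeff_eq σ hC hp, angular_coeff_eq σ hC hp, lapse_div_sqrtDet σ hC hp,
    lapse_sq σ hp]
  have hI : Complex.I ^ 2 = -1 := Complex.I_sq
  linear_combination (-(C * p.1 ^ (1 - 2 * alpha σ) : ℝ) * ((p.1 / C : ℝ) * k ^ 2 * R p.1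
    + (C * p.1 ^ (8 * σ ^ 2 - 1) : ℝ) * m ^ 2 * R p.1) * Complex.exp (Complex.I * k * p.2.1)
    * Complex.exp (Complex.I * m * p.2.2)) * hI

/-- The coefficient of the radial Klein–Gordon equation at `λ = 0`, as an Euler system. -/
def radialCoeff (σ C M k : ℝ) (m : ℤ) (r : ℝ) : ℝ :=
  k ^ 2 * r ^ 2 + M ^ 2 * r ^ (4 * σ + 2 * alpha σ) + m ^ 2 * C ^ 2 * r ^ (8 * σ ^ 2)

theorem mode_eq_mode_iff {k : ℝ} {m : ℤ} {R₁ R₂ : ℝ → ℂ} {p : ℝ × ℝ × ℝ} :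
    mode k m R₁ p = mode k m R₂ p ↔ R₁ p.1 = R₂ p.1 := by
  simp [mode, mul_left_inj' (Complex.exp_ne_zero _)]

theorem radial_equation_iff {σ C M k : ℝ} (hC : 0 < C) {m : ℤ} {lam a b : ℂ} {r : ℝ} (hr : 0 < r) :
    -((C * r ^ (1 - 2 * alpha σ) : ℝ) * (a - (r / C : ℝ) * k ^ 2 * b
          - (C * r ^ (8 * σ ^ 2 - 1) : ℝ) * m ^ 2 * b)) + (r ^ (4 * σ) * M ^ 2 : ℝ) * b = lam * b ↔
      C * a = r⁻¹ • (((radialCoeff σ C M k m r : ℂ) - lam * (r ^ (2 * alpha σ) : ℝ)) * b) := by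
  have hw : 0 < r ^ (2 * alpha σ) := Real.rpow_pos_of_pos hr _
  have hC' : (C : ℂ) ≠ 0 := by exact_mod_cast hC.ne'
  have hr' : (r : ℂ) ≠ 0 := by exact_mod_cast hr.ne'
  have hw' : ((r ^ (2 * alpha σ) : ℝ) : ℂ) ≠ 0 := by exact_mod_cast hw.ne'
  rw [radialCoeff, Real.rpow_sub hr, Real.rpow_one, Real.rpow_add hr,
    Real.rpow_sub hr (8 * σ ^ 2) 1, Real.rpow_one, Complex.real_smul]
  generalize r ^ (2 * alpha σ) = w at *
  push_cast
  field_simp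
  constructor
  · intro h
    linear_combination -h
  · intro h
    linear_combination -h

theorem isRadialSolution_iff {σ C M k : ℝ} (hC : 0 < C) {m : ℤ} {lam : ℂ} {R : ℝ → ℂ} :
    IsRadialSolution σ C M k m lam R ↔ ∃ S, IsEulerSolution
      (fun r => (radialCoeff σ C M k m r : ℂ) - lam * (r ^ (2 * alpha σ) : ℝ)) R S := by
  have hC' : (C : ℂ) ≠ 0 := by exact_mod_cast hC.ne'
  have key : ∀ r : ℝ, 0 < r → ((∀ z θ, kleinGordon σ C M (mode k m R) (r, z, θ)
      = lam * mode k m R (r, z, θ)) ↔ C * deriv (fun s : ℝ => ((s / C : ℝ) : ℂ) * deriv R s) r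
        = r⁻¹ • (((radialCoeff σ C M k m r : ℂ) - lam * (r ^ (2 * alpha σ) : ℝ)) * R r)) := by
    intro r hr
    have h : ∀ z θ, lam * mode k m R (r, z, θ) = mode k m (fun r => lam * R r) (r, z, θ) := by
      intro z θ
      simp only [mode]
      ring
    rw [← radial_equation_iff hC hr]
    constructor
    · intro H
      have := H 0 0
      rw [kleinGordon_mode hC hr, h, mode_eq_mode_iff] at this
      exact this
    · intro H z θ
      rw [kleinGordon_mode hC hr, h, mode_eq_mode_iff]
      exact H
  have hcont : ContinuousOn (fun r : ℝ =>
      (radialCoeff σ C M k m r : ℂ) - lam * (r ^ (2 * alpha σ) : ℝ)) (Ioi 0) := by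
    have h (e : ℝ) : ContinuousOn (fun r : ℝ => r ^ e) (Ioi 0) := (contDiffOn_rpow e).continuousOn
    have h1 : ContinuousOn (radialCoeff σ C M k m) (Ioi 0) :=
      ((by fun_prop : Continuous fun r : ℝ => k ^ 2 * r ^ 2).continuousOn.add
        ((h _).const_mul _)).add ((h _).const_mul _)
    exact (Complex.continuous_ofReal.comp_continuousOn h1).sub
      ((Complex.continuous_ofReal.comp_continuousOn (h _)).const_mul _)
  constructor
  · rintro ⟨hR, hA⟩
    have hR1 := (contDiffOn_succ_iff_deriv_of_isOpen (n := 1) isOpen_Ioi).1 hR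
    have hR2 := hR1.2.2.differentiableOn one_ne_zero
    refine ⟨fun r => r • deriv R r, fun r hr => ?_⟩
    have hn : Ioi (0 : ℝ) ∈ 𝓝 r := Ioi_mem_nhds hr
    have h1 := (hR1.1.differentiableAt hn).hasDerivAt
    have h2 := (hR2.differentiableAt hn).hasDerivAt
    refine ⟨by rwa [smul_smul, inv_mul_cancel₀ hr.ne', one_smul], ?_⟩
    rw [← (key r hr).1 fun z θ => hA (r, z, θ) hr]
    have h3 : DifferentiableAt ℝ (fun s : ℝ => ((s / C : ℝ) : ℂ) * deriv R s) r :=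
      (Complex.ofRealCLM.differentiableAt.comp r (differentiableAt_id.div_const C)).mul
        h2.differentiableAt
    convert h3.hasDerivAt.const_mul (C : ℂ) using 1
    funext s
    rw [Complex.real_smul]
    push_cast
    field_simp
  · rintro ⟨S, h⟩
    have hd : EqOn (deriv R) (fun r => r⁻¹ • S r) (Ioi 0) := fun r hr => (h r hr).1.deriv
    have hS : DifferentiableOn ℝ S (Ioi 0) := fun r hr =>
      (h r hr).2.differentiableAt.differentiableWithinAt
    have hR : DifferentiableOn ℝ R (Ioi 0) := fun r hr =>
      (h r hr).1.differentiableAt.differentiableWithinAt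
    have hinv : ContDiffOn ℝ 1 (fun r : ℝ => r⁻¹) (Ioi 0) :=
      contDiffOn_id.inv fun r hr => (mem_Ioi.1 hr).ne'
    have hS1 : ContDiffOn ℝ 1 S (Ioi 0) := by
      refine (contDiffOn_succ_iff_deriv_of_isOpen (n := 0) isOpen_Ioi).2 ⟨hS, by simp, ?_⟩
      rw [contDiffOn_zero]
      exact (hinv.continuousOn.smul (hcont.mul hR.continuousOn)).congr fun r hr => (h r hr).2.deriv
    refine ⟨(contDiffOn_succ_iff_deriv_of_isOpen (n := 1) isOpen_Ioi).2 ⟨hR, by simp,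
      (hinv.smul hS1).congr hd⟩, ?_⟩
    rintro ⟨r, z, θ⟩ hr
    refine (key r hr).2 ?_ z θ
    rw [← (h r hr).2.deriv]
    have h4 : (fun s : ℝ => ((s / C : ℝ) : ℂ) * deriv R s) =ᶠ[𝓝 r] fun s => (C : ℂ)⁻¹ * S s := by
      filter_upwards [Ioi_mem_nhds hr] with s hs
      rw [hd hs]
      simp only [Complex.real_smul]
      have : (s : ℂ) ≠ 0 := by exact_mod_cast (mem_Ioi.1 hs).ne'
      push_cast
      field_simp
    rw [h4.deriv_eq, deriv_const_mul_field]
    field_simp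

theorem rOfX_eq {σ C x : ℝ} (hσ : σ ≠ 1 / 2) (hC : 0 < C) (hx : 0 < x) :
    rOfX σ C x = (alpha σ * C) ^ (1 / (2 * alpha σ)) * x ^ (alpha σ)⁻¹ := by
  have hα := alpha_pos hσ
  rw [rOfX, Real.mul_rpow (by positivity) (by positivity), ← Real.rpow_natCast_mul hx.le]
  congr 2
  push_cast
  field_simp

theorem rOfX_pos {σ C x : ℝ} (hσ : σ ≠ 1 / 2) (hC : 0 < C) (hx : 0 < x) : 0 < rOfX σ C x := by
  have hα := alpha_pos hσ
  exact Real.rpow_pos_of_pos (by positivity) _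

theorem rOfX_rpow {σ C x : ℝ} (hσ : σ ≠ 1 / 2) (hC : 0 < C) (hx : 0 < x) (e : ℝ) :
    rOfX σ C x ^ e = (alpha σ * C * x ^ 2) ^ (e / (2 * alpha σ)) := by
  have hα := alpha_pos hσ
  rw [rOfX, ← Real.rpow_mul (by positivity)]
  congr 1
  ring

/-- The potential is the pull-back of the radial coefficient, shifted by the Euler term. -/
theorem sq_mul_potential {σ C M k : ℝ} (hσ : σ ≠ 1 / 2) (hC : 0 < C) {m : ℤ} {x : ℝ}
    (hx : 0 < x) : x ^ 2 * potential σ C M k m x + 1 / 4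
      = (alpha σ)⁻¹ ^ 2 * radialCoeff σ C M k m (rOfX σ C x) := by
  have hα := alpha_pos hσ
  have hs : 0 < alpha σ * C * x ^ 2 := by positivity
  have e1 : rOfX σ C x ^ 2
      = (alpha σ * C * x ^ 2) ^ ((-alpha σ + 1) / alpha σ) * (alpha σ * C * x ^ 2) := by
    rw [← Real.rpow_two, rOfX_rpow hσ hC hx, ← Real.rpow_add_one hs.ne']
    congr 1
    field_simp
    ring
  have e2 : rOfX σ C x ^ (4 * σ + 2 * alpha σ)
      = (alpha σ * C * x ^ 2) ^ (2 * σ / alpha σ) * (alpha σ * C * x ^ 2) := by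
    rw [rOfX_rpow hσ hC hx, ← Real.rpow_add_one hs.ne']
    congr 1
    field_simp
    ring
  have e3 : rOfX σ C x ^ (8 * σ ^ 2)
      = (alpha σ * C * x ^ 2) ^ ((4 * σ - 1) / alpha σ) * (alpha σ * C * x ^ 2) := by
    rw [rOfX_rpow hσ hC hx, ← Real.rpow_add_one hs.ne']
    congr 1
    field_simp
    rw [alpha]
    ring
  rw [radialCoeff, e1, e2, e3, potential]
  field_simp
  ring

theorem isRadialSolution_iff_isSolution {σ C M k : ℝ} (hC : 0 < C) (hσ : σ ≠ 1 / 2) {m : ℤ}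
    {lam : ℂ} {R : ℝ → ℂ} : IsRadialSolution σ C M k m lam R ↔
      IsSolution (potential σ C M k m) (C * lam / alpha σ) (toSchrodinger σ C R) := by
  have hα := alpha_pos hσ
  rw [isRadialSolution_iff hC, isSolution_iff, ← exists_isEulerSolution_comp_rpow_iff
    (κ := (alpha σ * C) ^ (1 / (2 * alpha σ))) (β := (alpha σ)⁻¹) (by positivity) (by positivity)]
  have hp : ∀ x : ℝ, 0 < x → (x ^ 2 : ℝ) • ((potential σ C M k m x : ℂ) - C * lam / alpha σ) + 1 / 4
      = ((alpha σ)⁻¹ ^ 2 : ℝ) • ((radialCoeff σ C M k m (rOfX σ C x) : ℂ)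
        - lam * (rOfX σ C x ^ (2 * alpha σ) : ℝ)) := by
    intro x hx
    have h1 : (x : ℂ) ^ 2 * potential σ C M k m x + 1 / 4
      = (alpha σ : ℂ)⁻¹ ^ 2 * radialCoeff σ C M k m (rOfX σ C x) := by
      have h := congrArg (fun t : ℝ => (t : ℂ)) (sq_mul_potential (M := M) (k := k) (m := m) hσ hC hx)
      push_cast at h
      exact h
    have hα' : (alpha σ : ℂ) ≠ 0 := by exact_mod_cast hα.ne'
    rw [rOfX_rpow hσ hC hx, div_self (by positivity), Real.rpow_one, Complex.real_smul,
      Complex.real_smul, mul_sub]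
    push_cast
    rw [mul_sub, ← h1]
    field_simp
    ring
  have hR : ∀ x : ℝ, 0 < x → (√x)⁻¹ • toSchrodinger σ C R x = R (rOfX σ C x) := by
    intro x hx
    have : (√x : ℂ) ≠ 0 := by exact_mod_cast (Real.sqrt_pos.2 hx).ne'
    rw [toSchrodinger, Complex.real_smul]
    push_cast
    field_simp
  constructor
  · rintro ⟨S, h⟩
    refine ⟨S, h.congr (fun x hx => ?_) (fun x hx => ?_) (fun _ _ => rfl)⟩
    · rw [← rOfX_eq hσ hC hx, hp x hx]
    · rw [← rOfX_eq hσ hC hx, hR x hx]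
  · rintro ⟨S, h⟩
    refine ⟨S, h.congr (fun x hx => ?_) (fun x hx => ?_) (fun _ _ => rfl)⟩
    · rw [← rOfX_eq hσ hC hx, hp x hx]
    · rw [← rOfX_eq hσ hC hx, hR x hx]

/-! ### The limiting equation at zero -/

theorem eq_of_hasDerivAt_zero_Ioi {E : Type*} [NormedAddCommGroup E] [NormedSpace ℝ E]
    {F : ℝ → E} (h : ∀ x, 0 < x → HasDerivAt F 0 x) {x y : ℝ} (hx : 0 < x) (hy : 0 < y) :
    F x = F y :=
  isOpen_Ioi.is_const_of_deriv_eq_zero isPreconnected_Ioi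
    (fun z hz => (h z hz).differentiableAt.differentiableWithinAt) (fun z hz => (h z hz).deriv) hx hy

theorem isSolution_limiting_iff (ψ : ℝ → ℂ) : IsSolution (fun x => -1 / (4 * x ^ 2)) 0 ψ ↔
    ∃! c : ℂ × ℂ, ∀ x : ℝ, 0 < x →
      ψ x = c.1 * (√x : ℂ) + c.2 * ((√x : ℂ) * (Real.log x : ℂ)) := by
  have hp : ∀ x : ℝ, 0 < x →
      (x ^ 2 : ℝ) • (((-1 / (4 * x ^ 2) : ℝ) : ℂ) - 0) + 1 / 4 = (0 : ℂ) := by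
    intro x hx
    have : (x : ℂ) ≠ 0 := by exact_mod_cast hx.ne'
    rw [Complex.real_smul]
    push_cast
    field_simp
    ring
  rw [isSolution_iff]
  constructor
  · rintro ⟨S, hS⟩
    have h := hS.congr (q := fun _ => 0) (fun x hx => (hp x hx).symm) (fun _ _ => rfl)
      (fun _ _ => rfl)
    have hS1 : ∀ x : ℝ, 0 < x → S x = S 1 := fun x hx =>
      eq_of_hasDerivAt_zero_Ioi (fun y hy => by simpa using (h y hy).2) hx one_pos
    have hR : ∀ x : ℝ, 0 < x → (√x)⁻¹ • ψ x - Real.log x • S 1 = ψ 1 := by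
      intro x hx
      have h1 := eq_of_hasDerivAt_zero_Ioi
        (F := fun x : ℝ => (√x)⁻¹ • ψ x - Real.log x • S 1) (fun y hy => by
          have h2 := (h y hy).1.sub ((Real.hasDerivAt_log hy.ne').smul_const (S 1))
          rw [hS1 y hy, sub_self] at h2
          exact h2) hx one_pos
      simpa using h1
    refine ⟨(ψ 1, S 1), fun x hx => ?_, ?_⟩
    · have hs : (√x : ℂ) ≠ 0 := by exact_mod_cast (Real.sqrt_pos.2 hx).ne'
      have h2 := hR x hx
      rw [Complex.real_smul, Complex.real_smul] at h2
      push_cast at h2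
      change ψ x = ψ 1 * (√x : ℂ) + S 1 * ((√x : ℂ) * (Real.log x : ℂ))
      rw [← h2]
      field_simp
      ring
    · rintro ⟨a, b⟩ hab
      simp only at hab
      have ha : a = ψ 1 := by simpa using (hab 1 one_pos).symm
      have he := Real.exp_pos 1
      have h1 := hab _ he
      have h2 := hR _ he
      have hs : (√(Real.exp 1) : ℂ) ≠ 0 := by exact_mod_cast (Real.sqrt_pos.2 he).ne'
      rw [Real.log_exp] at h1 h2
      rw [h1, Complex.real_smul] at h2
      push_cast at h2
      field_simp at h2
      rw [Prod.mk.injEq, ← ha]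
      refine ⟨rfl, ?_⟩
      rw [← ha] at h2
      rw [one_smul] at h2
      linear_combination h2
  · rintro ⟨⟨a, b⟩, hab, -⟩
    simp only at hab
    have h : IsEulerSolution (fun _ => (0 : ℂ)) (fun r : ℝ => a + Real.log r • b) fun _ => b := by
      intro r hr
      refine ⟨((Real.hasDerivAt_log hr.ne').smul_const b).const_add a, ?_⟩
      simpa using hasDerivAt_const r b
    refine ⟨_, h.congr hp (fun x hx => ?_) (fun _ _ => rfl)⟩
    have hs : (√x : ℂ) ≠ 0 := by exact_mod_cast (Real.sqrt_pos.2 hx).ne'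
    rw [hab x hx, Complex.real_smul, Complex.real_smul]
    push_cast
    field_simp

/-! ### Square integrability near the ends -/

theorem squareIntegrableAtZero_of_bound {ψ : ℝ → ℂ} (hψ : ContinuousOn ψ (Ioi 0)) {δ K : ℝ}
    (hδ : 0 < δ) (h : ∀ x ∈ Ioo 0 δ, ‖ψ x‖ ≤ K) : SquareIntegrableAtZero ψ :=
  ⟨δ, hδ, MemLp.of_bound ((hψ.mono Ioo_subset_Ioi_self).aestronglyMeasurable measurableSet_Ioo) K
    ((ae_restrict_iff' measurableSet_Ioo).2 (Eventually.of_forall h))⟩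

theorem squareIntegrableAtZero_sqrt : SquareIntegrableAtZero fun x => (√x : ℂ) := by
  refine squareIntegrableAtZero_of_bound (δ := 1) (K := 1) (by fun_prop) one_pos fun x hx => ?_
  rw [Complex.norm_real, Real.norm_of_nonneg (Real.sqrt_nonneg _)]
  exact Real.sqrt_le_one.2 hx.2.le

theorem squareIntegrableAtZero_sqrt_mul_log :
    SquareIntegrableAtZero fun x => (√x : ℂ) * (Real.log x : ℂ) := by
  have h0 : Tendsto (fun x : ℝ => (√x : ℂ) * (Real.log x : ℂ)) (𝓝[>] 0) (𝓝 0) := by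
    have h1 := tendsto_log_mul_rpow_nhdsGT_zero (r := 1 / 2) (by norm_num)
    have h2 := (Complex.continuous_ofReal.tendsto 0).comp h1
    rw [Complex.ofReal_zero] at h2
    refine h2.congr fun x => ?_
    rw [Real.sqrt_eq_rpow]
    simp [mul_comm]
  have h1 : ∀ᶠ x : ℝ in 𝓝[>] 0, ‖(√x : ℂ) * (Real.log x : ℂ)‖ < 1 := by
    have := h0.norm
    rw [norm_zero] at this
    exact this.eventually_lt_const one_pos
  obtain ⟨δ, hδ, hδ'⟩ := mem_nhdsGT_iff_exists_Ioo_subset.1 h1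
  refine squareIntegrableAtZero_of_bound (K := 1) ?_ hδ fun x hx => (hδ' hx).le
  refine ContinuousOn.mul (by fun_prop) (Complex.continuous_ofReal.comp_continuousOn ?_)
  exact Real.continuousOn_log.mono fun x hx => (mem_Ioi.1 hx).ne'

/-- If the coefficient of a real Euler system is small near `0`, then `x (R² / 4 + S²)` is
monotone there, so that `√x R` stays bounded. -/
theorem IsEulerSolution.exists_bound {p R S : ℝ → ℝ} (h : IsEulerSolution p R S) {δ : ℝ}
    (hp : ∀ x ∈ Ioo 0 δ, |p x| ≤ 1 / 4) : ∃ K, ∀ x ∈ Ioo 0 (δ / 2), |√x * R x| ≤ K := by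
  rcases le_or_gt δ 0 with hδ | hδ
  · exact ⟨0, fun x hx => absurd (hx.1.trans hx.2) (by linarith)⟩
  let H : ℝ → ℝ := fun x => x * (R x ^ 2 / 4 + S x ^ 2)
  have hd : ∀ x, 0 < x →
      HasDerivAt H (R x ^ 2 / 4 + S x ^ 2 + (1 / 2 + 2 * p x) * (R x * S x)) x := by
    intro x hx
    obtain ⟨h1, h2⟩ := h x hx
    refine ((hasDerivAt_id x).mul (((h1.pow 2).div_const 4).add (h2.pow 2))).congr_deriv ?_
    simp only [smul_eq_mul, id, Pi.add_apply, Pi.pow_apply]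
    field_simp
    ring
  have hmono : MonotoneOn H (Ioo 0 δ) := by
    refine monotoneOn_of_deriv_nonneg (convex_Ioo _ _)
      (fun x hx => (hd x hx.1).continuousAt.continuousWithinAt) ?_ ?_
    · rw [interior_Ioo]
      exact fun x hx => (hd x hx.1).differentiableAt.differentiableWithinAt
    · rw [interior_Ioo]
      intro x hx
      rw [(hd x hx.1).deriv]
      have h3 := abs_le.1 (hp x hx)
      -- a convex combination of the squares of `R/2 + S` and `R/2 - S`
      have h4 : R x ^ 2 / 4 + S x ^ 2 + (1 / 2 + 2 * p x) * (R x * S x)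
          = (3 / 4 + p x) * (R x / 2 + S x) ^ 2 + (1 / 4 - p x) * (R x / 2 - S x) ^ 2 := by ring
      rw [h4]
      exact add_nonneg (mul_nonneg (by linarith) (sq_nonneg _))
        (mul_nonneg (by linarith) (sq_nonneg _))
  refine ⟨√(4 * H (δ / 2)), fun x hx => Real.abs_le_sqrt ?_⟩
  have h1 := hmono ⟨hx.1, by linarith [hx.2]⟩ ⟨by linarith, by linarith⟩ hx.2.le
  have h2 : 0 ≤ x * S x ^ 2 := mul_nonneg hx.1.le (sq_nonneg _)
  rw [mul_pow, Real.sq_sqrt hx.1.le]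
  simp only [H] at h1 ⊢
  linarith

/-- A potential with `x² V(x) → -1/4` at `0` is in the limit circle case there: at `E = 0` all
solutions are bounded. -/
theorem limitCircleAtZero_of_tendsto {V : ℝ → ℝ}
    (hV : Tendsto (fun x => x ^ 2 * V x + 1 / 4) (𝓝[>] 0) (𝓝 0)) : LimitCircleAtZero V := by
  refine ⟨0, fun ψ hψ => ?_⟩
  have hcont : ContinuousOn ψ (Ioi 0) := by
    obtain ⟨φ, hφ⟩ := hψ
    exact fun x hx => (hφ x hx).1.continuousAt.continuousWithinAt
  obtain ⟨S, hS⟩ := isSolution_iff.1 hψ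
  have hsmall : ∀ᶠ x : ℝ in 𝓝[>] 0, |x ^ 2 * V x + 1 / 4| < 1 / 4 := by
    have := hV.abs
    rw [abs_zero] at this
    exact this.eventually_lt_const (by norm_num)
  obtain ⟨δ, hδ, hδ'⟩ := mem_nhdsGT_iff_exists_Ioo_subset.1 hsmall
  have hp : ∀ x : ℝ, (x ^ 2 : ℝ) • ((V x : ℂ) - 0) + 1 / 4 = ((x ^ 2 * V x + 1 / 4 : ℝ) : ℂ) := by
    intro x
    rw [Complex.real_smul]
    push_cast
    ring
  -- as the equation is real, real and imaginary parts solve it separately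
  have hpart : ∀ L : ℂ →L[ℝ] ℝ, IsEulerSolution (fun x => x ^ 2 * V x + 1 / 4)
      (fun x => (√x)⁻¹ * L (ψ x)) fun x => L (S x) := by
    intro L x hx
    obtain ⟨h1, h2⟩ := hS x hx
    simp only [hp] at h2
    have h1' := L.hasFDerivAt.comp_hasDerivAt x h1
    have h2' := L.hasFDerivAt.comp_hasDerivAt x h2
    rw [← Complex.real_smul, map_smul, map_smul, map_smul] at h2'
    rw [map_smul] at h1'
    refine ⟨h1'.congr_of_eventuallyEq (Eventually.of_forall fun y => ?_), h2'⟩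
    exact (L.map_smul _ _).symm
  obtain ⟨K₁, hK₁⟩ := (hpart Complex.reCLM).exists_bound fun x hx => (hδ' hx).le
  obtain ⟨K₂, hK₂⟩ := (hpart Complex.imCLM).exists_bound fun x hx => (hδ' hx).le
  refine squareIntegrableAtZero_of_bound hcont (half_pos hδ) (K := K₁ + K₂) fun x hx => ?_
  have hs : √x ≠ 0 := (Real.sqrt_pos.2 hx.1).ne'
  have e1 := hK₁ x hx
  have e2 := hK₂ x hx
  rw [mul_inv_cancel_left₀ hs] at e1 e2
  exact (Complex.norm_le_abs_re_add_abs_im _).trans (add_le_add e1 e2)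

/-! ### The limit point case at infinity -/

/-- Two solutions of a Schrödinger equation with Wronskian `1`. -/
theorem exists_solutions_wronskian_eq_one {𝕜 : Type*} [RCLike 𝕜] {v : ℝ → 𝕜}
    (hv : ContinuousOn v (Ioi 0)) : ∃ ψ₁ φ₁ ψ₂ φ₂ : ℝ → 𝕜,
      (∀ x, 0 < x → HasDerivAt ψ₁ (φ₁ x) x ∧ HasDerivAt φ₁ (v x * ψ₁ x) x) ∧
      (∀ x, 0 < x → HasDerivAt ψ₂ (φ₂ x) x ∧ HasDerivAt φ₂ (v x * ψ₂ x) x) ∧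
      ∀ x, 0 < x → ψ₁ x * φ₂ x - φ₁ x * ψ₂ x = 1 := by
  have hp : ContinuousOn (fun x : ℝ => (x ^ 2 : ℝ) • v x + 1 / 4) (Ioi 0) :=
    ((continuous_pow 2).continuousOn.smul hv).add continuousOn_const
  have key : ∀ a b : 𝕜, ∃ ψ φ : ℝ → 𝕜, ψ 1 = a ∧ φ 1 = b + (1 / 2 : ℝ) • a ∧
      ∀ x, 0 < x → HasDerivAt ψ (φ x) x ∧ HasDerivAt φ (v x * ψ x) x := by
    intro a b
    obtain ⟨R, S, hR, hS, h⟩ := exists_isEulerSolution hp a b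
    refine ⟨_, _, ?_, ?_, fun x hx => ⟨(h.hasDerivAt_sqrt_smul hx).1,
      (h.hasDerivAt_sqrt_smul hx).2.congr_deriv ?_⟩⟩
    · simp [hR]
    · simp [hR, hS]
    · rw [add_sub_cancel_right, smul_mul_assoc, smul_smul, mul_smul_comm]
      congr 1
      field_simp
  obtain ⟨ψ₁, φ₁, h1, h1', H₁⟩ := key 1 0
  obtain ⟨ψ₂, φ₂, h2, h2', H₂⟩ := key 0 1
  refine ⟨ψ₁, φ₁, ψ₂, φ₂, H₁, H₂, fun x hx => ?_⟩
  have hW := eq_of_hasDerivAt_zero_Ioi (F := fun x => ψ₁ x * φ₂ x - φ₁ x * ψ₂ x) (fun y hy => by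
    refine (((H₁ y hy).1.mul (H₂ y hy).2).sub ((H₁ y hy).2.mul (H₂ y hy).1)).congr_deriv ?_
    ring) hx one_pos
  simpa [h1, h1', h2, h2'] using hW

/-- For a potential bounded below, the derivative of a solution that is square integrable at
infinity is square integrable as well: otherwise `(|ψ|²)'` would tend to infinity. -/
theorem integrableOn_norm_sq_deriv {V : ℝ → ℝ} {E : ℂ} {ψ φ : ℝ → ℂ} {c κ : ℝ} (hc : 0 < c)
    (hV : ContinuousOn V (Ioi 0)) (hκ : ∀ x, c ≤ x → -κ ≤ V x - E.re)
    (hsol : ∀ x, 0 < x → HasDerivAt ψ (φ x) x ∧ HasDerivAt φ (((V x : ℂ) - E) * ψ x) x)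
    (hψ : IntegrableOn (fun x => ‖ψ x‖ ^ 2) (Ioi c)) :
    IntegrableOn (fun x => ‖φ x‖ ^ 2) (Ioi c) := by
  by_contra hni
  have cψ : ContinuousOn ψ (Ioi 0) := fun x hx => (hsol x hx).1.continuousAt.continuousWithinAt
  have cφ : ContinuousOn φ (Ioi 0) := fun x hx => (hsol x hx).2.continuousAt.continuousWithinAt
  have hIcc : ∀ y, Icc c y ⊆ Ioi 0 := fun y x hx => hc.trans_le hx.1
  have hκ0 : ∀ x, c ≤ x → -|κ| ≤ V x - E.re := fun x hx =>
    (neg_le_neg (le_abs_self κ)).trans (hκ x hx)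
  let f : ℝ → ℝ := fun x => 2 * inner ℝ (ψ x) (φ x)
  have hn : ∀ x, 0 < x → HasDerivAt (fun x => ‖ψ x‖ ^ 2) (f x) x := fun x hx =>
    (hsol x hx).1.norm_sq
  have hf : ∀ x, 0 < x →
      HasDerivAt f (2 * ‖φ x‖ ^ 2 + 2 * (V x - E.re) * ‖ψ x‖ ^ 2) x := by
    intro x hx
    refine (((hsol x hx).1.inner ℝ (hsol x hx).2).const_mul 2).congr_deriv ?_
    have e1 : inner ℝ (ψ x) (((V x : ℂ) - E) * ψ x) = (V x - E.re) * ‖ψ x‖ ^ 2 := by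
      rw [Complex.inner, Complex.sq_norm, Complex.normSq_apply]
      simp
      ring
    rw [e1, real_inner_self_eq_norm_sq]
    ring
  have ccψ : ∀ y, ContinuousOn (fun x => ‖ψ x‖ ^ 2) (Icc c y) := fun y =>
    (cψ.norm.pow 2).mono (hIcc y)
  have ccφ : ∀ y, ContinuousOn (fun x => ‖φ x‖ ^ 2) (Icc c y) := fun y =>
    (cφ.norm.pow 2).mono (hIcc y)
  have ccV : ∀ y, ContinuousOn (fun x => V x - E.re) (Icc c y) := fun y =>
    (hV.sub continuousOn_const).mono (hIcc y)
  set N : ℝ := ∫ x in Ioi c, ‖ψ x‖ ^ 2 with hN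
  -- the lower bound `f y ≥ f c + 2 ∫ |φ|² - 2 |κ| N`
  have hlow : ∀ y, c ≤ y → f c + 2 * (∫ x in c..y, ‖φ x‖ ^ 2) - 2 * |κ| * N ≤ f y := by
    intro y hy
    have i1 : IntervalIntegrable (fun x => ‖ψ x‖ ^ 2) volume c y :=
      (ccψ y).intervalIntegrable_of_Icc hy
    have i2 : IntervalIntegrable (fun x => ‖φ x‖ ^ 2) volume c y :=
      (ccφ y).intervalIntegrable_of_Icc hy
    have i3 : IntervalIntegrable (fun x => 2 * ‖φ x‖ ^ 2 + 2 * (V x - E.re) * ‖ψ x‖ ^ 2)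
        volume c y :=
      (((ccφ y).const_mul 2).add (((ccV y).const_mul 2).mul (ccψ y))).intervalIntegrable_of_Icc hy
    have h1 := intervalIntegral.integral_eq_sub_of_hasDerivAt (a := c) (b := y)
      (fun x hx => hf x (hc.trans_le (by rw [uIcc_of_le hy] at hx; exact hx.1))) i3
    have h2 : ∫ x in c..y, (2 * ‖φ x‖ ^ 2 - 2 * |κ| * ‖ψ x‖ ^ 2)
        ≤ ∫ x in c..y, (2 * ‖φ x‖ ^ 2 + 2 * (V x - E.re) * ‖ψ x‖ ^ 2) := by
      refine intervalIntegral.integral_mono_on hy ((i2.const_mul 2).sub (i1.const_mul _)) i3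
        fun x hx => ?_
      have := mul_le_mul_of_nonneg_right (hκ0 x hx.1) (sq_nonneg ‖ψ x‖)
      linarith
    rw [intervalIntegral.integral_sub (i2.const_mul 2) (i1.const_mul _),
      intervalIntegral.integral_const_mul, intervalIntegral.integral_const_mul, h1] at h2
    have h3 : ∫ x in c..y, ‖ψ x‖ ^ 2 ≤ N := by
      rw [intervalIntegral.integral_of_le hy]
      exact setIntegral_mono_set hψ (Eventually.of_forall fun x => sq_nonneg _)
        (LE.le.eventuallyLE Ioc_subset_Ioi_self)
    have h4 := mul_le_mul_of_nonneg_left h3 (mul_nonneg zero_le_two (abs_nonneg κ))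
    linarith
  -- since `∫ |φ|²` is unbounded, `f ≥ 1` from some point on
  obtain ⟨x₀, hx₀, hfx₀⟩ : ∃ x₀, c ≤ x₀ ∧ ∀ y, x₀ ≤ y → 1 ≤ f y := by
    have h1 : ¬ ∀ᶠ y in atTop, ∫ x in c..y, ‖‖φ x‖ ^ 2‖ ≤ (1 - f c + 2 * |κ| * N) / 2 := by
      intro h
      refine hni (integrableOn_Ioi_of_intervalIntegral_norm_bounded _ c (fun y => ?_) tendsto_id h)
      exact ((ccφ y).integrableOn_Icc).mono_set Ioc_subset_Icc_self
    obtain ⟨x₀, h2, hx₀⟩ := ((not_eventually.1 h1).and_eventually (eventually_ge_atTop c)).exists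
    refine ⟨x₀, hx₀, fun y hy => ?_⟩
    have h3 : ∫ x in c..x₀, ‖φ x‖ ^ 2 ≤ ∫ x in c..y, ‖φ x‖ ^ 2 :=
      intervalIntegral.integral_mono_interval le_rfl hx₀ hy
        (Eventually.of_forall fun x => sq_nonneg _)
        ((ccφ y).intervalIntegrable_of_Icc (hx₀.trans hy))
    simp only [norm_pow, norm_norm, not_le] at h2
    linarith [hlow y (hx₀.trans hy)]
  have hgrow : ∀ y, x₀ + 1 ≤ y → 1 ≤ ‖ψ y‖ ^ 2 := by
    intro y hy
    have h1 := (convex_Icc x₀ y).mul_sub_le_image_sub_of_le_deriv (f := fun x => ‖ψ x‖ ^ 2)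
      (C := 1) ((ccψ y).mono (Icc_subset_Icc_left hx₀))
      (fun x hx => by
        rw [interior_Icc] at hx
        exact (hn x (hc.trans_le (hx₀.trans hx.1.le))).differentiableAt.differentiableWithinAt)
      (fun x hx => by
        rw [interior_Icc] at hx
        rw [(hn x (hc.trans_le (hx₀.trans hx.1.le))).deriv]
        exact hfx₀ x hx.1.le) x₀ ⟨le_rfl, by linarith⟩ y ⟨by linarith, le_rfl⟩ (by linarith)
    have h2 := sq_nonneg ‖ψ x₀‖
    linarith
  have h1 : IntegrableOn (fun _ => (1 : ℝ)) (Ioi (x₀ + 1)) := by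
    refine (hψ.mono_set (Ioi_subset_Ioi (by linarith : c ≤ x₀ + 1))).mono'
      aestronglyMeasurable_const ((ae_restrict_iff' measurableSet_Ioi).2
        (Eventually.of_forall fun y hy => ?_))
    rw [norm_one]
    exact hgrow y (le_of_lt hy)
  rw [integrableOn_const_iff] at h1
  simp at h1

theorem limitPointAtInfinity_of_bddBelow {V : ℝ → ℝ} (hV : ContinuousOn V (Ioi 0)) {κ : ℝ}
    (hκ : ∀ x, 1 ≤ x → -κ ≤ V x) : LimitPointAtInfinity V := by
  rintro ⟨E, hE⟩
  obtain ⟨ψ₁, φ₁, ψ₂, φ₂, H₁, H₂, hW⟩ := exists_solutions_wronskian_eq_one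
    (v := fun x => (V x : ℂ) - E) ((Complex.continuous_ofReal.comp_continuousOn hV).sub
      continuousOn_const)
  have key : ∀ ψ φ : ℝ → ℂ,
      (∀ x, 0 < x → HasDerivAt ψ (φ x) x ∧ HasDerivAt φ (((V x : ℂ) - E) * ψ x) x) →
      ∃ c, 1 ≤ c ∧ ∀ d, c ≤ d →
        MemLp ψ 2 (volume.restrict (Ioi d)) ∧ MemLp φ 2 (volume.restrict (Ioi d)) := by
    intro ψ φ h
    obtain ⟨c, hc, hψ⟩ := hE ψ ⟨φ, h⟩
    refine ⟨max c 1, le_max_right _ _, fun d hd => ?_⟩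
    have hd0 : 0 < d := hc.trans_le ((le_max_left _ _).trans hd)
    have hsub : Ioi d ⊆ Ioi (0 : ℝ) := Ioi_subset_Ioi hd0.le
    have mψ : AEStronglyMeasurable ψ (volume.restrict (Ioi d)) := ContinuousOn.aestronglyMeasurable
      (fun x hx => (h x (hsub hx)).1.continuousAt.continuousWithinAt) measurableSet_Ioi
    have mφ : AEStronglyMeasurable φ (volume.restrict (Ioi d)) := ContinuousOn.aestronglyMeasurable
      (fun x hx => (h x (hsub hx)).2.continuousAt.continuousWithinAt) measurableSet_Ioi
    have hψd : MemLp ψ 2 (volume.restrict (Ioi d)) :=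
      hψ.mono_measure (Measure.restrict_mono (Ioi_subset_Ioi ((le_max_left _ _).trans hd)) le_rfl)
    refine ⟨hψd, (memLp_two_iff_integrable_sq_norm mφ).2 ?_⟩
    refine integrableOn_norm_sq_deriv (κ := κ + E.re) hd0 hV (fun x hx => ?_) h
      ((memLp_two_iff_integrable_sq_norm mψ).1 hψd)
    linarith [hκ x (((le_max_right _ _).trans hd).trans hx)]
  obtain ⟨c₁, hc₁, h₁⟩ := key ψ₁ φ₁ H₁
  obtain ⟨c₂, hc₂, h₂⟩ := key ψ₂ φ₂ H₂
  have k₁ := h₁ (max c₁ c₂) (le_max_left _ _)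
  have k₂ := h₂ (max c₁ c₂) (le_max_right _ _)
  have hi : IntegrableOn (fun x => ψ₁ x * φ₂ x - φ₁ x * ψ₂ x) (Ioi (max c₁ c₂)) :=
    (k₁.1.integrable_mul k₂.2).sub (k₁.2.integrable_mul k₂.1)
  have h1 : IntegrableOn (fun _ => (1 : ℂ)) (Ioi (max c₁ c₂)) :=
    hi.congr_fun (fun x hx => hW x ((one_pos.trans_le (hc₁.trans (le_max_left _ _))).trans hx))
      measurableSet_Ioi
  rw [integrableOn_const_iff] at h1
  simp at h1

/-! ### Schrödinger operators in the limit circle case at zero -/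

/-- A smooth cutoff on `ℝ`, equal to `1` on `(-∞, 1]` and to `0` on `[2, ∞)`. -/
def cutoff (x : ℝ) : ℝ := Real.smoothTransition (2 - x)

theorem cutoff_contDiff : ContDiff ℝ ∞ cutoff :=
  Real.smoothTransition.contDiff.comp (contDiff_const.sub contDiff_id)

theorem cutoff_of_le_one {x : ℝ} (hx : x ≤ 1) : cutoff x = 1 :=
  Real.smoothTransition.one_of_one_le (by linarith)

theorem cutoff_of_two_le {x : ℝ} (hx : 2 ≤ x) : cutoff x = 0 :=
  Real.smoothTransition.zero_of_nonpos (by linarith)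

theorem abs_cutoff_le_one (x : ℝ) : |cutoff x| ≤ 1 := by
  rw [cutoff, abs_of_nonneg (Real.smoothTransition.nonneg _)]
  exact Real.smoothTransition.le_one _

theorem hasDerivAt_cutoff (x : ℝ) : HasDerivAt cutoff (deriv cutoff x) x :=
  (cutoff_contDiff.differentiable (by simp) x).hasDerivAt

theorem deriv_cutoff_contDiff : ContDiff ℝ ∞ (deriv cutoff) :=
  (contDiff_infty_iff_deriv.1 cutoff_contDiff).2

theorem hasDerivAt_deriv_cutoff (x : ℝ) :
    HasDerivAt (deriv cutoff) (deriv (deriv cutoff) x) x :=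
  (deriv_cutoff_contDiff.differentiable (by simp) x).hasDerivAt

theorem deriv_cutoff_eq_zero {x : ℝ} (hx : x < 1 ∨ 2 < x) : deriv cutoff x = 0 := by
  rcases hx with hx | hx
  · have : cutoff =ᶠ[𝓝 x] fun _ => 1 := by
      filter_upwards [Iio_mem_nhds hx] with y hy using cutoff_of_le_one (le_of_lt hy)
    rw [this.deriv_eq, deriv_const]
  · have : cutoff =ᶠ[𝓝 x] fun _ => 0 := by
      filter_upwards [Ioi_mem_nhds hx] with y hy using cutoff_of_two_le (le_of_lt hy)
    rw [this.deriv_eq, deriv_const]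

theorem deriv_deriv_cutoff_eq_zero {x : ℝ} (hx : x < 1 ∨ 2 < x) :
    deriv (deriv cutoff) x = 0 := by
  have : deriv cutoff =ᶠ[𝓝 x] fun _ => 0 := by
    rcases hx with hx | hx
    · filter_upwards [Iio_mem_nhds hx] with y hy using deriv_cutoff_eq_zero (Or.inl hy)
    · filter_upwards [Ioi_mem_nhds hx] with y hy using deriv_cutoff_eq_zero (Or.inr hy)
  rw [this.deriv_eq, deriv_const]

theorem memLp_two_of_bound_of_eq_zero {g : ℝ → ℝ} (hg : ContinuousOn g (Ioi 0)) {δ b K : ℝ}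
    (hδ : 0 < δ) (hK : ∀ x ∈ Ioo 0 δ, |g x| ≤ K) (hb : ∀ x, b < x → g x = 0) :
    MemLp g 2 (volume.restrict (Ioi 0)) := by
  have hcompact : Icc δ b ⊆ Ioi 0 := fun x hx => hδ.trans_le hx.1
  obtain ⟨K', hK'⟩ := isCompact_Icc.exists_bound_of_continuousOn (hg.mono hcompact)
  have hbound : ∀ x ∈ Ioc 0 b, ‖g x‖ ≤ max K K' := by
    intro x hx
    rcases lt_or_ge x δ with h | h
    · exact (hK x ⟨hx.1, h⟩).trans (le_max_left _ _)
    · exact (hK' x ⟨h, hx.2⟩).trans (le_max_right _ _)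
  have h1 : MemLp g 2 (volume.restrict (Ioc 0 b)) :=
    MemLp.of_bound ((hg.mono Ioc_subset_Ioi_self).aestronglyMeasurable measurableSet_Ioc) _
      ((ae_restrict_iff' measurableSet_Ioc).2 (Eventually.of_forall hbound))
  rw [← memLp_indicator_iff_restrict measurableSet_Ioc] at h1
  refine (h1.restrict (Ioi 0)).ae_eq ((ae_restrict_iff' measurableSet_Ioi).2
    (Eventually.of_forall fun x hx => ?_))
  by_cases h : x ≤ b
  · exact indicator_of_mem (s := Ioc 0 b) ⟨hx, h⟩ g
  · rw [indicator_of_notMem (fun h' => h h'.2), hb x (not_le.1 h)]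

theorem halfLineTest_memLp (f : halfLineTest) :
    MemLp (f : ℝ → ℂ) 2 (volume.restrict (Ioi 0)) := by
  obtain ⟨hf, K, hK, hK0, hfK⟩ := f.2
  exact halfLine_memLp hK hf.continuous.continuousOn hK0 hfK

theorem schrodingerAction_memLp {V : ℝ → ℝ} (hV : ContinuousOn V (Ioi 0)) (f : halfLineTest) :
    MemLp (schrodingerAction V f) 2 (volume.restrict (Ioi 0)) := by
  obtain ⟨hf, K, hK, hK0, hfK⟩ := f.2
  refine halfLine_memLp hK ?_ hK0 fun x hx => ?_
  · exact ((contDiff_deriv (contDiff_deriv hf)).continuous.continuousOn.neg).add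
      ((Complex.continuous_ofReal.comp_continuousOn hV).mul hf.continuous.continuousOn)
  · change -deriv (deriv (f : ℝ → ℂ)) x + (V x : ℂ) * (f : ℝ → ℂ) x = 0
    rw [deriv_eq_zero_of_notMem hK.isClosed (deriv_eq_zero_of_notMem hK.isClosed hfK) x hx,
      hfK x hx, neg_zero, mul_zero, add_zero]

/-- The truncated solutions `χ ψ₁`, `χ ψ₂` lie in the domain of the adjoint, and their boundary
form is the Wronskian of `ψ₁` and `ψ₂`. -/
theorem schrodingerOperator_not_isEssentiallySelfAdjoint {V : ℝ → ℝ} (hV : ContinuousOn V (Ioi 0))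
    (hV0 : Tendsto (fun x => x ^ 2 * V x + 1 / 4) (𝓝[>] 0) (𝓝 0)) :
    ¬ IsEssentiallySelfAdjoint (schrodingerOperator V hV) := by
  obtain ⟨ψ₁, φ₁, ψ₂, φ₂, H₁, H₂, hW⟩ := exists_solutions_wronskian_eq_one hV
  have hsmall : ∀ᶠ x : ℝ in 𝓝[>] 0, |x ^ 2 * V x + 1 / 4| < 1 / 4 := by
    have := hV0.abs
    rw [abs_zero] at this
    exact this.eventually_lt_const (by norm_num)
  obtain ⟨δ, hδ, hδ'⟩ := mem_nhdsGT_iff_exists_Ioo_subset.1 hsmall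
  have hδ0 : 0 < δ := hδ
  let u : (ℝ → ℝ) → ℝ → ℝ := fun ψ x => cutoff x * ψ x
  let w : (ℝ → ℝ) → (ℝ → ℝ) → ℝ → ℝ := fun ψ φ x =>
    -(deriv (deriv cutoff) x * ψ x + 2 * deriv cutoff x * φ x)
  have hcut : Continuous cutoff := cutoff_contDiff.continuous
  have hcut' : Continuous (deriv cutoff) := deriv_cutoff_contDiff.continuous
  have hcut'' : Continuous (deriv (deriv cutoff)) :=
    (contDiff_infty_iff_deriv.1 deriv_cutoff_contDiff).2.continuous
  have hu : ∀ ψ φ : ℝ → ℝ,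
      (∀ x, 0 < x → HasDerivAt ψ (φ x) x ∧ HasDerivAt φ (V x * ψ x) x) →
      MemLp (u ψ) 2 (volume.restrict (Ioi 0)) := by
    intro ψ φ h
    obtain ⟨K, hK⟩ := (isEulerSolution_inv_sqrt_smul h).exists_bound (δ := min δ 1) fun x hx => by
      rw [smul_eq_mul]
      exact (hδ' ⟨hx.1, hx.2.trans_le (min_le_left _ _)⟩).le
    have cψ : ContinuousOn ψ (Ioi 0) := fun x hx => (h x hx).1.continuousAt.continuousWithinAt
    refine memLp_two_of_bound_of_eq_zero (hcut.continuousOn.mul cψ) (δ := min δ 1 / 2) (b := 2)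
      (K := K) (half_pos (lt_min hδ0 one_pos)) (fun x hx => ?_) (fun x hx => ?_)
    · have h1 := hK x hx
      have hx1 : x ≤ 1 := by linarith [hx.2, min_le_right δ 1]
      rw [smul_eq_mul, mul_inv_cancel_left₀ (Real.sqrt_pos.2 hx.1).ne'] at h1
      simpa only [u, cutoff_of_le_one hx1, one_mul] using h1
    · simp only [u, cutoff_of_two_le hx.le, zero_mul]
  have hw : ∀ ψ φ : ℝ → ℝ,
      (∀ x, 0 < x → HasDerivAt ψ (φ x) x ∧ HasDerivAt φ (V x * ψ x) x) →
      MemLp (w ψ φ) 2 (volume.restrict (Ioi 0)) := by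
    intro ψ φ h
    have cψ : ContinuousOn ψ (Ioi 0) := fun x hx => (h x hx).1.continuousAt.continuousWithinAt
    have cφ : ContinuousOn φ (Ioi 0) := fun x hx => (h x hx).2.continuousAt.continuousWithinAt
    refine memLp_two_of_bound_of_eq_zero (δ := 1) (b := 2) (K := 0) ((hcut''.continuousOn.mul
      cψ).add ((continuousOn_const.mul hcut'.continuousOn).mul cφ)).neg one_pos
      (fun x hx => ?_) (fun x hx => ?_)
    · simp [w, deriv_cutoff_eq_zero (Or.inl hx.2), deriv_deriv_cutoff_eq_zero (Or.inl hx.2)]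
    · simp [w, deriv_cutoff_eq_zero (Or.inr hx), deriv_deriv_cutoff_eq_zero (Or.inr hx)]
  have hweak : ∀ ψ φ : ℝ → ℝ,
      (∀ x, 0 < x → HasDerivAt ψ (φ x) x ∧ HasDerivAt φ (V x * ψ x) x) →
      ∀ f : halfLineTest, ∫ x in Ioi (0 : ℝ), (u ψ x : ℂ) * schrodingerAction V f x
          = ∫ x in Ioi (0 : ℝ), (w ψ φ x : ℂ) * (f : ℝ → ℂ) x := by
    intro ψ φ h f
    have i1 : IntegrableOn (fun x => (u ψ x : ℂ) * schrodingerAction V f x) (Ioi 0) :=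
      MemLp.integrable_mul (f := fun x => (u ψ x : ℂ)) (hu ψ φ h).ofReal
        (schrodingerAction_memLp hV f)
    have i2 : IntegrableOn (fun x => (w ψ φ x : ℂ) * (f : ℝ → ℂ) x) (Ioi 0) :=
      MemLp.integrable_mul (f := fun x => (w ψ φ x : ℂ)) (hw ψ φ h).ofReal (halfLineTest_memLp f)
    rw [← sub_eq_zero, ← integral_sub i1 i2]
    obtain ⟨hfs, K, hK, hK0, hfK⟩ := f.2
    have d1 : ∀ x, HasDerivAt (f : ℝ → ℂ) (deriv (f : ℝ → ℂ) x) x := fun x =>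
      (hfs.differentiable (by simp) x).hasDerivAt
    have d2 : ∀ x, HasDerivAt (deriv (f : ℝ → ℂ)) (deriv (deriv (f : ℝ → ℂ)) x) x := fun x =>
      ((contDiff_deriv hfs).differentiable (by simp) x).hasDerivAt
    let F : ℝ → ℂ := fun x => ((deriv cutoff x * ψ x + cutoff x * φ x : ℝ) : ℂ) * (f : ℝ → ℂ) x
      - ((cutoff x * ψ x : ℝ) : ℂ) * deriv (f : ℝ → ℂ) x
    have hF : ∀ x, 0 < x → HasDerivAt F ((u ψ x : ℂ) * schrodingerAction V f x
        - (w ψ φ x : ℂ) * (f : ℝ → ℂ) x) x := by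
      intro x hx
      obtain ⟨h1, h2⟩ := h x hx
      have e1 := (((hasDerivAt_deriv_cutoff x).mul h1).add
        ((hasDerivAt_cutoff x).mul h2)).ofReal_comp
      have e2 := ((hasDerivAt_cutoff x).mul h1).ofReal_comp
      refine ((e1.mul (d1 x)).sub (e2.mul (d2 x))).congr_deriv ?_
      simp only [u, w, schrodingerAction, LinearMap.coe_mk, AddHom.coe_mk, Pi.add_apply,
        Pi.mul_apply]
      push_cast
      ring
    have hF0 : ∀ x ∉ K, F x = 0 := by
      intro x hx
      simp only [F, hfK x hx, deriv_eq_zero_of_notMem hK.isClosed hfK x hx, mul_zero, sub_zero]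
    have hl : Tendsto F (𝓝[>] 0) (𝓝 0) := by
      refine tendsto_const_nhds.congr' ?_
      have : Kᶜ ∈ 𝓝 (0 : ℝ) := hK.isClosed.isOpen_compl.mem_nhds
        fun h0 => lt_irrefl (0 : ℝ) (hK0 h0)
      filter_upwards [mem_nhdsWithin_of_mem_nhds this] with x hx using (hF0 x hx).symm
    have hr : Tendsto F atTop (𝓝 0) := by
      refine tendsto_const_nhds.congr' ?_
      filter_upwards [atTop_le_cocompact hK.compl_mem_cocompact] with x hx using (hF0 x hx).symm
    rw [integral_Ioi_deriv_eq_neg hF (i1.sub i2) hl hr, neg_zero]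
  refine l2Operator_not_isEssentiallySelfAdjoint _ _ _ _ _ (hu ψ₁ φ₁ H₁) (hw ψ₁ φ₁ H₁)
    (hu ψ₂ φ₂ H₂) (hw ψ₂ φ₂ H₂) (fun f => hweak ψ₁ φ₁ H₁ f)
    (fun f => hweak ψ₂ φ₂ H₂ f) ?_
  have hF : ∀ x, 0 < x → HasDerivAt (fun x => cutoff x ^ 2)
      (w ψ₁ φ₁ x * u ψ₂ x - u ψ₁ x * w ψ₂ φ₂ x) x := by
    intro x hx
    refine ((hasDerivAt_cutoff x).pow 2).congr_deriv ?_
    simp only [u, w]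
    linear_combination (-2 * cutoff x * deriv cutoff x) * hW x hx
  have hint : IntegrableOn (fun x => w ψ₁ φ₁ x * u ψ₂ x - u ψ₁ x * w ψ₂ φ₂ x) (Ioi 0) :=
    ((hw ψ₁ φ₁ H₁).integrable_mul (hu ψ₂ φ₂ H₂)).sub ((hu ψ₁ φ₁ H₁).integrable_mul (hw ψ₂ φ₂ H₂))
  rw [integral_Ioi_deriv_eq_neg (l := 1) hF hint]
  · norm_num
  · refine tendsto_const_nhds.congr' ?_
    filter_upwards [mem_nhdsWithin_of_mem_nhds (Iio_mem_nhds one_pos)] with x hx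
    rw [cutoff_of_le_one (le_of_lt hx), one_pow]
  · refine tendsto_const_nhds.congr' ?_
    filter_upwards [Ici_mem_atTop 2] with x hx
    rw [cutoff_of_two_le hx]
    simp

/-! ### The potential of the radial equation -/

theorem radialCoeff_nonneg (σ C M k : ℝ) (m : ℤ) {r : ℝ} (hr : 0 < r) :
    0 ≤ radialCoeff σ C M k m r := by
  have h (e : ℝ) : 0 < r ^ e := Real.rpow_pos_of_pos hr e
  exact add_nonneg (add_nonneg (by positivity) (mul_nonneg (sq_nonneg _) (h _).le))
    (mul_nonneg (by positivity) (h _).le)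

theorem mass_exponent_pos (σ : ℝ) : 0 < 4 * σ + 2 * alpha σ := by
  rw [alpha]
  nlinarith [sq_nonneg (4 * σ - 1)]

theorem radialCoeff_tendsto_zero {σ : ℝ} (hσ0 : σ ≠ 0) (C M k : ℝ) (m : ℤ) :
    Tendsto (radialCoeff σ C M k m) (𝓝[>] 0) (𝓝 0) := by
  have h {e : ℝ} (he : 0 < e) : Tendsto (fun r : ℝ => r ^ e) (𝓝[>] 0) (𝓝 0) := by
    have := (Real.continuousAt_rpow_const 0 e (Or.inr he.le)).tendsto
    rw [Real.zero_rpow he.ne'] at this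
    exact this.mono_left nhdsWithin_le_nhds
  have h1 : Tendsto (fun r : ℝ => r ^ 2) (𝓝[>] 0) (𝓝 0) := by
    have := (continuous_pow 2).tendsto (0 : ℝ)
    rw [zero_pow two_ne_zero] at this
    exact this.mono_left nhdsWithin_le_nhds
  have := ((h1.const_mul (k ^ 2)).add ((h (mass_exponent_pos σ)).const_mul (M ^ 2))).add
    ((h (by positivity : 0 < 8 * σ ^ 2)).const_mul ((m : ℝ) ^ 2 * C ^ 2))
  simp only [mul_zero, add_zero] at this
  exact this

theorem rOfX_tendsto_zero {σ C : ℝ} (hσ : σ ≠ 1 / 2) (hC : 0 < C) :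
    Tendsto (rOfX σ C) (𝓝[>] 0) (𝓝[>] 0) := by
  have hα := alpha_pos hσ
  refine tendsto_nhdsWithin_iff.2 ⟨?_, ?_⟩
  · have h1 : Continuous (rOfX σ C) := by
      refine Continuous.rpow_const (by fun_prop) fun x => Or.inr (by positivity)
    have h2 := h1.tendsto 0
    have h3 : rOfX σ C 0 = 0 := by
      rw [rOfX, zero_pow two_ne_zero, mul_zero, Real.zero_rpow (by positivity)]
    rw [h3] at h2
    exact h2.mono_left nhdsWithin_le_nhds
  · filter_upwards [self_mem_nhdsWithin] with x hx using rOfX_pos hσ hC hx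

theorem sq_mul_potential_tendsto {σ C : ℝ} (hσ0 : σ ≠ 0) (hσ : σ ≠ 1 / 2) (hC : 0 < C)
    (M k : ℝ) (m : ℤ) :
    Tendsto (fun x => x ^ 2 * potential σ C M k m x + 1 / 4) (𝓝[>] 0) (𝓝 0) := by
  have h := ((radialCoeff_tendsto_zero hσ0 C M k m).comp (rOfX_tendsto_zero hσ hC)).const_mul
    ((alpha σ)⁻¹ ^ 2)
  rw [mul_zero] at h
  refine h.congr' ?_
  filter_upwards [self_mem_nhdsWithin] with x hx
  rw [sq_mul_potential hσ hC hx]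
  rfl

theorem potential_isEquivalent {σ C : ℝ} (hσ0 : σ ≠ 0) (hσ : σ ≠ 1 / 2) (hC : 0 < C)
    (M k : ℝ) (m : ℤ) : Asymptotics.IsEquivalent (𝓝[>] (0 : ℝ)) (potential σ C M k m)
      (fun x => -1 / (4 * x ^ 2)) := by
  refine Asymptotics.isEquivalent_of_tendsto_one ?_
  have h := ((sq_mul_potential_tendsto hσ0 hσ hC M k m).const_mul (-4)).const_add 1
  rw [mul_zero, add_zero] at h
  refine h.congr' ?_
  filter_upwards [self_mem_nhdsWithin] with x hx
  have : x ≠ 0 := (mem_Ioi.1 hx).ne'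
  rw [Pi.div_apply]
  field_simp
  ring

theorem potential_limitPointAtInfinity {σ C : ℝ} (hσ : σ ≠ 1 / 2) (hC : 0 < C)
    (M k : ℝ) (m : ℤ) : LimitPointAtInfinity (potential σ C M k m) := by
  refine limitPointAtInfinity_of_bddBelow (potential_continuousOn hσ hC M k m) (κ := 1 / 4)
    fun x hx => ?_
  have hx0 : 0 < x := one_pos.trans_le hx
  have h1 := sq_mul_potential (M := M) (k := k) (m := m) hσ hC hx0
  have h2 := radialCoeff_nonneg σ C M k m (rOfX_pos hσ hC hx0)
  have h3 : 0 ≤ x ^ 2 * potential σ C M k m x + 1 / 4 := by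
    rw [h1]
    positivity
  by_contra hlt
  rw [not_le] at hlt
  nlinarith [mul_nonneg (sub_nonneg.2 hx) hx0.le]

/-! ### The change of variables in the norm -/

theorem lintegral_eq_lintegral_toSchrodinger {σ C : ℝ} (hσ : σ ≠ 1 / 2) (hC : 0 < C) (R : ℝ → ℂ) :
    ∫⁻ r in Ioi (0 : ℝ), ENNReal.ofReal (sqrtDet σ C r / lapse σ r) * ‖R r‖ₑ ^ 2 =
      ∫⁻ x in Ioi (0 : ℝ), ‖toSchrodinger σ C R x‖ₑ ^ 2 := by
  have hα := alpha_pos hσ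
  set κ : ℝ := (alpha σ * C) ^ (1 / (2 * alpha σ)) with hκ
  have hκ0 : 0 < κ := by positivity
  have hd : ∀ x ∈ Ioi (0 : ℝ),
      HasDerivWithinAt (rOfX σ C) (rOfX σ C x / (alpha σ * x)) (Ioi 0) x := by
    intro x hx
    have hx0 : 0 < x := hx
    have h1 := ((Real.hasDerivAt_rpow_const (p := (alpha σ)⁻¹) (Or.inl hx0.ne')).const_mul
      κ).hasDerivWithinAt (s := Ioi 0)
    refine (h1.congr (fun y hy => rOfX_eq hσ hC hy) (rOfX_eq hσ hC hx)).congr_deriv ?_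
    rw [rOfX_eq hσ hC hx0, Real.rpow_sub_one hx0.ne', ← hκ]
    field_simp
  have hmono : StrictMonoOn (rOfX σ C) (Ioi 0) := by
    intro x hx y hy hxy
    rw [rOfX_eq hσ hC hx, rOfX_eq hσ hC hy]
    exact mul_lt_mul_of_pos_left (Real.rpow_lt_rpow (le_of_lt hx) hxy (by positivity)) hκ0
  have himage : rOfX σ C '' Ioi 0 = Ioi 0 := by
    refine Subset.antisymm ?_ fun r hr => ?_
    · rintro _ ⟨x, hx, rfl⟩
      exact rOfX_pos hσ hC hx
    · have hr0 : 0 < r := hr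
      have hx : 0 < (r / κ) ^ alpha σ := by positivity
      refine ⟨_, hx, ?_⟩
      rw [rOfX_eq hσ hC hx, ← Real.rpow_mul (by positivity), mul_inv_cancel₀ hα.ne', Real.rpow_one,
        ← hκ]
      field_simp
  have h := lintegral_image_eq_lintegral_abs_deriv_mul measurableSet_Ioi hd hmono.injOn
    fun r => ENNReal.ofReal (sqrtDet σ C r / lapse σ r) * ‖R r‖ₑ ^ 2
  rw [himage] at h
  rw [h]
  refine setLIntegral_congr_fun measurableSet_Ioi fun x hx => ?_
  have hx0 : 0 < x := hx
  have hρ := rOfX_pos hσ hC hx0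
  have hweight : rOfX σ C x / (alpha σ * x) * (sqrtDet σ C (rOfX σ C x) / lapse σ (rOfX σ C x))
      = x := by
    rw [sqrtDet_div_lapse σ hC hρ, Real.rpow_sub_one hρ.ne', rOfX_rpow hσ hC hx0,
      div_self (by positivity), Real.rpow_one]
    field_simp
  have hnorm : ‖toSchrodinger σ C R x‖ₑ ^ 2 = ENNReal.ofReal x * ‖R (rOfX σ C x)‖ₑ ^ 2 := by
    rw [toSchrodinger, enorm_mul, mul_pow]
    congr 1
    rw [← ofReal_norm, ← ENNReal.ofReal_pow (norm_nonneg _), Complex.norm_real,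
      Real.norm_of_nonneg (Real.sqrt_nonneg _), Real.sq_sqrt hx0.le]
  rw [hnorm, ← mul_assoc, ← ENNReal.ofReal_mul (abs_nonneg _),
    abs_of_pos (div_pos hρ (mul_pos hα hx0)), hweight]

/-! ### Green's identity on the static slice -/

theorem integral_prod_eq_zero_of_left {X Y : Type*} [MeasurableSpace X] [MeasurableSpace Y]
    {μ : Measure X} {ν : Measure Y} [SFinite μ] [SFinite ν] {f : X × Y → ℂ}
    (h : ∀ y, ∫ x, f (x, y) ∂μ = 0) : ∫ p, f p ∂(μ.prod ν) = 0 := by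
  by_cases hf : Integrable f (μ.prod ν)
  · rw [integral_prod_symm f hf]
    simp [h]
  · exact integral_undef hf

theorem integral_prod_eq_zero_of_right {X Y : Type*} [MeasurableSpace X] [MeasurableSpace Y]
    {μ : Measure X} {ν : Measure Y} [SFinite μ] [SFinite ν] {f : X × Y → ℂ}
    (h : ∀ x, ∫ y, f (x, y) ∂ν = 0) : ∫ p, f p ∂(μ.prod ν) = 0 := by
  by_cases hf : Integrable f (μ.prod ν)
  · rw [integral_prod f hf]
    simp [h]
  · exact integral_undef hf

/-- Lebesgue measure on the coordinate domain `0 < r`, `z ∈ ℝ`, `0 < θ ≤ 2π` of the slice. -/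
def coordMeasure : Measure (ℝ × ℝ × ℝ) :=
  (volume.restrict (Ioi (0 : ℝ))).prod
    ((volume : Measure ℝ).prod (volume.restrict (Ioc (0 : ℝ) (2 * Real.pi))))

theorem restrict_eq_coordMeasure : volume.restrict
    (Ioi (0 : ℝ) ×ˢ ((univ : Set ℝ) ×ˢ Ioc (0 : ℝ) (2 * Real.pi))) = coordMeasure := by
  rw [coordMeasure, Measure.volume_eq_prod, ← Measure.prod_restrict, Measure.volume_eq_prod,
    ← Measure.prod_restrict, Measure.restrict_univ]

theorem ae_coordMeasure_pos : ∀ᵐ p ∂coordMeasure, 0 < p.1 := by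
  rw [← restrict_eq_coordMeasure]
  filter_upwards [ae_restrict_mem
    (measurableSet_Ioi.prod (MeasurableSet.univ.prod measurableSet_Ioc))] with p hp using hp.1

theorem sliceTest_integrable {f : ℝ × ℝ × ℝ → ℂ} (hf : f ∈ sliceTest) :
    Integrable f coordMeasure := by
  obtain ⟨hs, -, K, hK, hK0, hfK⟩ := hf
  let S : Set (ℝ × ℝ × ℝ) :=
    (fun q : (ℝ × ℝ) × ℝ => (q.1.1, q.1.2, q.2)) '' (K ×ˢ Icc 0 (2 * Real.pi))
  have hS : IsCompact S := (hK.prod isCompact_Icc).image (by fun_prop)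
  rw [← restrict_eq_coordMeasure]
  refine (hs.continuous.continuousOn.integrableOn_compact hS).of_forall_sdiff_eq_zero
    (measurableSet_Ioi.prod (MeasurableSet.univ.prod measurableSet_Ioc)) ?_
  rintro ⟨r, z, θ⟩ ⟨hp, hpS⟩
  refine hfK r z θ fun hK' => hpS ⟨((r, z), θ), ⟨hK', Ioc_subset_Icc_self hp.2.2⟩, rfl⟩

theorem integral_dR_eq_zero {f : ℝ × ℝ × ℝ → ℂ} (hf : f ∈ sliceTest) :
    ∫ p, dR f p ∂coordMeasure = 0 := by
  obtain ⟨hs, -, K, hK, hK0, hfK⟩ := hf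
  refine integral_prod_eq_zero_of_left fun y => ?_
  have h1 : ContDiff ℝ 1 fun s => f (s, y.1, y.2) :=
    (hs.of_le (by simp)).comp (contDiff_id.prodMk contDiff_const)
  have h2 : HasCompactSupport fun s => f (s, y.1, y.2) :=
    HasCompactSupport.intro (hK.image continuous_fst) fun s hsK =>
      hfK s y.1 y.2 fun h => hsK ⟨_, h, rfl⟩
  have h3 := h2.integral_Ioi_deriv_eq h1 0
  rw [hfK 0 y.1 y.2 fun h => lt_irrefl (0 : ℝ) (hK0 _ h), neg_zero] at h3
  exact h3

theorem integral_dZ_eq_zero {f : ℝ × ℝ × ℝ → ℂ} (hf : f ∈ sliceTest) :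
    ∫ p, dZ f p ∂coordMeasure = 0 := by
  obtain ⟨hs, -, K, hK, hK0, hfK⟩ := hf
  refine integral_prod_eq_zero_of_right fun r => integral_prod_eq_zero_of_left fun θ => ?_
  have h1 : ContDiff ℝ 1 fun s => f (r, s, θ) :=
    (hs.of_le (by simp)).comp (contDiff_const.prodMk (contDiff_id.prodMk contDiff_const))
  have h2 : HasCompactSupport fun s => f (r, s, θ) :=
    HasCompactSupport.intro (hK.image continuous_snd) fun s hsK =>
      hfK r s θ fun h => hsK ⟨_, h, rfl⟩
  exact integral_eq_zero_of_hasDerivAt_of_integrable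
    (fun s => (h1.differentiable one_ne_zero s).hasDerivAt)
    ((h1.continuous_deriv le_rfl).integrable_of_hasCompactSupport h2.deriv)
    (h1.continuous.integrable_of_hasCompactSupport h2)

theorem integral_dT_eq_zero {f : ℝ × ℝ × ℝ → ℂ} (hf : f ∈ sliceTest) :
    ∫ p, dT f p ∂coordMeasure = 0 := by
  obtain ⟨hs, pf, -⟩ := hf
  refine integral_prod_eq_zero_of_right fun r => integral_prod_eq_zero_of_right fun z => ?_
  have h1 : ContDiff ℝ 1 fun s => f (r, z, s) :=
    (hs.of_le (by simp)).comp (contDiff_const.prodMk (contDiff_const.prodMk contDiff_id))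
  have h2 := intervalIntegral.integral_deriv_eq_sub' (a := 0) (b := 2 * Real.pi) _ rfl
    (fun s _ => h1.differentiable one_ne_zero s) (h1.continuous_deriv le_rfl).continuousOn
  rw [intervalIntegral.integral_of_le (by positivity)] at h2
  have h3 := pf r z 0
  rw [zero_add] at h3
  rw [h3, sub_self] at h2
  exact h2

/-- Functions of `(r, z, θ)` that are smooth for `r > 0` and `2π`-periodic in `θ`. -/
def IsRegular (U : ℝ × ℝ × ℝ → ℂ) : Prop :=
  ContDiffOn ℝ ∞ U {p | 0 < p.1} ∧ ∀ r z θ, U (r, z, θ + 2 * Real.pi) = U (r, z, θ)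

theorem isOpen_pos_fst : IsOpen {p : ℝ × ℝ × ℝ | 0 < p.1} :=
  isOpen_lt continuous_const continuous_fst

section Regular

variable {U W f : ℝ × ℝ × ℝ → ℂ} {p : ℝ × ℝ × ℝ}

theorem IsRegular.differentiableAt (hU : IsRegular U) (hp : 0 < p.1) : DifferentiableAt ℝ U p :=
  (hU.1.contDiffAt (isOpen_pos_fst.mem_nhds hp)).differentiableAt (by simp)

theorem hasDerivAt_coord_r (hU : DifferentiableAt ℝ U p) :
    HasDerivAt (fun s => U (s, p.2.1, p.2.2)) (fderiv ℝ U p (1, 0, 0)) p.1 :=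
  hU.hasFDerivAt.comp_hasDerivAt p.1
    ((hasDerivAt_id _).prodMk ((hasDerivAt_const _ _).prodMk (hasDerivAt_const _ _)))

theorem hasDerivAt_coord_z (hU : DifferentiableAt ℝ U p) :
    HasDerivAt (fun s => U (p.1, s, p.2.2)) (fderiv ℝ U p (0, 1, 0)) p.2.1 :=
  hU.hasFDerivAt.comp_hasDerivAt p.2.1
    ((hasDerivAt_const _ _).prodMk ((hasDerivAt_id _).prodMk (hasDerivAt_const _ _)))

theorem hasDerivAt_coord_θ (hU : DifferentiableAt ℝ U p) :
    HasDerivAt (fun s => U (p.1, p.2.1, s)) (fderiv ℝ U p (0, 0, 1)) p.2.2 :=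
  hU.hasFDerivAt.comp_hasDerivAt p.2.2
    ((hasDerivAt_const _ _).prodMk ((hasDerivAt_const _ _).prodMk (hasDerivAt_id _)))

theorem IsRegular.fderiv_contDiffOn (hU : IsRegular U) (v : ℝ × ℝ × ℝ) :
    ContDiffOn ℝ ∞ (fun p => fderiv ℝ U p v) {p | 0 < p.1} :=
  (hU.1.fderiv_of_isOpen isOpen_pos_fst (by simp)).clm_apply contDiffOn_const

theorem IsRegular.dR (hU : IsRegular U) : IsRegular (dR U) :=
  ⟨(hU.fderiv_contDiffOn (1, 0, 0)).congr fun _ hp =>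
      (hasDerivAt_coord_r (hU.differentiableAt hp)).deriv,
    fun r z θ => by simp only [LeviCivita.dR, hU.2]⟩

theorem IsRegular.dZ (hU : IsRegular U) : IsRegular (dZ U) :=
  ⟨(hU.fderiv_contDiffOn (0, 1, 0)).congr fun _ hp =>
      (hasDerivAt_coord_z (hU.differentiableAt hp)).deriv,
    fun r z θ => by simp only [LeviCivita.dZ, hU.2]⟩

theorem IsRegular.dT (hU : IsRegular U) : IsRegular (dT U) :=
  ⟨(hU.fderiv_contDiffOn (0, 0, 1)).congr fun _ hp =>
      (hasDerivAt_coord_θ (hU.differentiableAt hp)).deriv,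
    fun r z θ => by
      have h := deriv_comp_add_const (fun s => U (r, z, s)) (2 * Real.pi) θ
      simp only [hU.2] at h
      exact h.symm⟩

theorem IsRegular.add (hU : IsRegular U) (hW : IsRegular W) : IsRegular (U + W) :=
  ⟨hU.1.add hW.1, fun r z θ => by simp [hU.2, hW.2]⟩

theorem IsRegular.neg (hU : IsRegular U) : IsRegular (-U) :=
  ⟨hU.1.neg, fun r z θ => by simp [hU.2]⟩

theorem IsRegular.mulR {c : ℝ → ℝ} (hc : ContDiffOn ℝ ∞ c (Ioi 0)) (hU : IsRegular U) :
    IsRegular (mulR c U) :=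
  ⟨(Complex.ofRealCLM.contDiff.comp_contDiffOn
      (hc.comp contDiff_fst.contDiffOn fun _ hp => hp)).mul hU.1,
    fun r z θ => by simp [LeviCivita.mulR, hU.2]⟩

theorem IsRegular.kleinGordon {σ C : ℝ} (hC : 0 < C) (M : ℝ) (hU : IsRegular U) :
    IsRegular (kleinGordon σ C M U) :=
  (IsRegular.mulR (coeff3_smooth σ hC) (((hU.dR.mulR (coeff1_smooth σ hC)).dR.add
    (hU.dZ.mulR (coeff1_smooth σ hC)).dZ).add (hU.dT.mulR (coeff2_smooth σ hC)).dT)).neg.add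
    (hU.mulR (coeff4_smooth σ M))

theorem IsRegular.mul_mem (hU : IsRegular U) (hf : f ∈ sliceTest) : U * f ∈ sliceTest := by
  obtain ⟨hs, pf, K, hK, hK0, hfK⟩ := hf
  refine ⟨?_, fun r z θ => by simp [pf, hU.2], K, hK, hK0, fun r z θ hx => by simp [hfK r z θ hx]⟩
  rw [contDiff_iff_contDiffAt]
  intro p
  by_cases hp : (p.1, p.2.1) ∈ K
  · exact (hU.1.contDiffAt (isOpen_pos_fst.mem_nhds (hK0 _ hp))).mul hs.contDiffAt
  · have hV : IsOpen {p : ℝ × ℝ × ℝ | (p.1, p.2.1) ∉ K} :=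
      hK.isClosed.isOpen_compl.preimage (by fun_prop : Continuous fun p : ℝ × ℝ × ℝ => (p.1, p.2.1))
    have : U * f =ᶠ[𝓝 p] fun _ => 0 := by
      filter_upwards [hV.mem_nhds hp] with q hq
      have := hfK q.1 q.2.1 q.2.2 hq
      simp only [Prod.mk.eta] at this
      simp [this]
    exact contDiffAt_const.congr_of_eventuallyEq this

theorem dR_mul (hU : DifferentiableAt ℝ U p) (hW : DifferentiableAt ℝ W p) :
    dR (U * W) p = dR U p * W p + U p * dR W p := by
  have h1 := hasDerivAt_coord_r hU
  have h2 := hasDerivAt_coord_r hW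
  rw [dR, dR, dR, h1.deriv, h2.deriv]
  exact (h1.mul h2).deriv

theorem dZ_mul (hU : DifferentiableAt ℝ U p) (hW : DifferentiableAt ℝ W p) :
    dZ (U * W) p = dZ U p * W p + U p * dZ W p := by
  have h1 := hasDerivAt_coord_z hU
  have h2 := hasDerivAt_coord_z hW
  rw [dZ, dZ, dZ, h1.deriv, h2.deriv]
  exact (h1.mul h2).deriv

theorem dT_mul (hU : DifferentiableAt ℝ U p) (hW : DifferentiableAt ℝ W p) :
    dT (U * W) p = dT U p * W p + U p * dT W p := by
  have h1 := hasDerivAt_coord_θ hU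
  have h2 := hasDerivAt_coord_θ hW
  rw [dT, dT, dT, h1.deriv, h2.deriv]
  exact (h1.mul h2).deriv

theorem measurable_density (σ C : ℝ) :
    Measurable fun p : ℝ × ℝ × ℝ => sqrtDet σ C p.1 / lapse σ p.1 := by
  simp only [sqrtDet, lapse, hrr, hθθ]
  fun_prop

theorem integral_sliceMeasure {E : Type*} [NormedAddCommGroup E] [NormedSpace ℝ E] (σ C : ℝ)
    (g : ℝ × ℝ × ℝ → E) : ∫ p, g p ∂(sliceMeasure σ C)
      = ∫ p, (sqrtDet σ C p.1 / lapse σ p.1) • g p ∂coordMeasure := by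
  rw [sliceMeasure, restrict_eq_coordMeasure, integral_withDensity_eq_integral_toReal_smul
    (measurable_density σ C).ennreal_ofReal (Eventually.of_forall fun _ => ENNReal.ofReal_lt_top)]
  refine integral_congr_ae (Eventually.of_forall fun p => ?_)
  have : 0 ≤ sqrtDet σ C p.1 / lapse σ p.1 := div_nonneg (Real.sqrt_nonneg _) (Real.sqrt_nonneg _)
  simp only [ENNReal.toReal_ofReal this]

/-- Green's identity: the Klein–Gordon operator is formally symmetric between regular functions and
test functions. -/
theorem integral_mul_kleinGordon {σ C : ℝ} (hC : 0 < C) (M : ℝ) (hU : IsRegular U)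
    (hf : f ∈ sliceTest) : ∫ p, U p * kleinGordon σ C M f p ∂(sliceMeasure σ C)
      = ∫ p, kleinGordon σ C M U p * f p ∂(sliceMeasure σ C) := by
  have hdens : ContDiffOn ℝ ∞ (fun r => sqrtDet σ C r / lapse σ r) (Ioi 0) :=
    (sqrtDet_smooth σ hC).div (lapse_smooth σ) fun r hr => (lapse_pos σ hr).ne'
  have c1 := coeff1_smooth σ hC
  have c2 := coeff2_smooth σ hC
  rw [integral_sliceMeasure, integral_sliceMeasure, ← sub_eq_zero]
  have i1 : Integrable (fun p => (sqrtDet σ C p.1 / lapse σ p.1) • (U p * kleinGordon σ C M f p))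
      coordMeasure :=
    sliceTest_integrable (mulR_mem hdens (hU.mul_mem (kleinGordon_mem σ hC M hf)))
  have i2 : Integrable (fun p => (sqrtDet σ C p.1 / lapse σ p.1) • (kleinGordon σ C M U p * f p))
      coordMeasure :=
    sliceTest_integrable (mulR_mem hdens ((hU.kleinGordon hC M).mul_mem hf))
  rw [← integral_sub i1 i2]
  -- the fluxes of `f` and of `U`
  obtain ⟨fR, hfR⟩ : ∃ g, g = mulR (fun r => sqrtDet σ C r * (hrr σ r)⁻¹ * lapse σ r) (dR f) :=
    ⟨_, rfl⟩
  obtain ⟨fZ, hfZ⟩ : ∃ g, g = mulR (fun r => sqrtDet σ C r * (hrr σ r)⁻¹ * lapse σ r) (dZ f) :=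
    ⟨_, rfl⟩
  obtain ⟨fT, hfT⟩ : ∃ g, g = mulR (fun r => sqrtDet σ C r * (hθθ σ C r)⁻¹ * lapse σ r) (dT f) :=
    ⟨_, rfl⟩
  obtain ⟨UR, hUR⟩ : ∃ g, g = mulR (fun r => sqrtDet σ C r * (hrr σ r)⁻¹ * lapse σ r) (dR U) :=
    ⟨_, rfl⟩
  obtain ⟨UZ, hUZ⟩ : ∃ g, g = mulR (fun r => sqrtDet σ C r * (hrr σ r)⁻¹ * lapse σ r) (dZ U) :=
    ⟨_, rfl⟩
  obtain ⟨UT, hUT⟩ : ∃ g, g = mulR (fun r => sqrtDet σ C r * (hθθ σ C r)⁻¹ * lapse σ r) (dT U) :=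
    ⟨_, rfl⟩
  have mR : fR ∈ sliceTest := hfR ▸ mulR_mem c1 (dR_mem hf)
  have mZ : fZ ∈ sliceTest := hfZ ▸ mulR_mem c1 (dZ_mem hf)
  have mT : fT ∈ sliceTest := hfT ▸ mulR_mem c2 (dT_mem hf)
  have rR : IsRegular UR := hUR ▸ hU.dR.mulR c1
  have rZ : IsRegular UZ := hUZ ▸ hU.dZ.mulR c1
  have rT : IsRegular UT := hUT ▸ hU.dT.mulR c2
  have tR : UR * f - U * fR ∈ sliceTest := sub_mem (rR.mul_mem hf) (hU.mul_mem mR)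
  have tZ : UZ * f - U * fZ ∈ sliceTest := sub_mem (rZ.mul_mem hf) (hU.mul_mem mZ)
  have tT : UT * f - U * fT ∈ sliceTest := sub_mem (rT.mul_mem hf) (hU.mul_mem mT)
  have hpt : (fun p => (sqrtDet σ C p.1 / lapse σ p.1) • (U p * kleinGordon σ C M f p)
      - (sqrtDet σ C p.1 / lapse σ p.1) • (kleinGordon σ C M U p * f p)) =ᵐ[coordMeasure]
      dR (UR * f - U * fR) + dZ (UZ * f - U * fZ) + dT (UT * f - U * fT) := by
    filter_upwards [ae_coordMeasure_pos] with p hp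
    have dU := hU.differentiableAt hp
    have df := sliceTest_differentiable hf p
    have sub_R : ∀ F G : ℝ × ℝ × ℝ → ℂ, DifferentiableAt ℝ F p → DifferentiableAt ℝ G p →
        dR (F - G) p = dR F p - dR G p := fun F G hF hG =>
      ((hasDerivAt_coord_r hF).sub (hasDerivAt_coord_r hG)).deriv.trans
        (congrArg₂ _ (hasDerivAt_coord_r hF).deriv.symm (hasDerivAt_coord_r hG).deriv.symm)
    have sub_Z : ∀ F G : ℝ × ℝ × ℝ → ℂ, DifferentiableAt ℝ F p → DifferentiableAt ℝ G p →
        dZ (F - G) p = dZ F p - dZ G p := fun F G hF hG =>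
      ((hasDerivAt_coord_z hF).sub (hasDerivAt_coord_z hG)).deriv.trans
        (congrArg₂ _ (hasDerivAt_coord_z hF).deriv.symm (hasDerivAt_coord_z hG).deriv.symm)
    have sub_T : ∀ F G : ℝ × ℝ × ℝ → ℂ, DifferentiableAt ℝ F p → DifferentiableAt ℝ G p →
        dT (F - G) p = dT F p - dT G p := fun F G hF hG =>
      ((hasDerivAt_coord_θ hF).sub (hasDerivAt_coord_θ hG)).deriv.trans
        (congrArg₂ _ (hasDerivAt_coord_θ hF).deriv.symm (hasDerivAt_coord_θ hG).deriv.symm)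
    rw [Pi.add_apply, Pi.add_apply, sub_R _ _ ((rR.differentiableAt hp).mul df)
      (dU.mul (sliceTest_differentiable mR p)),
      sub_Z _ _ ((rZ.differentiableAt hp).mul df) (dU.mul (sliceTest_differentiable mZ p)),
      sub_T _ _ ((rT.differentiableAt hp).mul df) (dU.mul (sliceTest_differentiable mT p)),
      dR_mul (rR.differentiableAt hp) df, dR_mul dU (sliceTest_differentiable mR p),
      dZ_mul (rZ.differentiableAt hp) df, dZ_mul dU (sliceTest_differentiable mZ p),
      dT_mul (rT.differentiableAt hp) df, dT_mul dU (sliceTest_differentiable mT p)]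
    have hl : (lapse σ p.1 : ℂ) ≠ 0 := by exact_mod_cast (lapse_pos σ hp).ne'
    have hd : (sqrtDet σ C p.1 : ℂ) ≠ 0 := by exact_mod_cast (sqrtDet_pos σ hC hp).ne'
    have hw : ((sqrtDet σ C p.1 / lapse σ p.1 : ℝ) : ℂ) * ((lapse σ p.1 / sqrtDet σ C p.1 : ℝ) : ℂ)
        = 1 := by
      push_cast
      field_simp
    simp only [kleinGordon, weightedLaplacian, Complex.real_smul, ← hfR, ← hfZ, ← hfT, ← hUR,
      ← hUZ, ← hUT]
    have eR : UR p * dR f p = dR U p * fR p := by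
      rw [hUR, hfR, mulR, mulR]
      ring
    have eZ : UZ p * dZ f p = dZ U p * fZ p := by
      rw [hUZ, hfZ, mulR, mulR]
      ring
    have eT : UT p * dT f p = dT U p * fT p := by
      rw [hUT, hfT, mulR, mulR]
      ring
    simp only [Pi.add_apply, Pi.neg_apply, mulR]
    linear_combination ((dR UR p + dZ UZ p + dT UT p) * f p
      - U p * (dR fR p + dZ fZ p + dT fT p)) * hw - eR - eZ - eT
  rw [integral_congr_ae hpt, integral_add' ((sliceTest_integrable (dR_mem tR)).add
    (sliceTest_integrable (dZ_mem tZ))) (sliceTest_integrable (dT_mem tT)),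
    integral_add' (sliceTest_integrable (dR_mem tR)) (sliceTest_integrable (dZ_mem tZ)),
    integral_dR_eq_zero tR, integral_dZ_eq_zero tZ, integral_dT_eq_zero tT, add_zero, add_zero]

end Regular

/-! ### Finite sums of powers and logarithms with vector coefficients -/

section LogSum

variable {G : Type*} [AddCommGroup G] [Module ℝ G]

/-- Formal finite sums `∑ r^t (a_t + b_t log r)` with coefficients in `G`; the exponent `t` is
mapped to the pair `(a_t, b_t)`. -/
abbrev LogSum (G : Type*) [AddCommGroup G] [Module ℝ G] : Type _ := ℝ →₀ G × G

/-- The sums all of whose exponents are at least `s`. -/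
def LogSum.order (G : Type*) [AddCommGroup G] [Module ℝ G] (s : ℝ) : Submodule ℝ (LogSum G) :=
  Finsupp.supported (G × G) ℝ (Ici s)

theorem LogSum.single_mem {s t : ℝ} (h : s ≤ t) (v : G × G) :
    Finsupp.single t v ∈ LogSum.order G s :=
  Finsupp.single_mem_supported ℝ v h

theorem LogSum.order_anti {s s' : ℝ} (h : s' ≤ s) : LogSum.order G s ≤ LogSum.order G s' :=
  Finsupp.supported_mono (Ici_subset_Ici.2 h)

theorem LogSum.induction {s : ℝ} {motive : LogSum G → Prop} (h0 : motive 0)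
    (hadd : ∀ p q, motive p → motive q → motive (p + q))
    (hsingle : ∀ t, s ≤ t → ∀ a b : G, motive (Finsupp.single t (a, b))) {p : LogSum G}
    (hp : p ∈ LogSum.order G s) : motive p := by
  rw [← Finsupp.sum_single p]
  exact Finset.sum_induction _ motive hadd h0 fun t ht =>
    hsingle t ((Finsupp.mem_supported ℝ p).1 hp ht) _ _

theorem LogSum.exists_mem_order (p : LogSum G) : ∃ s, p ∈ LogSum.order G s := by
  rcases p.support.eq_empty_or_nonempty with h | h
  · exact ⟨0, by rw [Finsupp.support_eq_empty.1 h]; exact zero_mem _⟩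
  · exact ⟨p.support.min' h, (Finsupp.mem_supported ℝ p).2 fun t ht => p.support.min'_le t ht⟩

/-- The value of a formal sum at `r`. -/
def LogSum.eval (r : ℝ) : LogSum G →ₗ[ℝ] G :=
  Finsupp.lsum ℝ fun t => (r ^ t) • LinearMap.fst ℝ G G + (r ^ t * Real.log r) • LinearMap.snd ℝ G G

theorem LogSum.eval_single (r t : ℝ) (a b : G) : LogSum.eval r (Finsupp.single t (a, b))
    = (r ^ t) • a + (r ^ t * Real.log r) • b := by
  simp [LogSum.eval]

/-- The formal operator `r d/dr`. -/
def LogSum.euler : LogSum G →ₗ[ℝ] LogSum G :=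
  Finsupp.lsum ℝ fun t => (Finsupp.lsingle t).comp
    ((t • LinearMap.fst ℝ G G + LinearMap.snd ℝ G G).prod (t • LinearMap.snd ℝ G G))

theorem LogSum.euler_single (t : ℝ) (a b : G) : LogSum.euler (Finsupp.single t (a, b))
    = Finsupp.single t (t • a + b, t • b) := by
  simp [LogSum.euler]

/-- The inverse of `r d/dr` on sums with nonzero exponents. -/
def LogSum.eulerInv : LogSum G →ₗ[ℝ] LogSum G :=
  Finsupp.lsum ℝ fun t => (Finsupp.lsingle t).comp
    ((t⁻¹ • LinearMap.fst ℝ G G - t⁻¹ ^ 2 • LinearMap.snd ℝ G G).prod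
      (t⁻¹ • LinearMap.snd ℝ G G))

theorem LogSum.eulerInv_single (t : ℝ) (a b : G) : LogSum.eulerInv (Finsupp.single t (a, b))
    = Finsupp.single t (t⁻¹ • a - t⁻¹ ^ 2 • b, t⁻¹ • b) := by
  simp [LogSum.eulerInv]

theorem LogSum.euler_mem {s : ℝ} {p : LogSum G} (hp : p ∈ LogSum.order G s) :
    LogSum.euler p ∈ LogSum.order G s := by
  refine LogSum.induction (motive := fun p => LogSum.euler p ∈ LogSum.order G s) (by simp)
    (fun p q h1 h2 => ?_) (fun t ht a b => ?_) hp
  · rw [map_add]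
    exact add_mem h1 h2
  · rw [LogSum.euler_single]
    exact LogSum.single_mem ht _

theorem LogSum.eulerInv_mem {s : ℝ} {p : LogSum G} (hp : p ∈ LogSum.order G s) :
    LogSum.eulerInv p ∈ LogSum.order G s := by
  refine LogSum.induction (motive := fun p => LogSum.eulerInv p ∈ LogSum.order G s) (by simp)
    (fun p q h1 h2 => ?_) (fun t ht a b => ?_) hp
  · rw [map_add]
    exact add_mem h1 h2
  · rw [LogSum.eulerInv_single]
    exact LogSum.single_mem ht _

theorem LogSum.euler_eulerInv {s : ℝ} (hs : 0 < s) {p : LogSum G} (hp : p ∈ LogSum.order G s) :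
    LogSum.euler (LogSum.eulerInv p) = p := by
  refine LogSum.induction (motive := fun p => LogSum.euler (LogSum.eulerInv p) = p) (by simp)
    (fun p q h1 h2 => ?_) (fun t ht a b => ?_) hp
  · rw [map_add, map_add, h1, h2]
  · have h0 : t ≠ 0 := (hs.trans_le ht).ne'
    rw [LogSum.eulerInv_single, LogSum.euler_single, smul_sub, smul_smul, smul_smul, smul_smul,
      mul_inv_cancel₀ h0, one_smul, one_smul, pow_two, ← mul_assoc, mul_inv_cancel₀ h0, one_mul,
      sub_add_cancel]

/-- The formal operator `c r^q - r² B`, for an endomorphism `B` of the coefficients. -/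
def LogSum.perturbation (c q : ℝ) (B : G →ₗ[ℝ] G) : LogSum G →ₗ[ℝ] LogSum G :=
  Finsupp.lsum ℝ fun t => c • Finsupp.lsingle (t + q) - (Finsupp.lsingle (t + 2)).comp (B.prodMap B)

theorem LogSum.perturbation_single (c q : ℝ) (B : G →ₗ[ℝ] G) (t : ℝ) (a b : G) :
    LogSum.perturbation c q B (Finsupp.single t (a, b))
      = c • Finsupp.single (t + q) (a, b) - Finsupp.single (t + 2) (B a, B b) := by
  simp [LogSum.perturbation]

theorem LogSum.perturbation_mem (c q : ℝ) (B : G →ₗ[ℝ] G) {s : ℝ} {p : LogSum G}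
    (hp : p ∈ LogSum.order G s) :
    LogSum.perturbation c q B p ∈ LogSum.order G (s + min 2 q) := by
  refine LogSum.induction
    (motive := fun p => LogSum.perturbation c q B p ∈ LogSum.order G (s + min 2 q)) (by simp)
    (fun p q h1 h2 => ?_) (fun t ht a b => ?_) hp
  · rw [map_add]
    exact add_mem h1 h2
  · rw [LogSum.perturbation_single]
    exact sub_mem (Submodule.smul_mem _ _
      (LogSum.single_mem (add_le_add ht (min_le_right _ _)) _))
      (LogSum.single_mem (add_le_add ht (min_le_left _ _)) _)

theorem LogSum.eval_perturbation (c q : ℝ) (B : G →ₗ[ℝ] G) (p : LogSum G) {r : ℝ} (hr : 0 < r) :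
    LogSum.eval r (LogSum.perturbation c q B p)
      = (c * r ^ q) • LogSum.eval r p - (r ^ 2) • B (LogSum.eval r p) := by
  obtain ⟨s, hs⟩ := LogSum.exists_mem_order p
  refine LogSum.induction (motive := fun p => LogSum.eval r (LogSum.perturbation c q B p)
      = (c * r ^ q) • LogSum.eval r p - (r ^ 2) • B (LogSum.eval r p)) (by simp)
    (fun p q h1 h2 => ?_) (fun t _ a b => ?_) hs
  · simp only [map_add, h1, h2, smul_add]
    abel
  · simp only [LogSum.perturbation_single, map_sub, map_smul, LogSum.eval_single, map_add,
      Real.rpow_add hr, Real.rpow_two]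
    module

/-- The equation `((r d/dr)² - P) W = F`, with `P` the perturbation, can be solved among formal sums
of positive order up to an error of arbitrarily high order: each step inverts `(r d/dr)²`, and the
error is then the image of the correction under `P`. -/
theorem LogSum.exists_approx_solution (c : ℝ) {q : ℝ} (hq : 0 < q) (B : G →ₗ[ℝ] G) {s : ℝ}
    (hs : 0 < s) {F : LogSum G} (hF : F ∈ LogSum.order G s) (n : ℕ) :
    ∃ W ∈ LogSum.order G s, F - (LogSum.euler (LogSum.euler W) - LogSum.perturbation c q B W)
      ∈ LogSum.order G (s + n * min 2 q) := by
  have hη : 0 < min 2 q := lt_min two_pos hq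
  induction n with
  | zero => exact ⟨0, zero_mem _, by simpa using hF⟩
  | succ n ih =>
    obtain ⟨W, hW, hE⟩ := ih
    have hs' : s ≤ s + n * min 2 q := le_add_of_nonneg_right (by positivity)
    set V := LogSum.eulerInv (LogSum.eulerInv
      (F - (LogSum.euler (LogSum.euler W) - LogSum.perturbation c q B W))) with hV
    have hVm : V ∈ LogSum.order G (s + n * min 2 q) := LogSum.eulerInv_mem (LogSum.eulerInv_mem hE)
    have hDV : LogSum.euler (LogSum.euler V)
        = F - (LogSum.euler (LogSum.euler W) - LogSum.perturbation c q B W) := by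
      rw [hV, LogSum.euler_eulerInv (hs.trans_le hs') (LogSum.eulerInv_mem hE),
        LogSum.euler_eulerInv (hs.trans_le hs') hE]
    refine ⟨W + V, add_mem hW (LogSum.order_anti hs' hVm), ?_⟩
    have : F - (LogSum.euler (LogSum.euler (W + V)) - LogSum.perturbation c q B (W + V))
        = LogSum.perturbation c q B V := by
      simp only [map_add, hDV]
      abel
    rw [this]
    convert LogSum.perturbation_mem c q B hVm using 2
    push_cast
    ring

/-- A formal sum `e` annihilated by `(r d/dr)²` can be corrected by terms of positive order so that
it solves the full equation up to order `N`. -/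
theorem LogSum.exists_correction (c : ℝ) {q : ℝ} (hq : 0 < q) (B : G →ₗ[ℝ] G) {e : LogSum G}
    (he : e ∈ LogSum.order G 0) (he0 : LogSum.euler (LogSum.euler e) = 0) (N : ℝ) :
    ∃ W ∈ LogSum.order G (min 2 q), LogSum.euler (LogSum.euler (e + W))
      - LogSum.perturbation c q B (e + W) ∈ LogSum.order G N := by
  have hη : 0 < min 2 q := lt_min two_pos hq
  obtain ⟨n, hn⟩ := exists_nat_ge (N / min 2 q)
  have hF := LogSum.perturbation_mem c q B he
  rw [zero_add] at hF
  obtain ⟨W, hW, hE⟩ := LogSum.exists_approx_solution c hq B hη hF n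
  refine ⟨W, hW, ?_⟩
  rw [map_add, map_add, map_add, he0]
  have h1 := neg_mem hE
  have h2 : N ≤ min 2 q + n * min 2 q := by
    have := (div_le_iff₀ hη).1 hn
    linarith
  convert LogSum.order_anti h2 h1 using 1
  abel

/-! ### Analysis of power-logarithm sums -/

theorem hasDerivAt_rpow_euler (t : ℝ) {r : ℝ} (hr : 0 < r) :
    HasDerivAt (fun r : ℝ => r ^ t) (r⁻¹ * (t * r ^ t)) r := by
  refine (Real.hasDerivAt_rpow_const (Or.inl hr.ne')).congr_deriv ?_
  rw [Real.rpow_sub_one hr.ne']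
  ring

theorem hasDerivAt_rpow_mul_log_euler (t : ℝ) {r : ℝ} (hr : 0 < r) :
    HasDerivAt (fun r : ℝ => r ^ t * Real.log r) (r⁻¹ * (t * (r ^ t * Real.log r) + r ^ t)) r := by
  refine ((hasDerivAt_rpow_euler t hr).mul (Real.hasDerivAt_log hr.ne')).congr_deriv ?_
  ring

/-- `r d/dr` on the pairing of two power-logarithm sums. -/
theorem LogSum.hasDerivAt_pairing (b : G →ₗ[ℝ] G →ₗ[ℝ] ℝ) (p q : LogSum G) {r : ℝ} (hr : 0 < r) :
    HasDerivAt (fun r => b (LogSum.eval r p) (LogSum.eval r q))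
      (r⁻¹ * (b (LogSum.eval r (LogSum.euler p)) (LogSum.eval r q)
        + b (LogSum.eval r p) (LogSum.eval r (LogSum.euler q)))) r := by
  obtain ⟨s, hs⟩ := LogSum.exists_mem_order p
  obtain ⟨s', hs'⟩ := LogSum.exists_mem_order q
  refine LogSum.induction (motive := fun p => HasDerivAt
      (fun r => b (LogSum.eval r p) (LogSum.eval r q))
      (r⁻¹ * (b (LogSum.eval r (LogSum.euler p)) (LogSum.eval r q)
        + b (LogSum.eval r p) (LogSum.eval r (LogSum.euler q)))) r)
    (by simpa using hasDerivAt_const r (0 : ℝ)) (fun p p' h1 h2 => ?_) (fun t _ a a' => ?_) hs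
  · simp only [map_add, LinearMap.add_apply]
    refine (h1.add h2).congr_deriv ?_
    ring
  refine LogSum.induction (motive := fun q => HasDerivAt
      (fun r => b (LogSum.eval r (Finsupp.single t (a, a'))) (LogSum.eval r q))
      (r⁻¹ * (b (LogSum.eval r (LogSum.euler (Finsupp.single t (a, a')))) (LogSum.eval r q)
        + b (LogSum.eval r (Finsupp.single t (a, a'))) (LogSum.eval r (LogSum.euler q)))) r)
    (by simpa using hasDerivAt_const r (0 : ℝ)) (fun q q' h1 h2 => ?_) (fun t' _ c c' => ?_) hs'
  · simp only [map_add]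
    refine (h1.add h2).congr_deriv ?_
    ring
  · simp only [LogSum.euler_single, LogSum.eval_single, map_add, map_smul, LinearMap.add_apply,
      LinearMap.smul_apply, smul_eq_mul]
    have e1 := hasDerivAt_rpow_euler t hr
    have e2 := hasDerivAt_rpow_mul_log_euler t hr
    have e3 := hasDerivAt_rpow_euler t' hr
    have e4 := hasDerivAt_rpow_mul_log_euler t' hr
    refine ((((e1.mul (e3.mul_const (b a c))).add (e2.mul (e3.mul_const (b a' c)))).add
      ((e1.mul (e4.mul_const (b a c'))).add (e2.mul (e4.mul_const (b a' c'))))).congr_of_eventuallyEq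
        (Eventually.of_forall fun x => ?_)).congr_deriv ?_
    · simp only [Pi.add_apply, Pi.mul_apply]
      ring
    · ring

/-- A pairing of power-logarithm sums of positive total order vanishes at `0`. -/
theorem LogSum.tendsto_pairing (b : G →ₗ[ℝ] G →ₗ[ℝ] ℝ) {s s' : ℝ} (h : 0 < s + s') {p q : LogSum G}
    (hp : p ∈ LogSum.order G s) (hq : q ∈ LogSum.order G s') :
    Tendsto (fun r => b (LogSum.eval r p) (LogSum.eval r q)) (𝓝[>] 0) (𝓝 0) := by
  refine LogSum.induction (motive := fun p => Tendsto
      (fun r => b (LogSum.eval r p) (LogSum.eval r q)) (𝓝[>] 0) (𝓝 0)) (by simp)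
    (fun p p' h1 h2 => ?_) (fun t ht a a' => ?_) hp
  · simp only [map_add, LinearMap.add_apply]
    simpa using h1.add h2
  refine LogSum.induction (motive := fun q => Tendsto
      (fun r => b (LogSum.eval r (Finsupp.single t (a, a'))) (LogSum.eval r q)) (𝓝[>] 0) (𝓝 0))
    (by simp) (fun q q' h1 h2 => ?_) (fun t' ht' c c' => ?_) hq
  · simp only [map_add]
    simpa using h1.add h2
  · have hε : 0 < (t + t') / 2 := by linarith
    have l0 : Tendsto (fun r : ℝ => r ^ ((t + t') / 2)) (𝓝[>] 0) (𝓝 0) := by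
      have := (Real.continuousAt_rpow_const 0 _ (Or.inr hε.le)).tendsto
      rw [Real.zero_rpow hε.ne'] at this
      exact this.mono_left nhdsWithin_le_nhds
    have l1 := tendsto_log_mul_rpow_nhdsGT_zero hε
    have h00 := (l0.mul l0).mul_const (b a c)
    have h01 := (l0.mul l1).mul_const (b a c' + b a' c)
    have h11 := (l1.mul l1).mul_const (b a' c')
    have hall := (h00.add h01).add h11
    simp only [mul_zero, zero_mul, add_zero] at hall
    refine hall.congr' ?_
    filter_upwards [self_mem_nhdsWithin] with r hr
    have hr0 : 0 < r := hr
    have e : r ^ ((t + t') / 2) * r ^ ((t + t') / 2) = r ^ t * r ^ t' := by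
      rw [← Real.rpow_add hr0, ← Real.rpow_add hr0]
      congr 1
      ring
    simp only [LogSum.eval_single, map_add, map_smul, LinearMap.add_apply,
      LinearMap.smul_apply, smul_eq_mul]
    linear_combination (b a c + Real.log r * (b a c' + b a' c) + Real.log r ^ 2 * b a' c') * e

end LogSum

/-! ### Axial test functions as coefficients -/

/-- The real-valued test functions of the axial coordinate `z`. -/
def axialTest : Submodule ℝ (ℝ → ℝ) where
  carrier := {g | ContDiff ℝ ∞ g ∧ HasCompactSupport g}
  zero_mem' := ⟨contDiff_const, HasCompactSupport.zero⟩
  add_mem' hf hg := ⟨hf.1.add hg.1, hf.2.add hg.2⟩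
  smul_mem' c _ hf := ⟨contDiff_const.smul hf.1, hf.2.smul_left (f := fun _ => c)⟩

theorem axialTest_hasDerivAt (g : axialTest) (z : ℝ) :
    HasDerivAt (g : ℝ → ℝ) (deriv (g : ℝ → ℝ) z) z :=
  (g.2.1.differentiable (by simp) z).hasDerivAt

/-- Differentiation of axial test functions. -/
def axialDeriv : axialTest →ₗ[ℝ] axialTest where
  toFun g := ⟨deriv (g : ℝ → ℝ), (contDiff_infty_iff_deriv.1 g.2.1).2, g.2.2.deriv⟩
  map_add' f g := Subtype.ext (funext fun z =>
    ((axialTest_hasDerivAt f z).add (axialTest_hasDerivAt g z)).deriv)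
  map_smul' c g := Subtype.ext (funext fun z =>
    ((axialTest_hasDerivAt g z).const_smul c).deriv)

theorem hasDerivAt_axialDeriv (g : axialTest) (z : ℝ) :
    HasDerivAt (g : ℝ → ℝ) ((axialDeriv g : ℝ → ℝ) z) z :=
  axialTest_hasDerivAt g z

theorem axialTest_integrable_mul (g h : axialTest) :
    Integrable fun z => (g : ℝ → ℝ) z * (h : ℝ → ℝ) z :=
  (g.2.1.continuous.mul h.2.1.continuous).integrable_of_hasCompactSupport g.2.2.mul_right

/-- The pairing `∫ g h dz`. -/
def axialPairing : axialTest →ₗ[ℝ] axialTest →ₗ[ℝ] ℝ :=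
  LinearMap.mk₂ ℝ (fun g h => ∫ z, (g : ℝ → ℝ) z * (h : ℝ → ℝ) z)
    (fun g g' h => by
      simp only [Submodule.coe_add, Pi.add_apply, add_mul]
      exact integral_add (axialTest_integrable_mul g h) (axialTest_integrable_mul g' h))
    (fun c g h => by
      simp only [Submodule.coe_smul, Pi.smul_apply, smul_eq_mul, mul_assoc]
      exact integral_const_mul _ _)
    (fun g h h' => by
      simp only [Submodule.coe_add, Pi.add_apply, mul_add]
      exact integral_add (axialTest_integrable_mul g h) (axialTest_integrable_mul g h'))
    (fun c g h => by
      simp only [Submodule.coe_smul, Pi.smul_apply, smul_eq_mul, mul_left_comm _ c]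
      exact integral_const_mul _ _)

theorem axialPairing_apply (g h : axialTest) :
    axialPairing g h = ∫ z, (g : ℝ → ℝ) z * (h : ℝ → ℝ) z := rfl

theorem axialPairing_axialDeriv (g h : axialTest) :
    axialPairing (axialDeriv g) h = -axialPairing g (axialDeriv h) := by
  rw [axialPairing_apply, axialPairing_apply, eq_neg_iff_add_eq_zero,
    ← integral_add (axialTest_integrable_mul _ _) (axialTest_integrable_mul _ _)]
  exact integral_eq_zero_of_hasDerivAt_of_integrable
    (fun z => (hasDerivAt_axialDeriv g z).mul (hasDerivAt_axialDeriv h z))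
    ((axialTest_integrable_mul _ _).add (axialTest_integrable_mul _ _))
    (axialTest_integrable_mul g h)

/-- The second derivative on axial test functions. -/
def axialLaplacian : axialTest →ₗ[ℝ] axialTest := axialDeriv.comp axialDeriv

theorem axialPairing_axialLaplacian (g h : axialTest) :
    axialPairing (axialLaplacian g) h = axialPairing g (axialLaplacian h) := by
  simp [axialLaplacian, axialPairing_axialDeriv]

theorem exists_axialPairing_self_ne_zero : ∃ g : axialTest, axialPairing g g ≠ 0 := by
  let f : ContDiffBump (0 : ℝ) := ⟨1, 2, one_pos, one_lt_two⟩
  refine ⟨⟨f, f.contDiff, f.hasCompactSupport⟩, ne_of_gt ?_⟩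
  rw [axialPairing_apply]
  refine Continuous.integral_pos_of_hasCompactSupport_nonneg_nonzero (x := 0)
    (f.continuous.mul f.continuous) f.hasCompactSupport.mul_right
    (fun z => mul_self_nonneg (f z)) ?_
  have : f 0 = 1 := f.one_of_mem_closedBall (by simp [f])
  change f 0 * f 0 ≠ 0
  rw [this]
  norm_num

/-! ### Power-logarithm sums as functions of `(r, z)` -/

namespace LogSum

/-- The function of `(r, z)` given by a formal sum with axial test functions as coefficients. -/
def fn (p : LogSum axialTest) (r z : ℝ) : ℝ := ((eval r p : axialTest) : ℝ → ℝ) z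

theorem fn_add (p q : LogSum axialTest) (r z : ℝ) : fn (p + q) r z = fn p r z + fn q r z := by
  simp [fn]

theorem fn_zero (r z : ℝ) : fn 0 r z = 0 := by
  simp [fn]

theorem fn_single (t : ℝ) (a b : axialTest) (r z : ℝ) :
    fn (Finsupp.single t (a, b)) r z
      = r ^ t * (a : ℝ → ℝ) z + r ^ t * Real.log r * (b : ℝ → ℝ) z := by
  simp [fn, eval_single]

theorem hasDerivAt_fn_r (p : LogSum axialTest) {r : ℝ} (hr : 0 < r) (z : ℝ) :
    HasDerivAt (fun r => fn p r z) (r⁻¹ * fn (euler p) r z) r := by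
  obtain ⟨s, hs⟩ := exists_mem_order p
  refine LogSum.induction (motive := fun p => HasDerivAt (fun r => fn p r z)
    (r⁻¹ * fn (euler p) r z) r) ?_ (fun p q h1 h2 => ?_) (fun t _ a b => ?_) hs
  · simpa only [map_zero, fn_zero, mul_zero] using hasDerivAt_const r (0 : ℝ)
  · simp only [map_add, fn_add, mul_add]
    exact h1.add h2
  · simp only [euler_single, fn_single, Submodule.coe_add, Submodule.coe_smul, Pi.add_apply,
      Pi.smul_apply, smul_eq_mul]
    refine (((hasDerivAt_rpow_euler t hr).mul_const _).add
      ((hasDerivAt_rpow_mul_log_euler t hr).mul_const _)).congr_deriv ?_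
    ring

theorem hasDerivAt_fn_z (p : LogSum axialTest) (r z : ℝ) :
    HasDerivAt (fn p r) ((axialDeriv (eval r p) : ℝ → ℝ) z) z :=
  hasDerivAt_axialDeriv _ z

theorem fn_contDiffOn (p : LogSum axialTest) :
    ContDiffOn ℝ ∞ (fun x : ℝ × ℝ × ℝ => fn p x.1 x.2.1) {x | 0 < x.1} := by
  obtain ⟨s, hs⟩ := exists_mem_order p
  refine LogSum.induction (motive := fun p => ContDiffOn ℝ ∞
    (fun x : ℝ × ℝ × ℝ => fn p x.1 x.2.1) {x | 0 < x.1}) ?_ (fun p q h1 h2 => ?_)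
    (fun t _ a b => ?_) hs
  · simp only [fn_zero]
    exact contDiffOn_const
  · simp only [fn_add]
    exact h1.add h2
  · simp only [fn_single]
    have hr : ContDiffOn ℝ ∞ (fun x : ℝ × ℝ × ℝ => x.1 ^ t) {x | 0 < x.1} :=
      (contDiffOn_rpow t).comp contDiff_fst.contDiffOn fun _ hx => hx
    have hl : ContDiffOn ℝ ∞ (fun x : ℝ × ℝ × ℝ => Real.log x.1) {x | 0 < x.1} :=
      contDiff_fst.contDiffOn.log fun x hx => ne_of_gt hx
    have ha : ∀ g : axialTest, ContDiffOn ℝ ∞ (fun x : ℝ × ℝ × ℝ => (g : ℝ → ℝ) x.2.1)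
        {x | 0 < x.1} := fun g => (g.2.1.comp (contDiff_fst.comp contDiff_snd)).contDiffOn
    exact (hr.mul (ha a)).add ((hr.mul hl).mul (ha b))

theorem exists_fn_eq_zero (p : LogSum axialTest) :
    ∃ Z, ∀ r z, Z < |z| → fn p r z = 0 := by
  obtain ⟨s, hs⟩ := exists_mem_order p
  refine LogSum.induction (motive := fun p => ∃ Z, ∀ r z, Z < |z| → fn p r z = 0)
    ⟨0, fun r z _ => fn_zero r z⟩ (fun p q h1 h2 => ?_) (fun t _ a b => ?_) hs
  · obtain ⟨Z₁, h1⟩ := h1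
    obtain ⟨Z₂, h2⟩ := h2
    refine ⟨max Z₁ Z₂, fun r z hz => ?_⟩
    rw [fn_add, h1 r z ((le_max_left _ _).trans_lt hz), h2 r z ((le_max_right _ _).trans_lt hz),
      add_zero]
  · have key : ∀ g : axialTest, ∃ Z, ∀ z, Z < |z| → (g : ℝ → ℝ) z = 0 := by
      intro g
      obtain ⟨Z, hZ⟩ := g.2.2.isCompact.isBounded.subset_closedBall 0
      refine ⟨Z, fun z hz => image_eq_zero_of_notMem_tsupport fun h => ?_⟩
      have := hZ h
      rw [mem_closedBall_zero_iff, Real.norm_eq_abs] at this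
      exact absurd this (not_le.2 hz)
    obtain ⟨Z₁, h1⟩ := key a
    obtain ⟨Z₂, h2⟩ := key b
    refine ⟨max Z₁ Z₂, fun r z hz => ?_⟩
    rw [fn_single, h1 z ((le_max_left _ _).trans_lt hz), h2 z ((le_max_right _ _).trans_lt hz),
      mul_zero, mul_zero, add_zero]

theorem rpow_mul_abs_log_le {ε r : ℝ} (hε : 0 < ε) (hr : 0 < r) (hr2 : r ≤ 2) :
    r ^ ε * |Real.log r| ≤ 1 / ε + 2 ^ ε := by
  have h2 : (0 : ℝ) < 2 ^ ε := Real.rpow_pos_of_pos two_pos _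
  rcases le_or_gt r 1 with h | h
  · have h1 := (Real.abs_log_mul_self_rpow_lt r ε hr h hε).le
    rw [abs_mul, abs_of_pos (Real.rpow_pos_of_pos hr ε), mul_comm] at h1
    linarith
  · have h1 : |Real.log r| ≤ 1 := by
      rw [abs_of_nonneg (Real.log_nonneg h.le)]
      linarith [Real.log_le_sub_one_of_pos hr]
    have h3 : r ^ ε ≤ 2 ^ ε := Real.rpow_le_rpow hr.le hr2 hε.le
    have h4 : r ^ ε * |Real.log r| ≤ 2 ^ ε * 1 := mul_le_mul h3 h1 (abs_nonneg _) h2.le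
    have : 0 < 1 / ε := by positivity
    linarith

theorem exists_fn_bound {s s' : ℝ} (h : s' < s) {p : LogSum axialTest} (hp : p ∈ order axialTest s) :
    ∃ K, 0 ≤ K ∧ ∀ r, 0 < r → r ≤ 2 → ∀ z, |fn p r z| ≤ K * r ^ s' := by
  refine LogSum.induction (motive := fun p => ∃ K, 0 ≤ K ∧ ∀ r, 0 < r → r ≤ 2 → ∀ z,
    |fn p r z| ≤ K * r ^ s') ⟨0, le_rfl, fun r _ _ z => by simp [fn_zero]⟩ (fun p q h1 h2 => ?_)
    (fun t ht a b => ?_) hp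
  · obtain ⟨K₁, hK₁, h1⟩ := h1
    obtain ⟨K₂, hK₂, h2⟩ := h2
    refine ⟨K₁ + K₂, add_nonneg hK₁ hK₂, fun r hr hr2 z => ?_⟩
    rw [fn_add, add_mul]
    exact (abs_add_le _ _).trans (add_le_add (h1 r hr hr2 z) (h2 r hr hr2 z))
  · obtain ⟨A, hA⟩ := a.2.1.continuous.bounded_above_of_compact_support a.2.2
    obtain ⟨B, hB⟩ := b.2.1.continuous.bounded_above_of_compact_support b.2.2
    have hA0 : 0 ≤ A := (norm_nonneg _).trans (hA 0)
    have hB0 : 0 ≤ B := (norm_nonneg _).trans (hB 0)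
    have hε : 0 < t - s' := by linarith
    have h2 : (0 : ℝ) < 2 ^ (t - s') := Real.rpow_pos_of_pos two_pos _
    refine ⟨2 ^ (t - s') * A + (1 / (t - s') + 2 ^ (t - s')) * B, by positivity,
      fun r hr hr2 z => ?_⟩
    have hs' : 0 < r ^ s' := Real.rpow_pos_of_pos hr _
    have ht' : 0 < r ^ (t - s') := Real.rpow_pos_of_pos hr _
    have e : r ^ t = r ^ s' * r ^ (t - s') := by
      rw [← Real.rpow_add hr]
      congr 1
      ring
    have h3 : r ^ (t - s') ≤ 2 ^ (t - s') := Real.rpow_le_rpow hr.le hr2 hε.le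
    have h4 := rpow_mul_abs_log_le hε hr hr2
    have e5 : fn (Finsupp.single t (a, b)) r z = r ^ s' * (r ^ (t - s') * (a : ℝ → ℝ) z
        + r ^ (t - s') * Real.log r * (b : ℝ → ℝ) z) := by
      rw [fn_single, e]
      ring
    rw [e5, abs_mul, abs_of_pos hs', mul_comm]
    refine mul_le_mul_of_nonneg_right ((abs_add_le _ _).trans (add_le_add ?_ ?_)) hs'.le
    · rw [abs_mul, abs_of_pos ht']
      exact mul_le_mul h3 (hA z) (abs_nonneg _) h2.le
    · rw [abs_mul, abs_mul, abs_of_pos ht']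
      exact mul_le_mul h4 (hB z) (abs_nonneg _) (by positivity)

end LogSum

/-! ### Truncated expansions on the static slice -/

open LogSum

/-- The axially symmetric function `χ(r) p(r, z)` on the slice. -/
def truncated (p : LogSum axialTest) (x : ℝ × ℝ × ℝ) : ℝ := cutoff x.1 * fn p x.1 x.2.1

/-- The formal operator `P` for which `A` acts on axially symmetric functions as
`-r^{-2α} ((r d/dr)² - P)`. -/
def slicePerturbation (σ M : ℝ) : LogSum axialTest →ₗ[ℝ] LogSum axialTest :=
  perturbation (M ^ 2) (4 * σ + 2 * alpha σ) axialLaplacian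

/-- The image of `truncated p` under the Klein–Gordon operator. -/
def truncatedImage (σ M : ℝ) (p : LogSum axialTest) (x : ℝ × ℝ × ℝ) : ℝ :=
  -(x.1 ^ (-(2 * alpha σ)) * (cutoff x.1 * fn (euler (euler p) - slicePerturbation σ M p) x.1 x.2.1
    + 2 * (x.1 * deriv cutoff x.1) * fn (euler p) x.1 x.2.1
    + (x.1 * deriv cutoff x.1 + x.1 ^ 2 * deriv (deriv cutoff) x.1) * fn p x.1 x.2.1))

theorem fn_sub (p q : LogSum axialTest) (r z : ℝ) : fn (p - q) r z = fn p r z - fn q r z := by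
  have h := (eval r).map_sub p q
  exact congrFun (congrArg Subtype.val h) z

theorem fn_slicePerturbation (σ M : ℝ) (p : LogSum axialTest) {r : ℝ} (hr : 0 < r) (z : ℝ) :
    fn (slicePerturbation σ M p) r z = M ^ 2 * r ^ (4 * σ + 2 * alpha σ) * fn p r z
      - r ^ 2 * ((axialLaplacian (eval r p) : axialTest) : ℝ → ℝ) z := by
  rw [fn, slicePerturbation, eval_perturbation _ _ _ _ hr]
  rfl

theorem truncated_isRegular (p : LogSum axialTest) :
    IsRegular fun x => (truncated p x : ℂ) := by
  refine ⟨Complex.ofRealCLM.contDiff.comp_contDiffOn (ContDiffOn.mul ?_ (fn_contDiffOn p)),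
    fun _ _ _ => rfl⟩
  exact (cutoff_contDiff.comp contDiff_fst).contDiffOn

theorem kleinGordon_truncated {σ C : ℝ} (hC : 0 < C) (M : ℝ) (p : LogSum axialTest)
    {x : ℝ × ℝ × ℝ} (hx : 0 < x.1) :
    kleinGordon σ C M (fun x => (truncated p x : ℂ)) x = (truncatedImage σ M p x : ℂ) := by
  obtain ⟨r, z, θ⟩ := x
  have hr : 0 < r := hx
  have hR : ∀ s, 0 < s → dR (fun x => (truncated p x : ℂ)) (s, z, θ)
      = ((deriv cutoff s * fn p s z + cutoff s * (s⁻¹ * fn (euler p) s z) : ℝ) : ℂ) := fun s hs =>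
    ((hasDerivAt_cutoff s).mul (hasDerivAt_fn_r p hs z)).ofReal_comp.deriv
  have hRR : dR (mulR (fun r => sqrtDet σ C r * (hrr σ r)⁻¹ * lapse σ r)
      (dR fun x => (truncated p x : ℂ))) (r, z, θ)
      = ((C⁻¹ * (r⁻¹ * (cutoff r * fn (euler (euler p)) r z
        + 2 * (r * deriv cutoff r) * fn (euler p) r z
        + (r * deriv cutoff r + r ^ 2 * deriv (deriv cutoff) r) * fn p r z)) : ℝ) : ℂ) := by
    have h1 : HasDerivAt (fun s => C⁻¹ * (s * deriv cutoff s * fn p s z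
        + cutoff s * fn (euler p) s z)) (C⁻¹ * (r⁻¹ * (cutoff r * fn (euler (euler p)) r z
        + 2 * (r * deriv cutoff r) * fn (euler p) r z
        + (r * deriv cutoff r + r ^ 2 * deriv (deriv cutoff) r) * fn p r z))) r := by
      refine (((((hasDerivAt_id r).mul (hasDerivAt_deriv_cutoff r)).mul (hasDerivAt_fn_r p hr z)).add
        ((hasDerivAt_cutoff r).mul (hasDerivAt_fn_r (euler p) hr z))).const_mul C⁻¹).congr_deriv ?_
      simp only [id, Pi.mul_apply]
      field_simp
      ring
    refine (h1.ofReal_comp.congr_of_eventuallyEq ?_).deriv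
    filter_upwards [Ioi_mem_nhds hr] with s hs
    have hs0 : s ≠ 0 := (mem_Ioi.1 hs).ne'
    rw [mulR, hR s hs, axial_coeff_eq σ hC hs]
    rw [← Complex.ofReal_mul]
    congr 1
    field_simp
  have hZ : ∀ s, dZ (fun x => (truncated p x : ℂ)) (r, s, θ)
      = ((cutoff r * ((axialDeriv (eval r p) : axialTest) : ℝ → ℝ) s : ℝ) : ℂ) := fun s =>
    ((hasDerivAt_fn_z p r s).const_mul (cutoff r)).ofReal_comp.deriv
  have hZZ : dZ (mulR (fun r => sqrtDet σ C r * (hrr σ r)⁻¹ * lapse σ r)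
      (dZ fun x => (truncated p x : ℂ))) (r, z, θ)
      = ((r / C * (cutoff r * ((axialLaplacian (eval r p) : axialTest) : ℝ → ℝ) z) : ℝ) : ℂ) := by
    have h1 := (((hasDerivAt_axialDeriv (axialDeriv (eval r p)) z).const_mul
      (cutoff r)).const_mul (r / C)).ofReal_comp
    have h2 : (fun s => mulR (fun r => sqrtDet σ C r * (hrr σ r)⁻¹ * lapse σ r)
        (dZ fun x => (truncated p x : ℂ)) (r, s, θ)) = fun s =>
        ((r / C * (cutoff r * ((axialDeriv (eval r p) : axialTest) : ℝ → ℝ) s) : ℝ) : ℂ) := by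
      funext s
      rw [mulR, hZ s, axial_coeff_eq σ hC hr, ← Complex.ofReal_mul]
    rw [dZ]
    simp only [h2]
    exact h1.deriv
  have hT : dT (fun x => (truncated p x : ℂ)) = fun _ => 0 := by
    funext y
    change deriv (fun _ : ℝ => (truncated p y : ℂ)) y.2.2 = 0
    exact deriv_const _ _
  have hTT : dT (mulR (fun r => sqrtDet σ C r * (hθθ σ C r)⁻¹ * lapse σ r)
      (dT fun x => (truncated p x : ℂ))) (r, z, θ) = 0 := by
    rw [hT]
    simp [dT, mulR]
  rw [kleinGordon, weightedLaplacian]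
  simp only [Pi.add_apply, Pi.neg_apply]
  rw [mulR, mulR, Pi.add_apply, Pi.add_apply, hRR, hZZ, hTT, lapse_div_sqrtDet σ hC hr,
    lapse_sq σ hr, add_zero, ← Complex.ofReal_add, ← Complex.ofReal_mul, ← Complex.ofReal_neg,
    ← Complex.ofReal_mul, ← Complex.ofReal_add]
  congr 1
  have hα : 0 < r ^ (2 * alpha σ) := Real.rpow_pos_of_pos hr _
  simp only [truncatedImage, truncated, fn_sub, fn_slicePerturbation σ M p hr z]
  rw [Real.rpow_sub hr, Real.rpow_one, Real.rpow_neg hr.le, Real.rpow_add hr]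
  field_simp
  ring

/-- The weight of `sliceMeasure` is `r^{2α-1} / C`, so that functions of order `r^β` at the axis are
square integrable for `β > -α`. -/
theorem memLp_sliceMeasure {σ C : ℝ} (hC : 0 < C) {u : ℝ × ℝ × ℝ → ℝ}
    (hu : ContinuousOn u {x | 0 < x.1}) {β K Z : ℝ} (hβ : -alpha σ < β)
    (hb : ∀ x, 0 < x.1 → x.1 ≤ 2 → |u x| ≤ K * x.1 ^ β) (h2 : ∀ x, 2 < x.1 → u x = 0)
    (hZ : ∀ x, Z < |x.2.1| → u x = 0) : MemLp u 2 (sliceMeasure σ C) := by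
  have hm : AEStronglyMeasurable u coordMeasure := by
    rw [← restrict_eq_coordMeasure]
    exact (hu.mono fun x hx => hx.1).aestronglyMeasurable
      (measurableSet_Ioi.prod (MeasurableSet.univ.prod measurableSet_Ioc))
  have hac : sliceMeasure σ C ≪ coordMeasure := by
    rw [sliceMeasure, restrict_eq_coordMeasure]
    exact withDensity_absolutelyContinuous _ _
  have hm' : AEStronglyMeasurable u (sliceMeasure σ C) := hm.mono_ac hac
  rw [memLp_two_iff_integrable_sq hm', sliceMeasure, restrict_eq_coordMeasure,
    integrable_withDensity_iff_integrable_smul' (measurable_density σ C).ennreal_ofReal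
      (Eventually.of_forall fun _ => ENNReal.ofReal_lt_top)]
  let F : ℝ → ℝ := (Ioc 0 2).indicator fun r => K ^ 2 / C * r ^ (2 * β + 2 * alpha σ - 1)
  let H : ℝ → ℝ := (Icc (-Z) Z).indicator fun _ => 1
  have hF : IntegrableOn F (Ioi 0) := by
    have h1 : IntegrableOn (fun r : ℝ => r ^ (2 * β + 2 * alpha σ - 1)) (Ioc 0 2) := by
      rw [← intervalIntegrable_iff_integrableOn_Ioc_of_le zero_le_two]
      exact intervalIntegral.intervalIntegrable_rpow' (by linarith)
    exact ((integrable_indicator_iff measurableSet_Ioc).2 (h1.const_mul _)).integrableOn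
  have hH : Integrable H := (integrable_indicator_iff measurableSet_Icc).2
    (integrableOn_const (by simp))
  have h1 : Integrable (fun _ : ℝ => (1 : ℝ)) (volume.restrict (Ioc (0 : ℝ) (2 * Real.pi))) :=
    integrable_const 1
  have hprod : Integrable (fun x : ℝ × ℝ × ℝ => F x.1 * (H x.2.1 * 1)) coordMeasure :=
    Integrable.mul_prod hF (hH.mul_prod h1)
  refine hprod.mono' ?_ ?_
  · exact ((measurable_density σ C).ennreal_ofReal.ennreal_toReal.aestronglyMeasurable).smul
      (hm.pow 2)
  · filter_upwards [ae_coordMeasure_pos] with x hx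
    have hw : 0 ≤ sqrtDet σ C x.1 / lapse σ x.1 :=
      div_nonneg (Real.sqrt_nonneg _) (Real.sqrt_nonneg _)
    have hF0 : 0 ≤ F x.1 := indicator_nonneg (fun r hr => by
      have := Real.rpow_nonneg hr.1.le (2 * β + 2 * alpha σ - 1)
      positivity) _
    have hH0 : 0 ≤ H x.2.1 := indicator_nonneg (fun _ _ => zero_le_one) _
    rw [ENNReal.toReal_ofReal hw, smul_eq_mul, mul_one]
    by_cases h0 : u x = 0
    · rw [h0]
      simpa using mul_nonneg hF0 hH0
    have hx2 : x.1 ≤ 2 := not_lt.1 fun h => h0 (h2 x h)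
    have hxZ : |x.2.1| ≤ Z := not_lt.1 fun h => h0 (hZ x h)
    have eF : F x.1 = K ^ 2 / C * x.1 ^ (2 * β + 2 * alpha σ - 1) :=
      indicator_of_mem (s := Ioc 0 2) ⟨hx, hx2⟩ _
    have eH : H x.2.1 = 1 := indicator_of_mem (s := Icc (-Z) Z) (abs_le.1 hxZ) _
    rw [eF, eH, mul_one, Real.norm_of_nonneg (mul_nonneg hw (sq_nonneg _)),
      sqrtDet_div_lapse σ hC hx]
    have hsq : u x ^ 2 ≤ (K * x.1 ^ β) ^ 2 := by
      rw [← sq_abs]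
      exact pow_le_pow_left₀ (abs_nonneg _) (hb x hx hx2) 2
    have e : x.1 ^ (2 * β + 2 * alpha σ - 1) = x.1 ^ (2 * alpha σ - 1) * (x.1 ^ β) ^ 2 := by
      rw [← Real.rpow_mul_natCast hx.le, ← Real.rpow_add hx]
      congr 1
      push_cast
      ring
    have hpow := Real.rpow_pos_of_pos hx (2 * alpha σ - 1)
    calc x.1 ^ (2 * alpha σ - 1) / C * u x ^ 2
        ≤ x.1 ^ (2 * alpha σ - 1) / C * (K * x.1 ^ β) ^ 2 := by gcongr
      _ = K ^ 2 / C * x.1 ^ (2 * β + 2 * alpha σ - 1) := by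
          rw [e]
          ring

theorem fn_continuousOn (p : LogSum axialTest) :
    ContinuousOn (fun x : ℝ × ℝ × ℝ => fn p x.1 x.2.1) {x | 0 < x.1} :=
  (fn_contDiffOn p).continuousOn

theorem truncated_memLp {σ C : ℝ} (hσ : σ ≠ 1 / 2) (hC : 0 < C) {p : LogSum axialTest}
    (hp : p ∈ order axialTest 0) : MemLp (truncated p) 2 (sliceMeasure σ C) := by
  have hα := alpha_pos hσ
  obtain ⟨K, hK, hb⟩ := exists_fn_bound (s' := -(alpha σ / 2)) (by linarith) hp
  obtain ⟨Z, hZ⟩ := exists_fn_eq_zero p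
  refine memLp_sliceMeasure hC ?_ (by linarith : -alpha σ < -(alpha σ / 2)) (K := K) (Z := Z)
    (fun x hx hx2 => ?_) (fun x hx => ?_) (fun x hx => ?_)
  · exact (cutoff_contDiff.continuous.comp continuous_fst).continuousOn.mul (fn_continuousOn p)
  · rw [truncated, abs_mul]
    exact (mul_le_of_le_one_left (abs_nonneg _) (abs_cutoff_le_one _)).trans (hb _ hx hx2 _)
  · rw [truncated, cutoff_of_two_le hx.le, zero_mul]
  · rw [truncated, hZ _ _ hx, mul_zero]

/-- A term carrying a derivative of the cutoff is harmless, being supported in `1 ≤ r`. -/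
theorem exists_cutoff_term_bound {c : ℝ → ℝ} (hc : Continuous c) (hc1 : ∀ r, r < 1 → c r = 0)
    {p : LogSum axialTest} (hp : p ∈ order axialTest 0) {β : ℝ} (hβ : 0 ≤ β) :
    ∃ K, ∀ r, 0 < r → r ≤ 2 → ∀ z, |c r * fn p r z| ≤ K * r ^ β := by
  obtain ⟨K, hK, hb⟩ := exists_fn_bound (s' := -1) (by norm_num) hp
  obtain ⟨B, hB⟩ := (isCompact_Icc (a := (1 : ℝ)) (b := 2)).exists_bound_of_continuousOn
    hc.continuousOn
  have hB0 : 0 ≤ B := (norm_nonneg _).trans (hB 1 (by norm_num))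
  refine ⟨B * K, fun r hr hr2 z => ?_⟩
  have hrβ : 0 < r ^ β := Real.rpow_pos_of_pos hr _
  rcases lt_or_ge r 1 with h | h
  · rw [hc1 r h, zero_mul, abs_zero]
    positivity
  · have h1 : r ^ (-1 : ℝ) ≤ r ^ β := Real.rpow_le_rpow_of_exponent_le h (by linarith)
    rw [abs_mul, mul_assoc]
    exact mul_le_mul (hB r ⟨h, hr2⟩) ((hb r hr hr2 z).trans (mul_le_mul_of_nonneg_left h1 hK))
      (abs_nonneg _) hB0

/-- The condition on the order of the remainder compensates for the factor `r^{-2α}` of the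
operator. -/
theorem truncatedImage_memLp {σ C M : ℝ} (hσ : σ ≠ 1 / 2) (hC : 0 < C) {p : LogSum axialTest}
    (hp : p ∈ order axialTest 0)
    (hp' : euler (euler p) - slicePerturbation σ M p ∈ order axialTest (alpha σ + 1)) :
    MemLp (truncatedImage σ M p) 2 (sliceMeasure σ C) := by
  have hα := alpha_pos hσ
  have hcut' : Continuous (deriv cutoff) := deriv_cutoff_contDiff.continuous
  have hcut'' : Continuous (deriv (deriv cutoff)) :=
    (contDiff_infty_iff_deriv.1 deriv_cutoff_contDiff).2.continuous
  have cc1 : Continuous fun r => 2 * (r * deriv cutoff r) := by fun_prop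
  have cc2 : Continuous fun r => r * deriv cutoff r + r ^ 2 * deriv (deriv cutoff) r := by fun_prop
  obtain ⟨K₀, hK₀, hb₀⟩ := exists_fn_bound (s' := alpha σ + 1 / 2) (by linarith) hp'
  obtain ⟨K₁, hb₁⟩ := exists_cutoff_term_bound cc1
    (fun r hr => by rw [deriv_cutoff_eq_zero (Or.inl hr)]; ring) (euler_mem hp)
    (β := alpha σ + 1 / 2) (by linarith)
  obtain ⟨K₂, hb₂⟩ := exists_cutoff_term_bound cc2
    (fun r hr => by
      rw [deriv_cutoff_eq_zero (Or.inl hr), deriv_deriv_cutoff_eq_zero (Or.inl hr)]; ring) hp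
    (β := alpha σ + 1 / 2) (by linarith)
  obtain ⟨Z₀, hZ₀⟩ := exists_fn_eq_zero (euler (euler p) - slicePerturbation σ M p)
  obtain ⟨Z₁, hZ₁⟩ := exists_fn_eq_zero (euler p)
  obtain ⟨Z₂, hZ₂⟩ := exists_fn_eq_zero p
  refine memLp_sliceMeasure hC ?_ (by linarith : -alpha σ < 1 / 2 - alpha σ) (K := K₀ + K₁ + K₂)
    (Z := max Z₀ (max Z₁ Z₂)) (fun x hx hx2 => ?_) (fun x hx => ?_) (fun x hx => ?_)
  · have hr : ContinuousOn (fun x : ℝ × ℝ × ℝ => x.1 ^ (-(2 * alpha σ))) {x | 0 < x.1} :=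
      continuousOn_fst.rpow_const fun x hx => Or.inl (ne_of_gt hx)
    have hc (c : ℝ → ℝ) (h : Continuous c) :
        ContinuousOn (fun x : ℝ × ℝ × ℝ => c x.1) {x | 0 < x.1} :=
      (h.comp continuous_fst).continuousOn
    exact (hr.mul ((((hc _ cutoff_contDiff.continuous).mul (fn_continuousOn _)).add
      ((hc _ cc1).mul (fn_continuousOn _))).add ((hc _ cc2).mul (fn_continuousOn _)))).neg
  · have hpow : 0 < x.1 ^ (-(2 * alpha σ)) := Real.rpow_pos_of_pos hx _
    have e : x.1 ^ (1 / 2 - alpha σ) = x.1 ^ (-(2 * alpha σ)) * x.1 ^ (alpha σ + 1 / 2) := by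
      rw [← Real.rpow_add hx]
      congr 1
      ring
    have h0 : |cutoff x.1 * fn (euler (euler p) - slicePerturbation σ M p) x.1 x.2.1|
        ≤ K₀ * x.1 ^ (alpha σ + 1 / 2) := by
      rw [abs_mul]
      exact (mul_le_of_le_one_left (abs_nonneg _) (abs_cutoff_le_one _)).trans (hb₀ _ hx hx2 _)
    have h3 := (abs_add_three _ _ _).trans (add_le_add (add_le_add h0 (hb₁ _ hx hx2 x.2.1))
      (hb₂ _ hx hx2 x.2.1))
    rw [truncatedImage, abs_neg, abs_mul, abs_of_pos hpow, e]
    calc _ ≤ x.1 ^ (-(2 * alpha σ)) * (K₀ * x.1 ^ (alpha σ + 1 / 2)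
          + K₁ * x.1 ^ (alpha σ + 1 / 2) + K₂ * x.1 ^ (alpha σ + 1 / 2)) :=
          mul_le_mul_of_nonneg_left h3 hpow.le
      _ = _ := by ring
  · rw [truncatedImage, cutoff_of_two_le hx.le, deriv_cutoff_eq_zero (Or.inr hx),
      deriv_deriv_cutoff_eq_zero (Or.inr hx)]
    ring
  · rw [truncatedImage, hZ₀ _ _ ((le_max_left _ _).trans_lt hx),
      hZ₁ _ _ (((le_max_left _ _).trans (le_max_right _ _)).trans_lt hx),
      hZ₂ _ _ (((le_max_right _ _).trans (le_max_right _ _)).trans_lt hx)]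
    ring

theorem integral_truncated_mul_kleinGordon {σ C : ℝ} (hC : 0 < C) (M : ℝ) (p : LogSum axialTest)
    {f : ℝ × ℝ × ℝ → ℂ} (hf : f ∈ sliceTest) :
    ∫ x, (truncated p x : ℂ) * kleinGordon σ C M f x ∂(sliceMeasure σ C)
      = ∫ x, (truncatedImage σ M p x : ℂ) * f x ∂(sliceMeasure σ C) := by
  rw [integral_mul_kleinGordon hC M (truncated_isRegular p) hf, integral_sliceMeasure,
    integral_sliceMeasure]
  refine integral_congr_ae ?_
  filter_upwards [ae_coordMeasure_pos] with x hx
  rw [kleinGordon_truncated hC M p hx]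

/-! ### The boundary form of two truncated expansions -/

/-- The Wronskian of two expansions with respect to `r d/dr`, integrated over `z`. -/
def wronskian (p q : LogSum axialTest) (r : ℝ) : ℝ :=
  axialPairing (eval r (euler p)) (eval r q) - axialPairing (eval r p) (eval r (euler q))

theorem hasDerivAt_wronskian (p q : LogSum axialTest) {r : ℝ} (hr : 0 < r) :
    HasDerivAt (wronskian p q) (r⁻¹ * (axialPairing (eval r (euler (euler p))) (eval r q)
      - axialPairing (eval r p) (eval r (euler (euler q))))) r := by
  refine ((hasDerivAt_pairing axialPairing (euler p) q hr).sub
    (hasDerivAt_pairing axialPairing p (euler q) hr)).congr_deriv ?_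
  ring

/-- Integrated over `z`, the boundary form of two truncated expansions is the derivative of their
truncated Wronskian: `P` is symmetric and drops out. -/
theorem integral_boundary_form {σ C M : ℝ} (hC : 0 < C) (p q : LogSum axialTest) {r : ℝ}
    (hr : 0 < r) (θ : ℝ) : ∫ z, sqrtDet σ C r / lapse σ r *
      (truncatedImage σ M p (r, z, θ) * truncated q (r, z, θ)
        - truncated p (r, z, θ) * truncatedImage σ M q (r, z, θ))
      = -C⁻¹ * (2 * cutoff r * deriv cutoff r * wronskian p q r + cutoff r ^ 2 *
        (r⁻¹ * (axialPairing (eval r (euler (euler p))) (eval r q)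
          - axialPairing (eval r p) (eval r (euler (euler q)))))) := by
  set a := eval r p with ha
  set b := eval r q with hb
  set a1 := eval r (euler p) with ha1
  set b1 := eval r (euler q) with hb1
  set a2 := eval r (euler (euler p)) with ha2
  set b2 := eval r (euler (euler q)) with hb2
  have hpow : r ^ (2 * alpha σ) ≠ 0 := (Real.rpow_pos_of_pos hr _).ne'
  have hpt : ∀ z, sqrtDet σ C r / lapse σ r *
      (truncatedImage σ M p (r, z, θ) * truncated q (r, z, θ)
        - truncated p (r, z, θ) * truncatedImage σ M q (r, z, θ))
      = -(C⁻¹ * r⁻¹ * cutoff r ^ 2) * ((a2 : ℝ → ℝ) z * (b : ℝ → ℝ) z)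
        + C⁻¹ * r⁻¹ * cutoff r ^ 2 * ((a : ℝ → ℝ) z * (b2 : ℝ → ℝ) z)
        + -(C⁻¹ * r * cutoff r ^ 2) * ((axialLaplacian a : ℝ → ℝ) z * (b : ℝ → ℝ) z)
        + C⁻¹ * r * cutoff r ^ 2 * ((a : ℝ → ℝ) z * (axialLaplacian b : ℝ → ℝ) z)
        + -(C⁻¹ * (2 * cutoff r * deriv cutoff r)) * ((a1 : ℝ → ℝ) z * (b : ℝ → ℝ) z)
        + C⁻¹ * (2 * cutoff r * deriv cutoff r) * ((a : ℝ → ℝ) z * (b1 : ℝ → ℝ) z) := by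
    intro z
    simp only [truncatedImage, truncated, fn_sub, fn_slicePerturbation σ M _ hr]
    rw [sqrtDet_div_lapse σ hC hr, Real.rpow_sub hr, Real.rpow_one, Real.rpow_neg hr.le]
    simp only [fn, ← ha, ← hb, ← ha1, ← hb1, ← ha2, ← hb2]
    field_simp
    ring
  have I (c : ℝ) (g h : axialTest) :
      Integrable (fun z => c * ((g : ℝ → ℝ) z * (h : ℝ → ℝ) z)) ∧
        ∫ z, c * ((g : ℝ → ℝ) z * (h : ℝ → ℝ) z) = c * axialPairing g h :=
    ⟨(axialTest_integrable_mul g h).const_mul c, integral_const_mul _ _⟩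
  have S {f g : ℝ → ℝ} {x y : ℝ} (hf : Integrable f ∧ ∫ z, f z = x)
      (hg : Integrable g ∧ ∫ z, g z = y) :
      Integrable (fun z => f z + g z) ∧ ∫ z, (f z + g z) = x + y :=
    ⟨hf.1.add hg.1, by rw [integral_add hf.1 hg.1, hf.2, hg.2]⟩
  simp only [hpt]
  rw [(S (S (S (S (S (I _ _ _) (I _ _ _)) (I _ _ _)) (I _ _ _)) (I _ _ _)) (I _ _ _)).2]
  simp only [axialPairing_axialLaplacian, wronskian]
  ring

/-- The boundary form of two truncated expansions is the limit of their Wronskian at the axis. -/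
theorem integral_boundary_form_eq {σ C M : ℝ} (hC : 0 < C) (p q : LogSum axialTest) {l : ℝ}
    (hint : Integrable (fun x => truncatedImage σ M p x * truncated q x
      - truncated p x * truncatedImage σ M q x) (sliceMeasure σ C))
    (hl : Tendsto (wronskian p q) (𝓝[>] 0) (𝓝 l)) :
    ∫ x, (truncatedImage σ M p x * truncated q x - truncated p x * truncatedImage σ M q x)
      ∂(sliceMeasure σ C) = 2 * Real.pi * (C⁻¹ * l) := by
  have hint' : Integrable (fun x : ℝ × ℝ × ℝ => sqrtDet σ C x.1 / lapse σ x.1 *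
      (truncatedImage σ M p x * truncated q x - truncated p x * truncatedImage σ M q x))
      coordMeasure := by
    rw [sliceMeasure, restrict_eq_coordMeasure, integrable_withDensity_iff_integrable_smul'
      (measurable_density σ C).ennreal_ofReal
      (Eventually.of_forall fun _ => ENNReal.ofReal_lt_top)] at hint
    refine hint.congr (Eventually.of_forall fun x => ?_)
    have : 0 ≤ sqrtDet σ C x.1 / lapse σ x.1 := div_nonneg (Real.sqrt_nonneg _) (Real.sqrt_nonneg _)
    simp only [ENNReal.toReal_ofReal this, smul_eq_mul]
  have hinner : ∀ r, ∫ y : ℝ × ℝ, sqrtDet σ C r / lapse σ r *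
      (truncatedImage σ M p (r, y) * truncated q (r, y)
        - truncated p (r, y) * truncatedImage σ M q (r, y))
      ∂((volume : Measure ℝ).prod (volume.restrict (Ioc (0 : ℝ) (2 * Real.pi))))
      = 2 * Real.pi * ∫ z, sqrtDet σ C r / lapse σ r *
        (truncatedImage σ M p (r, z, 0) * truncated q (r, z, 0)
          - truncated p (r, z, 0) * truncatedImage σ M q (r, z, 0)) := by
    intro r
    have h := integral_fun_fst (μ := (volume : Measure ℝ))
      (ν := volume.restrict (Ioc (0 : ℝ) (2 * Real.pi))) fun z => sqrtDet σ C r / lapse σ r *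
        (truncatedImage σ M p (r, z, 0) * truncated q (r, z, 0)
          - truncated p (r, z, 0) * truncatedImage σ M q (r, z, 0))
    have hv : (volume.restrict (Ioc (0 : ℝ) (2 * Real.pi))).real univ = 2 * Real.pi := by
      simp [Real.pi_pos.le]
    rw [hv, smul_eq_mul] at h
    exact h
  have hF : ∀ r, 0 < r → HasDerivAt
      (fun r => 2 * Real.pi * (-C⁻¹ * (cutoff r ^ 2 * wronskian p q r)))
      (∫ y : ℝ × ℝ, sqrtDet σ C r / lapse σ r *
        (truncatedImage σ M p (r, y) * truncated q (r, y)
          - truncated p (r, y) * truncatedImage σ M q (r, y))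
        ∂((volume : Measure ℝ).prod (volume.restrict (Ioc (0 : ℝ) (2 * Real.pi))))) r := by
    intro r hr
    rw [hinner, integral_boundary_form hC p q hr]
    refine (((((hasDerivAt_cutoff r).pow 2).mul (hasDerivAt_wronskian p q hr)).const_mul
      (-C⁻¹)).const_mul (2 * Real.pi)).congr_deriv ?_
    simp only [Pi.pow_apply]
    ring
  rw [integral_sliceMeasure]
  simp only [smul_eq_mul]
  rw [coordMeasure] at hint' ⊢
  rw [integral_prod _ hint', integral_Ioi_deriv_eq_neg (l := 2 * Real.pi * (-C⁻¹ * (1 ^ 2 * l))) hF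
    hint'.integral_prod_left]
  · ring
  · refine (((Tendsto.pow (tendsto_const_nhds.congr' ?_) 2).mul hl).const_mul _).const_mul _
    filter_upwards [mem_nhdsWithin_of_mem_nhds (Iio_mem_nhds one_pos)] with r hr
    exact (cutoff_of_le_one (le_of_lt hr)).symm
  · refine tendsto_const_nhds.congr' ?_
    filter_upwards [Ici_mem_atTop 2] with r hr
    rw [cutoff_of_two_le hr]
    ring

/-- The expansions starting with `g` and with `g log r` have Wronskian `-∫ g²` at the axis. -/
theorem tendsto_wronskian (g : axialTest) {η : ℝ} (hη : 0 < η) {W₁ W₂ : LogSum axialTest}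
    (h₁ : W₁ ∈ order axialTest η) (h₂ : W₂ ∈ order axialTest η) :
    Tendsto (wronskian (Finsupp.single 0 (g, 0) + W₁) (Finsupp.single 0 (0, g) + W₂)) (𝓝[>] 0)
      (𝓝 (-axialPairing g g)) := by
  have e1 : euler (Finsupp.single 0 (g, (0 : axialTest))) = 0 := by simp [euler_single]
  have e2 : euler (Finsupp.single 0 ((0 : axialTest), g)) = Finsupp.single 0 (g, 0) := by
    simp [euler_single]
  have m1 : (Finsupp.single 0 (g, (0 : axialTest)) : LogSum axialTest) ∈ order axialTest 0 :=
    single_mem le_rfl _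
  have m2 : (Finsupp.single 0 ((0 : axialTest), g) : LogSum axialTest) ∈ order axialTest 0 :=
    single_mem le_rfl _
  have hη0 : 0 < η + 0 := by linarith
  have h0η : 0 < 0 + η := by linarith
  have t1 := tendsto_pairing axialPairing hη0 (euler_mem h₁) (add_mem m2 (order_anti hη.le h₂))
  have t2 := tendsto_pairing axialPairing h0η m1 (euler_mem h₂)
  have t3 := tendsto_pairing axialPairing hη0 h₁ (add_mem m1 (order_anti hη.le (euler_mem h₂)))
  have t := ((t1.sub (t2.add t3)).sub_const (axialPairing g g))
  simp only [add_zero, sub_zero, zero_sub] at t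
  refine t.congr fun r => ?_
  have eg : eval r (Finsupp.single 0 (g, (0 : axialTest))) = g := by simp [eval_single]
  simp only [wronskian, map_add, e1, e2, eg, LinearMap.add_apply, zero_add]
  ring

theorem quantumMechanicallySingular {σ C : ℝ} (hσ : σ ≠ 1 / 2) (hC : 0 < C) (M : ℝ) :
    QuantumMechanicallySingular σ hC M := by
  obtain ⟨g, hg⟩ := exists_axialPairing_self_ne_zero
  have hη : 0 < min 2 (4 * σ + 2 * alpha σ) := lt_min two_pos (mass_exponent_pos σ)
  have m1 : (Finsupp.single 0 (g, (0 : axialTest)) : LogSum axialTest) ∈ order axialTest 0 :=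
    single_mem le_rfl _
  have m2 : (Finsupp.single 0 ((0 : axialTest), g) : LogSum axialTest) ∈ order axialTest 0 :=
    single_mem le_rfl _
  obtain ⟨W₁, hW₁, h₁⟩ := exists_correction (M ^ 2) (mass_exponent_pos σ) axialLaplacian m1
    (by simp [euler_single]) (alpha σ + 1)
  obtain ⟨W₂, hW₂, h₂⟩ := exists_correction (M ^ 2) (mass_exponent_pos σ) axialLaplacian m2
    (by simp [euler_single]) (alpha σ + 1)
  have o1 := add_mem m1 (order_anti hη.le hW₁)
  have o2 := add_mem m2 (order_anti hη.le hW₂)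
  have u1 := truncated_memLp hσ hC o1
  have u2 := truncated_memLp hσ hC o2
  have w1 := truncatedImage_memLp (M := M) hσ hC o1 h₁
  have w2 := truncatedImage_memLp (M := M) hσ hC o2 h₂
  refine l2Operator_not_isEssentiallySelfAdjoint _ _ _ _ _ u1 w1 u2 w2
    (fun f => integral_truncated_mul_kleinGordon hC M _ f.2)
    (fun f => integral_truncated_mul_kleinGordon hC M _ f.2) ?_
  rw [integral_boundary_form_eq hC _ _ ((w1.integrable_mul u2).sub (u1.integrable_mul w2))
    (tendsto_wronskian g hη hW₁ hW₂)]
  exact mul_ne_zero (mul_ne_zero two_ne_zero Real.pi_ne_zero)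
    (mul_ne_zero (inv_ne_zero hC.ne') (neg_ne_zero.2 hg))

end LeviCivita

end

open LeviCivita in
theorem mainTheorem1 (σ C : ℝ) (hC : 0 < C) (hσ0 : σ ≠ 0) (hσ : σ ≠ 1 / 2) (M : ℝ) :
    -- the radial Klein–Gordon equation in Schrödinger form, for all separation constants
    (∀ (k : ℝ) (m : ℤ),
      (∀ (lam : ℂ) (R : ℝ → ℂ), IsRadialSolution σ C M k m lam R ↔
        IsSolution (potential σ C M k m) (C * lam / alpha σ) (toSchrodinger σ C R)) ∧
      LimitPointAtInfinity (potential σ C M k m) ∧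
      Asymptotics.IsEquivalent (𝓝[>] (0 : ℝ)) (potential σ C M k m)
        (fun x => -1 / (4 * x ^ 2)) ∧
      LimitCircleAtZero (potential σ C M k m) ∧
      ¬ IsEssentiallySelfAdjoint
          (schrodingerOperator (potential σ C M k m) (potential_continuousOn hσ hC M k m))) ∧
    -- the change of variables preserves the Hilbert space norm
    (∀ R : ℝ → ℂ,
      ∫⁻ r in Ioi (0 : ℝ), ENNReal.ofReal (sqrtDet σ C r / lapse σ r) * ‖R r‖ₑ ^ 2 =
        ∫⁻ x in Ioi (0 : ℝ), ‖toSchrodinger σ C R x‖ₑ ^ 2) ∧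
    -- the limiting equation at zero
    (∀ ψ : ℝ → ℂ, IsSolution (fun x => -1 / (4 * x ^ 2)) 0 ψ ↔
      ∃! c : ℂ × ℂ, ∀ x : ℝ, 0 < x →
        ψ x = c.1 * (√x : ℂ) + c.2 * ((√x : ℂ) * (Real.log x : ℂ))) ∧
    SquareIntegrableAtZero (fun x => (√x : ℂ)) ∧
    SquareIntegrableAtZero (fun x => (√x : ℂ) * (Real.log x : ℂ)) ∧
    QuantumMechanicallySingular σ hC M :=
  ⟨fun k m => ⟨fun _ _ => isRadialSolution_iff_isSolution hC hσ,
      potential_limitPointAtInfinity hσ hC M k m, potential_isEquivalent hσ0 hσ hC M k m,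
      limitCircleAtZero_of_tendsto (sq_mul_potential_tendsto hσ0 hσ hC M k m),
      schrodingerOperator_not_isEssentiallySelfAdjoint _
        (sq_mul_potential_tendsto hσ0 hσ hC M k m)⟩,
    lintegral_eq_lintegral_toSchrodinger hσ hC, isSolution_limiting_iff,
    squareIntegrableAtZero_sqrt, squareIntegrableAtZero_sqrt_mul_log,
    quantumMechanicallySingular hσ hC M⟩
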